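/- Let $(V,\Omega)$ be a real symplectic vector space of finite dimension $2n$, and let $\mathcal R_0$ be the Lie group with global coordinates $(a,x,z)\in\mathbb R\times V\times\mathbb R$ and multiplication $$(a,x,z)(a',x',z')=\Big(a+a',\;e^{-a'}x+x',\;e^{-2a'}z+z'+\tfrac12\,\Omega(x,x')e^{-a'}\Big),$$ so that $\dim\mathcal R_0=2n+2$. Let $dx$ be the Liouville measure of $(V,\Omega)$ (Lebesgue measure in symplectic coordinates), and equip $\mathcal R_0$ with the left Haar measure $dg=2\pi^{-\frac12\dim\mathcal R_0}\,da\,dx\,dz$, which is used for all integrals and for $L^2(\mathcal R_0)=L^2(\mathcal R_0,dg;\mathbb C)$. Put $S_V(x_0,x_1,x_2)=\Omega(x_0,x_1)+\Omega(x_1,x_2)+\Omega(x_2,x_0)$. For $g_i=(a_i,x_i,z_i)\in\mathcal R_0$, $i=0,1,2$, set $$S(g_0,g_1,g_2)=S_V\big(\cosh(a_1-a_2)x_0,\cosh(a_2-a_0)x_1,\cosh(a_0-a_1)x_2\big)-\sinh(2(a_0-a_1))z_2-\sinh(2(a_1-a_2))z_0-\sinh(2(a_2-a_0))z_1,$$ $$A(g_0,g_1,g_2)=\Big[\cosh(2(a_1-a_2))\cosh(2(a_2-a_0))\cosh(2(a_0-a_1))\,\big[\cosh(a_1-a_2)\cosh(a_2-a_0)\cosh(a_0-a_1)\big]^{\dim\mathcal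 R_0-2}\Big]^{1/2}.$$ Let $\theta\in\mathbb R\setminus\{0\}$. For all $u,v\in C_c^\infty(\mathcal R_0)$ (complex valued) and all $g_0\in\mathcal R_0$, the integral $$(u\star^{(2)}_\theta v)(g_0)=\frac1{\theta^{\dim\mathcal R_0}}\int_{\mathcal R_0\times\mathcal R_0}A(g_0,g_1,g_2)\,e^{\frac{2i}{\theta}S(g_0,g_1,g_2)}\,u(g_1)v(g_2)\,dg_1\,dg_2$$ converges absolutely, and the following hold. (1) The function $u\star^{(2)}_\theta v$ belongs to $L^2(\mathcal R_0)$ for all $u,v\in C_c^\infty(\mathcal R_0)$, and $\star^{(2)}_\theta$ extends uniquely to a bounded bilinear map $\star^{(2)}_\theta:L^2(\mathcal R_0)\times L^2(\mathcal R_0)\to L^2(\mathcal R_0)$. (2) The extended product is left-invariant: $(\lambda_gf)\star^{(2)}_\theta(\lambda_gh)=\lambda_g(f\star^{(2)}_\theta h)$ for all $g\in\mathcal R_0$ and $f,h\in L^2(\mathcal R_0)$, where $(\lambda_gf)(g')=f(g^{-1}g')$. (3) With complex conjugation $f\mapsto\bar f$ as involution and the inner product of $L^2(\mathcal R_0)$,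 the extended product makes $L^2(\mathcal R_0)$ a Hilbert algebra: the product is associative, $\overline{f\star^{(2)}_\theta h}=\bar h\star^{(2)}_\theta\bar f$, $\langle f,h\rangle=\langle\bar h,\bar f\rangle$, $\langle f\star^{(2)}_\theta h,k\rangle=\langle h,\bar f\star^{(2)}_\theta k\rangle$, left multiplications are bounded, and the products $f\star^{(2)}_\theta h$ span a dense subspace. (4) The product is strongly closed: for all $u,v\in C_c^\infty(\mathcal R_0)$ the function $u\star^{(2)}_\theta v$ is integrable and $$\int_{\mathcal R_0}u\star^{(2)}_\theta v\,dg=\int_{\mathcal R_0}uv\,dg .$$ -/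

import Mathlib

open MeasureTheory
open scoped ENNReal NNReal ContDiff

noncomputable section

namespace OscKernel

variable {V : Type*} [NormedAddCommGroup V] [NormedSpace ℝ V]

/-- The group `R₀ = A N` attached to a bilinear form `Ω` on `V` (a symplectic form in all the
applications), in the global coordinates `(a, x, z) ∈ ℝ × V × ℝ`.  The norm, the topology, the
smooth structure and the Borel sets are those of the coordinate space. -/
def R0 (_Ω : V →ₗ[ℝ] V →ₗ[ℝ] ℝ) : Type _ := ℝ × V × ℝ

namespace R0

variable (Ω : V →ₗ[ℝ] V →ₗ[ℝ] ℝ)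

instance : NormedAddCommGroup (R0 Ω) := inferInstanceAs (NormedAddCommGroup (ℝ × V × ℝ))

instance : NormedSpace ℝ (R0 Ω) := inferInstanceAs (NormedSpace ℝ (ℝ × V × ℝ))

instance [MeasurableSpace V] : MeasurableSpace (R0 Ω) :=
  inferInstanceAs (MeasurableSpace (ℝ × V × ℝ))

variable {Ω}

/-- The coordinate `a ∈ ℝ`. -/
def a (g : R0 Ω) : ℝ := g.1

/-- The coordinate `x ∈ V`. -/
def x (g : R0 Ω) : V := g.2.1

/-- The coordinate `z ∈ ℝ`. -/
def z (g : R0 Ω) : ℝ := g.2.2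

/-- The point with coordinates `(a, x, z)`. -/
def mk (a : ℝ) (x : V) (z : ℝ) : R0 Ω := (a, x, z)

theorem ext' {g h : R0 Ω} (ha : g.a = h.a) (hx : g.x = h.x) (hz : g.z = h.z) : g = h :=
  Prod.ext ha (Prod.ext hx hz)

/-- The multiplication law
`(a,x,z)(a',x',z') = (a + a', e^{-a'} x + x', e^{-2a'} z + z' + ½ Ω(x,x') e^{-a'})`. -/
instance : Mul (R0 Ω) where
  mul g h := mk (g.a + h.a) (Real.exp (-h.a) • g.x + h.x)
    (Real.exp (-2 * h.a) * g.z + h.z + 1 / 2 * Ω g.x h.x * Real.exp (-h.a))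

instance : One (R0 Ω) where
  one := mk 0 0 0

/-- The inverse; the term with `Ω(x,x)` vanishes when `Ω` is alternating. -/
instance : Inv (R0 Ω) where
  inv g := mk (-g.a) (-(Real.exp g.a • g.x))
    (-(Real.exp (2 * g.a) * g.z) + 1 / 2 * Ω g.x g.x * Real.exp (2 * g.a))

@[simp] theorem mul_a (g h : R0 Ω) : (g * h).a = g.a + h.a := rfl
@[simp] theorem mul_x (g h : R0 Ω) : (g * h).x = Real.exp (-h.a) • g.x + h.x := rfl
@[simp] theorem mul_z (g h : R0 Ω) : (g * h).z =
    Real.exp (-2 * h.a) * g.z + h.z + 1 / 2 * Ω g.x h.x * Real.exp (-h.a) := rfl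
@[simp] theorem one_a : (1 : R0 Ω).a = 0 := rfl
@[simp] theorem one_x : (1 : R0 Ω).x = 0 := rfl
@[simp] theorem one_z : (1 : R0 Ω).z = 0 := rfl
@[simp] theorem inv_a (g : R0 Ω) : g⁻¹.a = -g.a := rfl
@[simp] theorem inv_x (g : R0 Ω) : g⁻¹.x = -(Real.exp g.a • g.x) := rfl
@[simp] theorem inv_z (g : R0 Ω) : g⁻¹.z =
    -(Real.exp (2 * g.a) * g.z) + 1 / 2 * Ω g.x g.x * Real.exp (2 * g.a) := rfl

instance : Group (R0 Ω) :=
  Group.ofLeftAxioms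
    (fun g h k => by
      apply ext'
      · simp [add_assoc]
      · simp only [mul_x, mul_a, smul_add, smul_smul, ← Real.exp_add, add_assoc]
        congr 3
        ring
      · simp only [mul_x, mul_a, mul_z, map_add, map_smul, LinearMap.add_apply,
          LinearMap.smul_apply, smul_eq_mul, mul_add, neg_add, Real.exp_add]
        have h2 : Real.exp (-2 * k.a) = Real.exp (-k.a) * Real.exp (-k.a) := by
          rw [← Real.exp_add]; congr 1; ring
        rw [h2]
        ring)
    (fun g => by apply ext' <;> simp)
    (fun g => by
      apply ext'
      · simp
      · simp [smul_smul, ← Real.exp_add]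
      · have h2 : Real.exp (2 * g.a) = Real.exp g.a * Real.exp g.a := by
          rw [← Real.exp_add]; congr 1; ring
        have h3 : Real.exp (-2 * g.a) = Real.exp (-g.a) * Real.exp (-g.a) := by
          rw [← Real.exp_add]; congr 1; ring
        have h4 : Real.exp g.a * Real.exp (-g.a) = 1 := by
          rw [← Real.exp_add]; simp
        simp only [mul_z, inv_z, inv_x, map_neg, LinearMap.neg_apply, map_smul,
          LinearMap.smul_apply, smul_eq_mul, one_z, h2, h3]
        linear_combination
          (-(g.z) + 1 / 2 * Ω g.x g.x) * (1 + Real.exp g.a * Real.exp (-g.a)) * h4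
            - 1 / 2 * Ω g.x g.x * h4)

end R0

/-- The dimension of `R₀`. -/
def dimR0 (V : Type*) [NormedAddCommGroup V] [NormedSpace ℝ V] : ℕ := Module.finrank ℝ V + 2

section Measure

variable [FiniteDimensional ℝ V] [MeasurableSpace V] [BorelSpace V]

/-- The Liouville measure of `(V, Ω)`: the translation-invariant measure giving the
parallelepiped spanned by a basis `b` the mass `|det (Ω (b i) (b j))|^{1/2}`.  In linear
coordinates in which `Ω` is the standard symplectic form, this is Lebesgue measure. -/
def liouville (Ω : V →ₗ[ℝ] V →ₗ[ℝ] ℝ) : Measure V :=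
  Real.toNNReal (Real.sqrt |(Matrix.of fun i j =>
    Ω (Module.finBasis ℝ V i) (Module.finBasis ℝ V j)).det|) • (Module.finBasis ℝ V).addHaar

/-- The left Haar measure `2 π^{-dim R₀ / 2} da dx dz` of `R₀`, where `dx` is the Liouville
measure of `V`. -/
def haarR0 (Ω : V →ₗ[ℝ] V →ₗ[ℝ] ℝ) : Measure (R0 Ω) :=
  (Real.toNNReal (2 / Real.sqrt (Real.pi ^ dimR0 V)) •
    (volume : Measure ℝ).prod ((liouville Ω).prod (volume : Measure ℝ)) : Measure (ℝ × V × ℝ))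

instance (Ω : V →ₗ[ℝ] V →ₗ[ℝ] ℝ) : SigmaFinite (liouville Ω) := by
  unfold liouville; infer_instance

instance (Ω : V →ₗ[ℝ] V →ₗ[ℝ] ℝ) : (liouville Ω).IsAddLeftInvariant := by
  unfold liouville; infer_instance

theorem measurePreserving_mul_left (Ω : V →ₗ[ℝ] V →ₗ[ℝ] ℝ) (g : R0 Ω) :
    MeasurePreserving (fun h : R0 Ω => g * h) (haarR0 Ω) (haarR0 Ω) := by
  have hΩ : Continuous (fun y : V => Ω g.x y) := (Ω g.x).continuous_of_finiteDimensional
  have h1 : MeasurePreserving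
      (fun h : ℝ × V × ℝ => ((g.a + h.1, (Real.exp (-h.1) • g.x + h.2.1,
        Real.exp (-2 * h.1) * g.z + h.2.2 + 1 / 2 * Ω g.x h.2.1 * Real.exp (-h.1))) : ℝ × V × ℝ))
      ((volume : Measure ℝ).prod ((liouville Ω).prod (volume : Measure ℝ)))
      ((volume : Measure ℝ).prod ((liouville Ω).prod (volume : Measure ℝ))) := by
    refine MeasurePreserving.skew_product (f := fun a : ℝ => g.a + a)
      (g := fun (a : ℝ) (p : V × ℝ) => ((Real.exp (-a) • g.x + p.1,
        Real.exp (-2 * a) * g.z + p.2 + 1 / 2 * Ω g.x p.1 * Real.exp (-a)) : V × ℝ))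
      (MeasureTheory.measurePreserving_add_left volume g.a) ?_ ?_
    · apply Continuous.measurable
      unfold Function.uncurry
      fun_prop
    · refine Filter.Eventually.of_forall fun a => MeasurePreserving.map_eq ?_
      refine MeasurePreserving.skew_product (f := fun y : V => Real.exp (-a) • g.x + y)
        (g := fun (y : V) (t : ℝ) =>
          Real.exp (-2 * a) * g.z + t + 1 / 2 * Ω g.x y * Real.exp (-a))
        (MeasureTheory.measurePreserving_add_left (liouville Ω) _) ?_ ?_
      · apply Continuous.measurable
        unfold Function.uncurry
        fun_prop
      · refine Filter.Eventually.of_forall fun y => ?_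
        have := (MeasureTheory.measurePreserving_add_left (volume : Measure ℝ)
          (Real.exp (-2 * a) * g.z + 1 / 2 * Ω g.x y * Real.exp (-a))).map_eq
        rw [← this]
        congr 1
        funext t
        ring
  exact h1.smul_measure _

end Measure

section Kernel

variable {Ω : V →ₗ[ℝ] V →ₗ[ℝ] ℝ}

/-- `S_V(x₀,x₁,x₂) = Ω(x₀,x₁) + Ω(x₁,x₂) + Ω(x₂,x₀)`. -/
def SV (Ω : V →ₗ[ℝ] V →ₗ[ℝ] ℝ) (x₀ x₁ x₂ : V) : ℝ := Ω x₀ x₁ + Ω x₁ x₂ + Ω x₂ x₀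

/-- The phase `S` of the three-point kernel. -/
def phase (g₀ g₁ g₂ : R0 Ω) : ℝ :=
  SV Ω (Real.cosh (g₁.a - g₂.a) • g₀.x) (Real.cosh (g₂.a - g₀.a) • g₁.x)
      (Real.cosh (g₀.a - g₁.a) • g₂.x)
    - (Real.sinh (2 * (g₀.a - g₁.a)) * g₂.z + Real.sinh (2 * (g₁.a - g₂.a)) * g₀.z
      + Real.sinh (2 * (g₂.a - g₀.a)) * g₁.z)

/-- The amplitude `A` of the three-point kernel. -/
def amplitude (g₀ g₁ g₂ : R0 Ω) : ℝ :=
  Real.sqrt (Real.cosh (2 * (g₁.a - g₂.a)) * Real.cosh (2 * (g₂.a - g₀.a))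
      * Real.cosh (2 * (g₀.a - g₁.a))
    * (Real.cosh (g₁.a - g₂.a) * Real.cosh (g₂.a - g₀.a) * Real.cosh (g₀.a - g₁.a))
        ^ (dimR0 V - 2))

/-- The integrand `A e^{(2i/θ) S} u ⊗ v` at the point `g₀`. -/
def integrand (θ : ℝ) (u v : R0 Ω → ℂ) (g₀ : R0 Ω) (p : R0 Ω × R0 Ω) : ℂ :=
  (amplitude g₀ p.1 p.2 : ℂ) * Complex.exp (2 * Complex.I / (θ : ℂ) * (phase g₀ p.1 p.2 : ℂ))
    * (u p.1 * v p.2)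

/-- Smooth compactly supported functions on `R₀`. -/
def IsTest (u : R0 Ω → ℂ) : Prop := ContDiff ℝ ∞ u ∧ HasCompactSupport u

variable [FiniteDimensional ℝ V] [MeasurableSpace V] [BorelSpace V]

/-- The product `u ⋆ v = θ^{-dim R₀} ∫_{R₀ × R₀} A e^{(2i/θ) S} u ⊗ v`. -/
def starProd (θ : ℝ) (u v : R0 Ω → ℂ) (g₀ : R0 Ω) : ℂ :=
  1 / (θ : ℂ) ^ dimR0 V * ∫ p, integrand θ u v g₀ p ∂(haarR0 Ω).prod (haarR0 Ω)

/-- The Hilbert space `L²(R₀)` of the left Haar measure. -/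
abbrev L2 (Ω : V →ₗ[ℝ] V →ₗ[ℝ] ℝ) : Type _ := Lp ℂ 2 (haarR0 Ω)

/-- The left regular representation: `(λ_g f)(h) = f(g⁻¹ h)`. -/
def leftReg (g : R0 Ω) : L2 Ω →+ L2 Ω :=
  Lp.compMeasurePreserving (fun h : R0 Ω => g⁻¹ * h) (measurePreserving_mul_left Ω g⁻¹)

/-- The bilinear map `M` on `L²(R₀)` extends the product `⋆` of test functions. -/
def Extends (θ : ℝ) (M : L2 Ω →L[ℂ] L2 Ω →L[ℂ] L2 Ω) : Prop :=
  ∀ u v : R0 Ω → ℂ, IsTest u → IsTest v →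
    ∃ (hu : MemLp u 2 (haarR0 Ω)) (hv : MemLp v 2 (haarR0 Ω))
      (huv : MemLp (starProd θ u v) 2 (haarR0 Ω)),
      M (hu.toLp u) (hv.toLp v) = huv.toLp (starProd θ u v)

end Kernel

/-- A Hilbert algebra structure on a complex inner product space `H`: an associative bilinear
product and a conjugate-linear involutive anti-automorphism `J`, with
`⟨x, y⟩ = ⟨J y, J x⟩`, `⟨x y, z⟩ = ⟨y, (J x) z⟩`, bounded left multiplications, and products
spanning a dense subspace. -/
structure IsHilbertAlgebra {H : Type*} [NormedAddCommGroup H] [InnerProductSpace ℂ H]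
    (mul : H → H → H) (J : H → H) : Prop where
  add_mul : ∀ x y w, mul (x + y) w = mul x w + mul y w
  mul_add : ∀ x y w, mul x (y + w) = mul x y + mul x w
  smul_mul : ∀ (c : ℂ) x y, mul (c • x) y = c • mul x y
  mul_smul : ∀ (c : ℂ) x y, mul x (c • y) = c • mul x y
  mul_assoc : ∀ x y w, mul (mul x y) w = mul x (mul y w)
  inv_add : ∀ x y, J (x + y) = J x + J y
  inv_smul : ∀ (c : ℂ) x, J (c • x) = (starRingEnd ℂ) c • J x
  inv_inv : ∀ x, J (J x) = x
  inv_mul : ∀ x y, J (mul x y) = mul (J y) (J x)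
  inner_inv : ∀ x y, inner ℂ x y = inner ℂ (J y) (J x)
  inner_mul : ∀ x y w, inner ℂ (mul x y) w = inner ℂ y (mul (J x) w)
  bounded : ∀ x, ∃ C : ℝ, ∀ y, ‖mul x y‖ ≤ C * ‖y‖
  dense : Dense (Submodule.span ℂ {w | ∃ x y, w = mul x y} : Set H)

end OscKernel

end

noncomputable section

set_option linter.unusedSectionVars false

/-! The product is, in disguise, composition of Hilbert–Schmidt kernels. Take Darboux coordinates `V
≃ E × E` and write a point of `R0 Ω` as `(w, ζ)` with `w = (a, b)` and `ζ = (z, η)`, both in `ℝ ×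
E`. The amplitude depends on the `w`'s alone, and the phase is linear in the three `ζ`'s: it is the
sum over cyclic permutations of `⟨ζ₀, freq w₀ w₁ w₂⟩` (`phase_chart`). Integrating out the `ζ`'s
therefore takes partial Fourier transforms, and the trilinear form `∫ U₀ · (U₁ ⋆ U₂)` becomes the
integral over `(w₀, w₁, w₂)` of the amplitude times three such transforms (`integral_mul_starW`).

Now substitute `w₀ = mid R P`, `w₁ = mid P Q`, `w₂ = mid Q R`. The three frequencies become `gap R
P`, `gap P Q`, `gap Q R` (`freq_mid`), so each factor depends on only two of the points `P, Q, R`.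
The Jacobian (`changeVar_triple`) absorbs the powers of `cosh` in the amplitude and leaves one
factor `√cosh` for each pair. Up to a positive constant the trilinear form is thus the trace of a
product of three kernels `ker κ Uᵢ` (`exists_integral_tri`). By Plancherel, and because `(mid, gap)`
has Jacobian proportional to `cosh (P.1 - Q.1)`, the map `U ↦ ker κ U` is a multiple of an isometry;
its range is total. It extends to a unitary from `L²(R₀)` onto the square integrable kernels
(`exists_unitary_ker`) and turns conjugation into the adjoint (`unitary_star`). The bounded
extension and the Hilbert algebra axioms are then pulled back from `HS.isHilbertAlgebra`
(`exists_extension`).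

Left invariance holds because phase and amplitude are invariant under simultaneous left translation
of the three points (`phase_mul_left`), first for test functions and then by density.

Strong closedness needs integrability and a value. Integrability comes from integration by parts in
the second point: oscillatory integrals with hyperbolic amplitudes span a space stable under
multiplication by the `x` and `z` coordinates of the first point (`form_mul_osc_mem`,
`z_mul_osc_mem`), and its members decay faster than any exponential in `|a|` (`exists_norm_osc_le`).
For the value, `u ⋆ v` is in `ζ₀` the Fourier transform of a continuous compactly supported function
(`starW_eq_ft`), so by inversion its integral over `ζ₀` is that function at frequency zero. Zero
frequency forces `w₂ = w₁`; one more change of variables and Parseval give a multiple of `∫ u v`,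
and the normalisation of the Haar measure makes the multiple equal to 1 (`starConst_mul_ftConst`).
-/

namespace OscKernel

/-! ### Preliminaries on square integrable functions. -/

section SquareIntegrable

variable {X : Type*} [MeasurableSpace X] {μ : Measure X}

theorem eLpNorm_two_sq (f : X → ℂ) : eLpNorm f 2 μ ^ 2 = ∫⁻ x, ‖f x‖ₑ ^ 2 ∂μ := by
  rw [eLpNorm_eq_lintegral_rpow_enorm_toReal (by norm_num) (by norm_num)]
  simp only [ENNReal.toReal_ofNat, ENNReal.rpow_two]
  rw [← ENNReal.rpow_natCast, ← ENNReal.rpow_mul]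
  norm_num

theorem memLp_two_of_lintegral {f : X → ℂ} (hf : AEStronglyMeasurable f μ)
    (h : ∫⁻ x, ‖f x‖ₑ ^ 2 ∂μ < ⊤) : MemLp f 2 μ := by
  refine ⟨hf, ?_⟩
  rw [← eLpNorm_two_sq] at h
  by_contra hc
  rw [not_lt, top_le_iff] at hc
  simp [hc] at h

theorem lintegral_lt_top_of_memLp_two {f : X → ℂ} (hf : MemLp f 2 μ) :
    ∫⁻ x, ‖f x‖ₑ ^ 2 ∂μ < ⊤ := by
  rw [← eLpNorm_two_sq]
  exact ENNReal.pow_lt_top hf.2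

theorem lintegral_mul_sq_le {f g : X → ℝ≥0∞} (hf : AEMeasurable f μ) (hg : AEMeasurable g μ) :
    (∫⁻ x, f x * g x ∂μ) ^ 2 ≤ (∫⁻ x, f x ^ 2 ∂μ) * ∫⁻ x, g x ^ 2 ∂μ := by
  have h := ENNReal.lintegral_mul_le_Lp_mul_Lq μ Real.HolderConjugate.two_two hf hg
  simp only [Pi.mul_apply, ENNReal.rpow_two] at h
  calc (∫⁻ x, f x * g x ∂μ) ^ 2
      ≤ ((∫⁻ a, f a ^ 2 ∂μ) ^ (1 / 2 : ℝ) * (∫⁻ a, g a ^ 2 ∂μ) ^ (1 / 2 : ℝ)) ^ 2 := by gcongr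
    _ = _ := by
      rw [mul_pow, ← ENNReal.rpow_natCast, ← ENNReal.rpow_natCast, ← ENNReal.rpow_mul,
        ← ENNReal.rpow_mul]
      norm_num

theorem lt_top_of_sq_lt_top {a : ℝ≥0∞} (h : a ^ 2 < ⊤) : a < ⊤ := by
  by_contra hc
  rw [not_lt, top_le_iff] at hc
  simp [hc] at h

theorem Lp_star_add (f g : Lp ℂ 2 μ) : star (f + g) = star f + star g := by
  apply Lp.ext
  filter_upwards [Lp.coeFn_star (f + g), Lp.coeFn_add f g, Lp.coeFn_add (star f) (star g),
    Lp.coeFn_star f, Lp.coeFn_star g] with x h1 h2 h3 h4 h5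
  rw [h1, h3, Pi.star_apply, h2, Pi.add_apply, Pi.add_apply, h4, h5, Pi.star_apply, Pi.star_apply,
    star_add]

theorem Lp_star_smul (c : ℂ) (f : Lp ℂ 2 μ) : star (c • f) = (starRingEnd ℂ) c • star f := by
  apply Lp.ext
  filter_upwards [Lp.coeFn_star (c • f), Lp.coeFn_smul c f,
    Lp.coeFn_smul ((starRingEnd ℂ) c) (star f), Lp.coeFn_star f] with x h1 h2 h3 h4
  simp [h1, h2, h3, h4]

theorem Lp_norm_star (f : Lp ℂ 2 μ) : ‖star f‖ = ‖f‖ := by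
  refine le_antisymm ?_ ?_ <;> refine Lp.norm_le_norm_of_ae_le ?_ <;>
    filter_upwards [Lp.coeFn_star f] with x h <;> simp [h]

theorem continuous_Lp_star : Continuous (star : Lp ℂ 2 μ → Lp ℂ 2 μ) := by
  refine (LipschitzWith.of_dist_le_mul (K := 1) fun f g => ?_).continuous
  have h : star f - star g = star (f - g) := by
    rw [sub_eq_add_neg, sub_eq_add_neg, Lp_star_add, ← neg_one_smul ℂ g, Lp_star_smul]
    simp
  rw [dist_eq_norm, dist_eq_norm, h, Lp_norm_star]
  simp

theorem L2_inner_eq (F G : Lp ℂ 2 μ) :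
    inner ℂ F G = ∫ z, (starRingEnd ℂ) (F z) * G z ∂μ := by
  rw [L2.inner_def]
  refine integral_congr_ae (Filter.Eventually.of_forall fun z => ?_)
  simp [mul_comm]

/-- The exceptional null set of `y` depends on `g`; separability of `L²` allows `D` to be replaced
by a countable dense subset, so that one null set serves all `g` and almost every slice is
orthogonal to a dense set. -/
theorem ae_eq_zero_of_dense {Y : Type*} [MeasurableSpace Y] {ν : Measure Y} [SFinite μ]
    [SFinite ν] [IsSeparable μ] {K : X × Y → ℂ} (hK : Measurable K)
    (hK2 : ∫⁻ z, ‖K z‖ₑ ^ 2 ∂μ.prod ν < ⊤) {D : Set (Lp ℂ 2 μ)} (hD : Dense D)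
    (h : ∀ g ∈ D, ∀ᵐ y ∂ν, ∫ x, (starRingEnd ℂ) (g x) * K (x, y) ∂μ = 0) :
    K =ᵐ[μ.prod ν] 0 := by
  have : Fact ((1 : ℝ≥0∞) ≤ 2) := ⟨by norm_num⟩
  have : Fact ((2 : ℝ≥0∞) ≠ ⊤) := ⟨by norm_num⟩
  obtain ⟨t, htD, htc, htd⟩ := hD.exists_countable_dense_subset
  have h1 : ∀ᵐ y ∂ν, ∀ g ∈ t, ∫ x, (starRingEnd ℂ) (g x) * K (x, y) ∂μ = 0 :=
    (ae_ball_iff htc).2 fun g hg => h g (htD hg)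
  have h2 : ∀ᵐ y ∂ν, ∫⁻ x, ‖K (x, y)‖ₑ ^ 2 ∂μ < ⊤ := by
    refine ae_lt_top (Measurable.lintegral_prod_left' (f := fun z => ‖K z‖ₑ ^ 2) (by fun_prop)) ?_
    rw [← lintegral_prod_symm (fun z => ‖K z‖ₑ ^ 2) (by fun_prop)]
    exact hK2.ne
  have h3 : ∀ᵐ y ∂ν, ∀ᵐ x ∂μ, K (x, y) = 0 := by
    filter_upwards [h1, h2] with y hy1 hy2
    have hm : MemLp (fun x => K (x, y)) 2 μ :=
      memLp_two_of_lintegral (by fun_prop : Measurable _).aestronglyMeasurable hy2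
    have h0 : ∀ g ∈ t, inner ℂ g (hm.toLp _) = 0 := by
      intro g hg
      rw [L2_inner_eq, ← hy1 g hg]
      refine integral_congr_ae ?_
      filter_upwards [hm.coeFn_toLp] with x hx
      rw [hx]
    have h00 : (fun g => inner ℂ g (hm.toLp _)) = fun _ => (0 : ℂ) :=
      Continuous.ext_on htd (by fun_prop) continuous_const h0
    have h000 : hm.toLp _ = 0 := inner_self_eq_zero.1 (congrFun h00 (hm.toLp _))
    exact hm.coeFn_toLp.symm.trans (h000 ▸ Lp.coeFn_zero _ _ _)
  have h4 : ∀ᵐ w ∂ν.prod μ, K w.swap = 0 :=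
    (Measure.ae_prod_iff_ae_ae (p := fun w : Y × X => K w.swap = 0)
      (measurableSet_eq_fun (hK.comp measurable_swap) measurable_const)).2 h3
  exact Measure.measurePreserving_swap.quasiMeasurePreserving.ae h4

end SquareIntegrable

/-! ### The Hilbert algebra of square integrable kernels. -/

section Kernels

variable {X : Type*} [MeasurableSpace X] {μ : Measure X} [SigmaFinite μ]

theorem measurable_lintegral_comp {f g : X × X → ℝ≥0∞} (hf : Measurable f) (hg : Measurable g) :
    Measurable fun z : X × X => ∫⁻ q, f (z.1, q) * g (q, z.2) ∂μ :=
  Measurable.lintegral_prod_right' (f := fun w : (X × X) × X => f (w.1.1, w.2) * g (w.2, w.1.2))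
    (by fun_prop)

/-- Cauchy–Schwarz in the middle variable separates the outer variables. This submultiplicativity is
stated for nonnegative kernels so that it also controls absolute convergence in the Fubini arguments
below. -/
theorem lintegral_comp_sq_le {f g : X × X → ℝ≥0∞} (hf : Measurable f) (hg : Measurable g) :
    ∫⁻ z, (∫⁻ q, f (z.1, q) * g (q, z.2) ∂μ) ^ 2 ∂μ.prod μ
      ≤ (∫⁻ z, f z ^ 2 ∂μ.prod μ) * ∫⁻ z, g z ^ 2 ∂μ.prod μ := by
  calc ∫⁻ z, (∫⁻ q, f (z.1, q) * g (q, z.2) ∂μ) ^ 2 ∂μ.prod μ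
      ≤ ∫⁻ z, (∫⁻ q, f (z.1, q) ^ 2 ∂μ) * (∫⁻ q, g (q, z.2) ^ 2 ∂μ) ∂μ.prod μ := by
        refine lintegral_mono fun z => lintegral_mul_sq_le ?_ ?_ <;> fun_prop
    _ = (∫⁻ p, ∫⁻ q, f (p, q) ^ 2 ∂μ ∂μ) * ∫⁻ r, ∫⁻ q, g (q, r) ^ 2 ∂μ ∂μ := by
        refine lintegral_prod_mul (f := fun p => ∫⁻ q, f (p, q) ^ 2 ∂μ)
          (g := fun r => ∫⁻ q, g (q, r) ^ 2 ∂μ) ?_ ?_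
        · exact (Measurable.lintegral_prod_right' (f := fun w => f w ^ 2)
            (by fun_prop)).aemeasurable
        · exact (Measurable.lintegral_prod_left' (f := fun w => g w ^ 2)
            (by fun_prop)).aemeasurable
    _ = _ := by
        rw [lintegral_prod _ (by fun_prop), lintegral_prod_symm _ (by fun_prop)]

theorem ae_lintegral_comp_lt_top {f g : X × X → ℝ≥0∞} (hf : Measurable f) (hg : Measurable g)
    (hf2 : ∫⁻ z, f z ^ 2 ∂μ.prod μ < ⊤) (hg2 : ∫⁻ z, g z ^ 2 ∂μ.prod μ < ⊤) :
    ∀ᵐ z ∂μ.prod μ, ∫⁻ q, f (z.1, q) * g (q, z.2) ∂μ < ⊤ := by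
  have h := (lintegral_comp_sq_le (μ := μ) hf hg).trans_lt (ENNReal.mul_lt_top hf2 hg2)
  filter_upwards [ae_lt_top ((measurable_lintegral_comp hf hg).pow_const 2) h.ne] with z hz
  exact lt_top_of_sq_lt_top hz

theorem lintegral_triple_lt_top {f g h : X × X → ℝ≥0∞} (hf : Measurable f) (hg : Measurable g)
    (hh : Measurable h) (hf2 : ∫⁻ z, f z ^ 2 ∂μ.prod μ < ⊤)
    (hg2 : ∫⁻ z, g z ^ 2 ∂μ.prod μ < ⊤) (hh2 : ∫⁻ z, h z ^ 2 ∂μ.prod μ < ⊤) :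
    ∫⁻ w, f (w.1.1, w.2) * g (w.2, w.1.2) * h w.1 ∂(μ.prod μ).prod μ < ⊤ := by
  rw [lintegral_prod _ (by fun_prop)]
  have e : ∀ z : X × X, ∫⁻ q, f (z.1, q) * g (q, z.2) * h z ∂μ
      = (∫⁻ q, f (z.1, q) * g (q, z.2) ∂μ) * h z := fun z =>
    lintegral_mul_const _ (by fun_prop)
  simp only [e]
  refine lt_top_of_sq_lt_top ((lintegral_mul_sq_le
    (measurable_lintegral_comp hf hg).aemeasurable hh.aemeasurable).trans_lt ?_)
  exact ENNReal.mul_lt_top ((lintegral_comp_sq_le (μ := μ) hf hg).trans_lt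
    (ENNReal.mul_lt_top hf2 hg2)) hh2

/-- Composition of integral kernels. -/
def kcomp (μ : Measure X) (F G : X × X → ℂ) (z : X × X) : ℂ := ∫ q, F (z.1, q) * G (q, z.2) ∂μ

theorem kcomp_congr {F F' G G' : X × X → ℂ} (hF : F =ᵐ[μ.prod μ] F') (hG : G =ᵐ[μ.prod μ] G') :
    kcomp μ F G =ᵐ[μ.prod μ] kcomp μ F' G' := by
  have h1 : ∀ᵐ p ∂μ, ∀ᵐ q ∂μ, F (p, q) = F' (p, q) := Measure.ae_ae_of_ae_prod hF
  have h2 : ∀ᵐ r ∂μ, ∀ᵐ q ∂μ, G (q, r) = G' (q, r) :=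
    Measure.ae_ae_of_ae_prod (Measure.measurePreserving_swap.quasiMeasurePreserving.ae hG)
  have h1' := (Measure.quasiMeasurePreserving_fst (μ := μ) (ν := μ)).ae h1
  have h2' := (Measure.quasiMeasurePreserving_snd (μ := μ) (ν := μ)).ae h2
  filter_upwards [h1', h2'] with z hz1 hz2
  refine integral_congr_ae ?_
  filter_upwards [hz1, hz2] with q hq1 hq2
  rw [hq1, hq2]

theorem stronglyMeasurable_kcomp {F G : X × X → ℂ} (hF : Measurable F) (hG : Measurable G) :
    StronglyMeasurable (kcomp μ F G) :=
  StronglyMeasurable.integral_prod_right'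
    (f := fun w : (X × X) × X => F (w.1.1, w.2) * G (w.2, w.1.2))
    (by fun_prop : Measurable _).stronglyMeasurable

theorem lintegral_kcomp_sq_le {F G : X × X → ℂ} (hF : Measurable F) (hG : Measurable G) :
    ∫⁻ z, ‖kcomp μ F G z‖ₑ ^ 2 ∂μ.prod μ
      ≤ (∫⁻ z, ‖F z‖ₑ ^ 2 ∂μ.prod μ) * ∫⁻ z, ‖G z‖ₑ ^ 2 ∂μ.prod μ := by
  refine le_trans (lintegral_mono fun z => ?_)
    (lintegral_comp_sq_le (μ := μ) (f := fun z => ‖F z‖ₑ) (g := fun z => ‖G z‖ₑ)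
      (by fun_prop) (by fun_prop))
  gcongr
  refine (enorm_integral_le_lintegral_enorm _).trans (le_of_eq ?_)
  simp [enorm_mul]

theorem ae_integrable_comp {F G : X × X → ℂ} (hF : Measurable F) (hG : Measurable G)
    (hF2 : ∫⁻ z, ‖F z‖ₑ ^ 2 ∂μ.prod μ < ⊤) (hG2 : ∫⁻ z, ‖G z‖ₑ ^ 2 ∂μ.prod μ < ⊤) :
    ∀ᵐ z ∂μ.prod μ, Integrable (fun q => F (z.1, q) * G (q, z.2)) μ := by
  filter_upwards [ae_lintegral_comp_lt_top (μ := μ) (f := fun z => ‖F z‖ₑ) (g := fun z => ‖G z‖ₑ)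
    (by fun_prop) (by fun_prop) hF2 hG2] with z hz
  refine ⟨by fun_prop, ?_⟩
  simpa [HasFiniteIntegral, enorm_mul] using hz

/-- Fubini in the two intermediate variables. Absolute convergence for almost every pair of outer
variables follows by composing `|F| ∘ |G|`, again square integrable, with `|H|`. -/
theorem kcomp_assoc {F G H : X × X → ℂ} (hF : Measurable F) (hG : Measurable G)
    (hH : Measurable H) (hF2 : ∫⁻ z, ‖F z‖ₑ ^ 2 ∂μ.prod μ < ⊤)
    (hG2 : ∫⁻ z, ‖G z‖ₑ ^ 2 ∂μ.prod μ < ⊤) (hH2 : ∫⁻ z, ‖H z‖ₑ ^ 2 ∂μ.prod μ < ⊤) :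
    kcomp μ (kcomp μ F G) H =ᵐ[μ.prod μ] kcomp μ F (kcomp μ G H) := by
  have hFG := lintegral_comp_sq_le (μ := μ) (f := fun z => ‖F z‖ₑ) (g := fun z => ‖G z‖ₑ)
    (by fun_prop) (by fun_prop)
  filter_upwards [ae_lintegral_comp_lt_top (μ := μ)
    (f := fun z => ∫⁻ q, ‖F (z.1, q)‖ₑ * ‖G (q, z.2)‖ₑ ∂μ) (g := fun z => ‖H z‖ₑ)
    (measurable_lintegral_comp (f := fun z => ‖F z‖ₑ) (g := fun z => ‖G z‖ₑ)
      (by fun_prop) (by fun_prop)) (by fun_prop)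
    (hFG.trans_lt (ENNReal.mul_lt_top hF2 hG2)) hH2] with z hz
  have hint : Integrable (Function.uncurry fun r q : X => F (z.1, q) * G (q, r) * H (r, z.2))
      (μ.prod μ) := by
    refine ⟨(by fun_prop : Measurable _).aestronglyMeasurable, ?_⟩
    rw [HasFiniteIntegral, lintegral_prod _ (by fun_prop)]
    refine lt_of_le_of_lt (le_of_eq (lintegral_congr fun r => ?_)) hz
    simp only [Function.uncurry, enorm_mul]
    exact lintegral_mul_const _ (by fun_prop)
  simp only [kcomp]
  calc ∫ r, (∫ q, F (z.1, q) * G (q, r) ∂μ) * H (r, z.2) ∂μ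
      = ∫ r, ∫ q, F (z.1, q) * G (q, r) * H (r, z.2) ∂μ ∂μ := by
        simp_rw [integral_mul_const]
    _ = ∫ q, ∫ r, F (z.1, q) * G (q, r) * H (r, z.2) ∂μ ∂μ := integral_integral_swap hint
    _ = _ := by simp_rw [mul_assoc, integral_const_mul]

/-- Pairings with a composition become absolutely convergent triple integrals, in which the
variables may be permuted freely; this gives both `HS.inner_mul` and the trace form of the star
product. -/
theorem integral_kcomp_mul {F G H : X × X → ℂ} (hF : Measurable F) (hG : Measurable G)
    (hH : Measurable H) (hF2 : ∫⁻ z, ‖F z‖ₑ ^ 2 ∂μ.prod μ < ⊤)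
    (hG2 : ∫⁻ z, ‖G z‖ₑ ^ 2 ∂μ.prod μ < ⊤) (hH2 : ∫⁻ z, ‖H z‖ₑ ^ 2 ∂μ.prod μ < ⊤) :
    Integrable (fun w : (X × X) × X => F (w.1.1, w.2) * G (w.2, w.1.2) * H w.1)
      ((μ.prod μ).prod μ) ∧
    ∫ z, kcomp μ F G z * H z ∂μ.prod μ
      = ∫ w, F (w.1.1, w.2) * G (w.2, w.1.2) * H w.1 ∂(μ.prod μ).prod μ := by
  have hint : Integrable (fun w : (X × X) × X => F (w.1.1, w.2) * G (w.2, w.1.2) * H w.1)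
      ((μ.prod μ).prod μ) := by
    refine ⟨(by fun_prop : Measurable _).aestronglyMeasurable, ?_⟩
    have := lintegral_triple_lt_top (μ := μ) (f := fun z => ‖F z‖ₑ) (g := fun z => ‖G z‖ₑ)
      (h := fun z => ‖H z‖ₑ) (by fun_prop) (by fun_prop) (by fun_prop) hF2 hG2 hH2
    simpa [HasFiniteIntegral, enorm_mul] using this
  refine ⟨hint, ?_⟩
  rw [integral_prod _ hint]
  refine integral_congr_ae (Filter.Eventually.of_forall fun z => ?_)
  simp only [kcomp]
  rw [integral_mul_const]

variable (μ) in
/-- Square integrable kernels. -/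
abbrev HS : Type _ := Lp ℂ 2 (μ.prod μ)

namespace HS

set_option linter.unusedSectionVars false

theorem measurable_coe (F : HS μ) : Measurable (F : X × X → ℂ) :=
  (Lp.stronglyMeasurable F).measurable

theorem lintegral_lt_top (F : HS μ) : ∫⁻ z, ‖F z‖ₑ ^ 2 ∂μ.prod μ < ⊤ :=
  lintegral_lt_top_of_memLp_two (Lp.memLp F)

theorem memLp_kcomp (F G : HS μ) : MemLp (kcomp μ F G) 2 (μ.prod μ) :=
  memLp_two_of_lintegral
    (stronglyMeasurable_kcomp F.measurable_coe G.measurable_coe).aestronglyMeasurable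
    ((lintegral_kcomp_sq_le F.measurable_coe G.measurable_coe).trans_lt
      (ENNReal.mul_lt_top F.lintegral_lt_top G.lintegral_lt_top))

/-- The product of square integrable kernels. -/
def mul (F G : HS μ) : HS μ := (memLp_kcomp F G).toLp _

/-- The adjoint of a square integrable kernel. -/
def adj (F : HS μ) : HS μ :=
  star (Lp.compMeasurePreserving Prod.swap Measure.measurePreserving_swap F)

theorem coeFn_mul (F G : HS μ) : (mul F G : X × X → ℂ) =ᵐ[μ.prod μ] kcomp μ F G :=
  MemLp.coeFn_toLp _

theorem coeFn_adj (F : HS μ) :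
    (adj F : X × X → ℂ) =ᵐ[μ.prod μ] fun z => (starRingEnd ℂ) (F z.swap) := by
  refine (Lp.coeFn_star _).trans ?_
  filter_upwards [Lp.coeFn_compMeasurePreserving F
    (Measure.measurePreserving_swap (μ := μ) (ν := μ))] with z hz
  rw [Pi.star_apply, hz]
  rfl

theorem norm_mul_le (F G : HS μ) : ‖mul F G‖ ≤ ‖F‖ * ‖G‖ := by
  have h := lintegral_kcomp_sq_le (μ := μ) F.measurable_coe G.measurable_coe
  simp only [← eLpNorm_two_sq] at h
  rw [← mul_pow] at h
  have h' := (ENNReal.pow_le_pow_left_iff (two_ne_zero)).1 h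
  rw [mul, Lp.norm_toLp, Lp.norm_def, Lp.norm_def, ← ENNReal.toReal_mul]
  exact ENNReal.toReal_mono (ENNReal.mul_ne_top (Lp.eLpNorm_ne_top _) (Lp.eLpNorm_ne_top _)) h'

theorem ae_integrable (F G : HS μ) :
    ∀ᵐ z ∂μ.prod μ, Integrable (fun q => F (z.1, q) * G (q, z.2)) μ :=
  ae_integrable_comp F.measurable_coe G.measurable_coe F.lintegral_lt_top G.lintegral_lt_top

theorem add_mul (F F' G : HS μ) : mul (F + F') G = mul F G + mul F' G := by
  apply Lp.ext
  refine (coeFn_mul _ _).trans (((kcomp_congr (Lp.coeFn_add F F') (ae_eq_refl _)).trans ?_).trans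
    (Lp.coeFn_add _ _).symm)
  filter_upwards [ae_integrable F G, ae_integrable F' G, coeFn_mul F G, coeFn_mul F' G]
    with z h1 h2 h3 h4
  simp only [Pi.add_apply, h3, h4, kcomp, _root_.add_mul]
  exact integral_add h1 h2

theorem mul_add (F G G' : HS μ) : mul F (G + G') = mul F G + mul F G' := by
  apply Lp.ext
  refine (coeFn_mul _ _).trans (((kcomp_congr (ae_eq_refl _) (Lp.coeFn_add G G')).trans ?_).trans
    (Lp.coeFn_add _ _).symm)
  filter_upwards [ae_integrable F G, ae_integrable F G', coeFn_mul F G, coeFn_mul F G']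
    with z h1 h2 h3 h4
  simp only [Pi.add_apply, h3, h4, kcomp, _root_.mul_add]
  exact integral_add h1 h2

theorem smul_mul (c : ℂ) (F G : HS μ) : mul (c • F) G = c • mul F G := by
  apply Lp.ext
  refine (coeFn_mul _ _).trans (((kcomp_congr (Lp.coeFn_smul c F) (ae_eq_refl _)).trans ?_).trans
    (Lp.coeFn_smul _ _).symm)
  filter_upwards [coeFn_mul F G] with z h
  simp only [Pi.smul_apply, h, kcomp, smul_eq_mul, mul_assoc, integral_const_mul]

theorem mul_smul (c : ℂ) (F G : HS μ) : mul F (c • G) = c • mul F G := by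
  apply Lp.ext
  refine (coeFn_mul _ _).trans (((kcomp_congr (ae_eq_refl _) (Lp.coeFn_smul c G)).trans ?_).trans
    (Lp.coeFn_smul _ _).symm)
  filter_upwards [coeFn_mul F G] with z h
  simp only [Pi.smul_apply, h, kcomp, smul_eq_mul, mul_left_comm _ c, integral_const_mul]

theorem mul_assoc (F G H : HS μ) : mul (mul F G) H = mul F (mul G H) := by
  apply Lp.ext
  refine (coeFn_mul _ _).trans ((kcomp_congr (coeFn_mul _ _) (ae_eq_refl _)).trans
    (((kcomp_assoc F.measurable_coe G.measurable_coe H.measurable_coe F.lintegral_lt_top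
      G.lintegral_lt_top H.lintegral_lt_top).trans
      (kcomp_congr (ae_eq_refl _) (coeFn_mul _ _).symm)).trans (coeFn_mul _ _).symm))

theorem adj_add (F G : HS μ) : adj (F + G) = adj F + adj G := by
  rw [adj, map_add, Lp_star_add]
  rfl

theorem adj_smul (c : ℂ) (F : HS μ) : adj (c • F) = (starRingEnd ℂ) c • adj F := by
  apply Lp.ext
  filter_upwards [coeFn_adj (c • F), coeFn_adj F, Lp.coeFn_smul ((starRingEnd ℂ) c) (adj F),
    Measure.measurePreserving_swap.quasiMeasurePreserving.ae (Lp.coeFn_smul c F)] with z h1 h2 h3 h4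
  rw [h1, h3, Pi.smul_apply, h2, h4]
  simp

theorem adj_adj (F : HS μ) : adj (adj F) = F := by
  apply Lp.ext
  filter_upwards [coeFn_adj (adj F),
    Measure.measurePreserving_swap.quasiMeasurePreserving.ae (coeFn_adj F)] with z h1 h2
  rw [h1, h2]
  simp

theorem adj_mul (F G : HS μ) : adj (mul F G) = mul (adj G) (adj F) := by
  apply Lp.ext
  filter_upwards [coeFn_adj (mul F G), coeFn_mul (adj G) (adj F),
    kcomp_congr (coeFn_adj G) (coeFn_adj F),
    Measure.measurePreserving_swap.quasiMeasurePreserving.ae (coeFn_mul F G)] with z h1 h2 h3 h4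
  rw [h1, h2, h3, h4]
  simp only [kcomp, ← integral_conj, map_mul, Prod.swap, mul_comm]

theorem inner_adj (F G : HS μ) : inner ℂ F G = inner ℂ (adj G) (adj F) := by
  rw [L2_inner_eq, L2_inner_eq, ← (Measure.measurePreserving_swap (μ := μ) (ν := μ)).integral_comp'
    (f := MeasurableEquiv.prodComm)]
  refine integral_congr_ae ?_
  filter_upwards [coeFn_adj F, coeFn_adj G] with z h1 h2
  simp [h1, h2, mul_comm, MeasurableEquiv.prodComm]

theorem inner_mul (F G H : HS μ) : inner ℂ (mul F G) H = inner ℂ G (mul (adj F) H) := by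
  have m1 : Measurable fun z => (starRingEnd ℂ) (F z) :=
    Complex.continuous_conj.measurable.comp F.measurable_coe
  have m2 : Measurable fun z => (starRingEnd ℂ) (G z) :=
    Complex.continuous_conj.measurable.comp G.measurable_coe
  obtain ⟨i1, e1⟩ := integral_kcomp_mul (μ := μ) m1 m2 H.measurable_coe
    (by simpa using F.lintegral_lt_top) (by simpa using G.lintegral_lt_top) H.lintegral_lt_top
  have m1' : Measurable fun z : X × X => (starRingEnd ℂ) (F z.swap) := m1.comp measurable_swap
  have f1' : ∫⁻ z : X × X, ‖(starRingEnd ℂ) (F z.swap)‖ₑ ^ 2 ∂μ.prod μ < ⊤ := by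
    have := lintegral_prod_swap (μ := μ) (ν := μ) (fun z => ‖F z‖ₑ ^ 2)
    simpa [this] using F.lintegral_lt_top
  obtain ⟨i2, e2⟩ := integral_kcomp_mul (μ := μ) m1' H.measurable_coe m2 f1' H.lintegral_lt_top
    (by simpa using G.lintegral_lt_top)
  have s1 : inner ℂ (mul F G) H
      = ∫ z, kcomp μ (fun z => (starRingEnd ℂ) (F z)) (fun z => (starRingEnd ℂ) (G z)) z * H z
        ∂μ.prod μ := by
    rw [L2_inner_eq]
    refine integral_congr_ae ?_
    filter_upwards [coeFn_mul F G] with z hz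
    rw [hz]
    simp only [kcomp, ← integral_conj, map_mul]
  have s2 : inner ℂ G (mul (adj F) H)
      = ∫ z, kcomp μ (fun z => (starRingEnd ℂ) (F z.swap)) H z * (starRingEnd ℂ) (G z)
        ∂μ.prod μ := by
    rw [L2_inner_eq]
    refine integral_congr_ae ?_
    filter_upwards [coeFn_mul (adj F) H, kcomp_congr (coeFn_adj F) (ae_eq_refl H)] with z hz hz2
    rw [hz, hz2, mul_comm]
  -- Both sides are triple integrals of `conj F(p,q) · conj G(q,r) · H(p,r)`, one over `((p,r),q)`
  -- and the other over `((q,r),p)`; this map exchanges `p` and `q`.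
  have hρ : MeasurePreserving (fun w : (X × X) × X => ((w.2, w.1.2), w.1.1))
      ((μ.prod μ).prod μ) ((μ.prod μ).prod μ) :=
    (Measure.measurePreserving_swap.comp ((MeasurePreserving.id μ).prod
      Measure.measurePreserving_swap)).comp (measurePreserving_prodAssoc μ μ μ)
  have hρ' : MeasurableEmbedding (fun w : (X × X) × X => ((w.2, w.1.2), w.1.1)) :=
    ((MeasurableEquiv.prodAssoc.trans ((MeasurableEquiv.refl X).prodCongr
      MeasurableEquiv.prodComm)).trans MeasurableEquiv.prodComm).measurableEmbedding
  rw [s1, s2, e1, e2, ← hρ.integral_comp hρ']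
  refine integral_congr_ae (Filter.Eventually.of_forall fun w => ?_)
  simp only [Prod.swap]
  ring

/-- The rank one kernel `f ⊗ g`. -/
theorem memLp_rankOne {f g : X → ℂ} (hf : MemLp f 2 μ) (hg : MemLp g 2 μ) :
    MemLp (fun z : X × X => f z.1 * g z.2) 2 (μ.prod μ) := by
  refine memLp_two_of_lintegral (hf.1.comp_fst.mul hg.1.comp_snd) ?_
  simp only [enorm_mul, mul_pow]
  rw [lintegral_prod_mul (f := fun x => ‖f x‖ₑ ^ 2) (g := fun x => ‖g x‖ₑ ^ 2)
    (hf.1.enorm.pow_const 2) (hg.1.enorm.pow_const 2)]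
  exact ENNReal.mul_lt_top (lintegral_lt_top_of_memLp_two hf) (lintegral_lt_top_of_memLp_two hg)

/-- Composing with the rank one kernels `1_s ⊗ conj g` suffices: for `p ∈ s` the product at `(p, r)`
is the inner product of `g` with the slice `H(·, r)`. The set `s` needs positive measure to contain
a good `p`, and finite measure to have a square integrable indicator. -/
theorem eq_zero_of_mul_eq_zero [IsSeparable μ] (H : HS μ) (h : ∀ F : HS μ, mul F H = 0) :
    H = 0 := by
  rcases eq_or_ne μ 0 with h0 | h0
  · apply Lp.ext
    have h1 : μ.prod μ = 0 := by simp [h0]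
    have h2 : ∀ t : Set (X × X), (μ.prod μ) t = 0 := fun t => by simp [h1]
    exact h2 _
  obtain ⟨s, hs, hs0, hsf⟩ : ∃ s, MeasurableSet s ∧ 0 < μ s ∧ μ s < ⊤ := by
    obtain ⟨s, hs, -, h1, h2⟩ := Measure.exists_subset_measure_lt_top (μ := μ) (s := Set.univ)
      (r := 0) MeasurableSet.univ (by simpa [pos_iff_ne_zero] using h0)
    exact ⟨s, hs, h1, h2⟩
  have hms : MemLp (s.indicator fun _ => (1 : ℂ)) 2 μ := memLp_indicator_const 2 hs 1 (Or.inr hsf.ne)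
  apply Lp.ext
  refine Filter.EventuallyEq.trans ?_ (Lp.coeFn_zero _ _ _).symm
  refine ae_eq_zero_of_dense H.measurable_coe H.lintegral_lt_top (D := Set.univ) dense_univ ?_
  intro g _
  have hR := memLp_rankOne hms (Lp.memLp (star g))
  have h1 := h (hR.toLp _)
  have h2 : kcomp μ (fun z : X × X => s.indicator (fun _ => (1 : ℂ)) z.1 * star g z.2) H
      =ᵐ[μ.prod μ] 0 := by
    refine (kcomp_congr hR.coeFn_toLp.symm (ae_eq_refl _)).trans ((coeFn_mul _ _).symm.trans ?_)
    rw [h1]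
    exact Lp.coeFn_zero _ _ _
  have h3 : ∀ᵐ p ∂μ, ∀ᵐ r ∂μ, ∫ q, s.indicator (fun _ => (1 : ℂ)) p * star g q * H (q, r) ∂μ = 0 :=
    Measure.ae_ae_of_ae_prod h2
  obtain ⟨p, hp, hp2⟩ := ((frequently_ae_mem_iff.2 hs0.ne').and_eventually h3).exists
  filter_upwards [hp2] with r hr
  rw [← hr]
  refine integral_congr_ae ?_
  filter_upwards [Lp.coeFn_star g] with q hq
  simp [hp, hq]

theorem isHilbertAlgebra [IsSeparable μ] :
    IsHilbertAlgebra (mul : HS μ → HS μ → HS μ) adj where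
  add_mul := add_mul
  mul_add := mul_add
  smul_mul := smul_mul
  mul_smul := mul_smul
  mul_assoc := mul_assoc
  inv_add := adj_add
  inv_smul := adj_smul
  inv_inv := adj_adj
  inv_mul := adj_mul
  inner_inv := inner_adj
  inner_mul := inner_mul
  bounded F := ⟨‖F‖, norm_mul_le F⟩
  dense := by
    rw [Submodule.dense_iff_topologicalClosure_eq_top, Submodule.topologicalClosure_eq_top_iff,
      Submodule.eq_bot_iff]
    intro H hH
    rw [Submodule.mem_orthogonal] at hH
    refine eq_zero_of_mul_eq_zero H fun F => ?_
    rw [← inner_self_eq_zero (𝕜 := ℂ)]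
    -- Writing the second `F` as `F**` gives `⟨FH, FH⟩ = ⟨F*(FH), H⟩`, which vanishes because `H` is
    -- orthogonal to all products.
    nth_rewrite 2 [← adj_adj F]
    rw [← inner_mul]
    exact hH _ (Submodule.subset_span ⟨_, _, rfl⟩)

end HS
end Kernels

/-- The product may be rescaled by `c` as well as conjugated by the unitary. The factor must be real
to stay compatible with the involution and the inner product, and nonzero to keep the products
total. -/
theorem IsHilbertAlgebra.transport {H₁ H₂ : Type*} [NormedAddCommGroup H₁] [InnerProductSpace ℂ H₁]
    [NormedAddCommGroup H₂] [InnerProductSpace ℂ H₂] {mul : H₂ → H₂ → H₂} {J : H₂ → H₂}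
    (h : IsHilbertAlgebra mul J) (U : H₁ ≃ₗᵢ[ℂ] H₂) {c : ℂ} (hc : c ≠ 0)
    (hcc : (starRingEnd ℂ) c = c) {J' : H₁ → H₁}
    (hJ : ∀ x, U (J' x) = J (U x)) :
    IsHilbertAlgebra (fun x y => c • U.symm (mul (U x) (U y))) J' where
  add_mul x y w := by simp [h.add_mul]
  mul_add x y w := by simp [h.mul_add]
  smul_mul a x y := by simp only [map_smul, h.smul_mul, smul_comm a]
  mul_smul a x y := by simp only [map_smul, h.mul_smul, smul_comm a]
  mul_assoc x y w := by
    simp only [map_smul, U.apply_symm_apply, h.mul_assoc, h.smul_mul, h.mul_smul]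
  inv_add x y := U.injective (by simp [hJ, h.inv_add])
  inv_smul a x := U.injective (by simp [hJ, h.inv_smul])
  inv_inv x := U.injective (by simp [hJ, h.inv_inv])
  inv_mul x y := U.injective (by
    simp only [map_smul, U.apply_symm_apply, hJ, h.inv_mul, h.inv_smul, hcc])
  inner_inv x y := by
    rw [← U.inner_map_map, h.inner_inv, ← hJ, ← hJ, U.inner_map_map]
  inner_mul x y w := by
    rw [inner_smul_left, inner_smul_right, ← U.inner_map_map, ← U.inner_map_map]
    simp only [U.apply_symm_apply, hJ, h.inner_mul, hcc]
  bounded x := by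
    obtain ⟨C, hC⟩ := h.bounded (U x)
    refine ⟨‖c‖ * C, fun y => ?_⟩
    rw [norm_smul, U.symm.norm_map, _root_.mul_assoc]
    have := hC (U y)
    rw [U.norm_map] at this
    simpa using mul_le_mul_of_nonneg_left this (norm_nonneg c)
  dense := by
    have h1 : Dense (U.symm '' (Submodule.span ℂ {w | ∃ x y, w = mul x y} : Set H₂)) :=
      U.symm.surjective.denseRange.dense_image U.symm.continuous h.dense
    refine h1.mono ?_
    rintro _ ⟨w, hw, rfl⟩
    have h2 : Submodule.span ℂ {w | ∃ x y, w = mul x y} ≤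
        (Submodule.span ℂ {w | ∃ x y, w = c • U.symm (mul (U x) (U y))}).comap
          (U.symm.toLinearEquiv : H₂ →ₗ[ℂ] H₁) := by
      rw [Submodule.span_le]
      rintro _ ⟨x, y, rfl⟩
      have h3 := Submodule.smul_mem _ (c⁻¹) (Submodule.subset_span
        (s := {w | ∃ x y, w = c • U.symm (mul (U x) (U y))}) ⟨U.symm x, U.symm y, rfl⟩)
      simpa [smul_smul, hc] using h3
    exact h2 hw

/-! ### The Fourier transform on `ℝ × E`. -/

open FourierTransform

section Fourier

variable {E : Type*} [NormedAddCommGroup E] [InnerProductSpace ℝ E]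

/-- The Euclidean pairing of `ℝ × E`. -/
def pair (ζ ξ : ℝ × E) : ℝ := ζ.1 * ξ.1 + inner ℝ ζ.2 ξ.2

theorem pair_comm (ζ ξ : ℝ × E) : pair ζ ξ = pair ξ ζ := by
  simp [pair, mul_comm, real_inner_comm]

@[fun_prop]
theorem Continuous.pair {X : Type*} [TopologicalSpace X] {f g : X → ℝ × E} (hf : Continuous f)
    (hg : Continuous g) : Continuous fun x => OscKernel.pair (f x) (g x) := by
  unfold OscKernel.pair
  fun_prop

variable [FiniteDimensional ℝ E] [MeasurableSpace E] [BorelSpace E]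

instance : (volume : Measure (ℝ × E)).IsAddHaarMeasure :=
  inferInstanceAs ((volume : Measure ℝ).prod (volume : Measure E)).IsAddHaarMeasure

/-- The Fourier transform on `ℝ × E` with frequency scale `κ`. -/
def ft (κ : ℝ) (ψ : ℝ × E → ℂ) (ξ : ℝ × E) : ℂ :=
  ∫ ζ, Complex.exp ((κ * pair ζ ξ : ℝ) * Complex.I) * ψ ζ

variable (E) in
/-- The constant of the Plancherel and inversion formulas for `ft κ`. -/
def ftConst (κ : ℝ) : ℝ := (2 * Real.pi / |κ|) ^ (Module.finrank ℝ E + 1)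

theorem ftConst_pos {κ : ℝ} (hκ : κ ≠ 0) : 0 < ftConst E κ := by
  unfold ftConst; positivity

variable (E) in
/-- The dilation relating `ft κ` to the Fourier transform. -/
def dil (κ : ℝ) (ξ : ℝ × E) : WithLp 2 (ℝ × E) := WithLp.toLp 2 (-(κ / (2 * Real.pi)) • ξ)

theorem measurableEmbedding_dil {κ : ℝ} (hκ : κ ≠ 0) : MeasurableEmbedding (dil E κ) :=
  ((MeasurableEquiv.smul₀ (-(κ / (2 * Real.pi)))
    (neg_ne_zero.2 (by positivity))).trans (MeasurableEquiv.toLp 2 (ℝ × E))).measurableEmbedding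

theorem measurePreserving_dil {κ : ℝ} (hκ : κ ≠ 0) :
    MeasurePreserving (dil E κ) volume (ENNReal.ofReal (ftConst E κ) • volume) := by
  refine ⟨(measurableEmbedding_dil hκ).measurable, ?_⟩
  have h1 : Measure.map (fun ξ : ℝ × E => -(κ / (2 * Real.pi)) • ξ) volume
      = ENNReal.ofReal (ftConst E κ) • volume := by
    rw [Measure.map_addHaar_smul _ (neg_ne_zero.2 (by positivity : κ / (2 * Real.pi) ≠ 0))]
    congr 2
    rw [Module.finrank_prod, Module.finrank_self, abs_inv, abs_pow, abs_neg, abs_div,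
      abs_of_pos Real.two_pi_pos, ftConst, ← inv_pow, inv_div, add_comm]
  have h2 := (WithLp.volume_preserving_toLp (U := ℝ) (V := E)).map_eq
  have h3 : dil E κ = (WithLp.toLp 2) ∘ fun ξ : ℝ × E => -(κ / (2 * Real.pi)) • ξ := rfl
  rw [h3, ← Measure.map_map (WithLp.volume_preserving_toLp (U := ℝ) (V := E)).measurable
    (by fun_prop), h1, Measure.map_smul, h2]

theorem integral_dil {F : Type*} [NormedAddCommGroup F] [NormedSpace ℝ F] {κ : ℝ} (hκ : κ ≠ 0)
    (f : WithLp 2 (ℝ × E) → F) : ∫ ξ, f (dil E κ ξ) = ftConst E κ • ∫ w, f w := by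
  rw [(measurePreserving_dil hκ).integral_comp (measurableEmbedding_dil hκ), integral_smul_measure,
    ENNReal.toReal_ofReal (ftConst_pos hκ).le]

theorem integral_ofLp {F : Type*} [NormedAddCommGroup F] [NormedSpace ℝ F]
    (f : ℝ × E → F) : ∫ w : WithLp 2 (ℝ × E), f (WithLp.ofLp w) = ∫ ζ, f ζ :=
  (WithLp.volume_preserving_ofLp (U := ℝ) (V := E)).integral_comp
    (MeasurableEquiv.toLp 2 (ℝ × E)).symm.measurableEmbedding f

theorem ft_eq_fourier (κ : ℝ) (ψ : ℝ × E → ℂ) (ξ : ℝ × E) :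
    ft κ ψ ξ = 𝓕 (fun w : WithLp 2 (ℝ × E) => ψ (WithLp.ofLp w)) (dil E κ ξ) := by
  rw [Real.fourier_eq', ft, ← integral_ofLp]
  refine integral_congr_ae (Filter.Eventually.of_forall fun w => ?_)
  simp only [smul_eq_mul]
  congr 4
  rw [WithLp.prod_inner_apply]
  simp only [dil, pair, WithLp.ofLp_fst, WithLp.ofLp_snd, Prod.smul_fst, Prod.smul_snd,
    inner_smul_right]
  simp
  field_simp
  ring

/-- A smooth compactly supported function on `ℝ × E` as a Schwartz function. -/
theorem exists_schwartz {ψ : ℝ × E → ℂ} (hψ : ContDiff ℝ ∞ ψ) (hc : HasCompactSupport ψ) :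
    ∃ f : SchwartzMap (WithLp 2 (ℝ × E)) ℂ, (f : WithLp 2 (ℝ × E) → ℂ) = fun w => ψ w.ofLp := by
  have h1 : ContDiff ℝ ∞ fun w : WithLp 2 (ℝ × E) => ψ w.ofLp :=
    hψ.comp (WithLp.prodContinuousLinearEquiv 2 ℝ ℝ E).contDiff
  have h2 : HasCompactSupport fun w : WithLp 2 (ℝ × E) => ψ w.ofLp :=
    hc.comp_homeomorph (WithLp.prodContinuousLinearEquiv 2 ℝ ℝ E).toHomeomorph
  exact ⟨h2.toSchwartzMap h1, rfl⟩

theorem ft_neg_conj (κ : ℝ) (φ : ℝ × E → ℂ) (ξ : ℝ × E) :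
    (starRingEnd ℂ) (ft κ (fun ζ => (starRingEnd ℂ) (φ ζ)) ξ) = ft κ φ (-ξ) := by
  rw [ft, ← integral_conj, ft]
  refine integral_congr_ae (Filter.Eventually.of_forall fun w => ?_)
  simp only [map_mul, Complex.conj_conj, ← Complex.exp_conj, Complex.conj_ofReal, Complex.conj_I]
  congr 2
  simp [pair]
  ring

/-- Parseval in bilinear form: it is the Hermitian formula applied to `ψ` and `conj φ`, conjugation
in position space being conjugation and reflection in frequency space. -/
theorem integral_ft_mul_ft_neg {κ : ℝ} (hκ : κ ≠ 0) {ψ φ : ℝ × E → ℂ} (hψ : ContDiff ℝ ∞ ψ)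
    (hψc : HasCompactSupport ψ) (hφ : ContDiff ℝ ∞ φ) (hφc : HasCompactSupport φ) :
    ∫ ξ, ft κ ψ ξ * ft κ φ (-ξ) = ftConst E κ * ∫ ζ, ψ ζ * φ ζ := by
  obtain ⟨f, hf⟩ := exists_schwartz hψ hψc
  have hφ' : ContDiff ℝ ∞ fun ζ => (starRingEnd ℂ) (φ ζ) :=
    Complex.conjCLE.contDiff.comp hφ
  obtain ⟨g, hg⟩ := exists_schwartz hφ' (hφc.comp_left (map_zero _))
  have h := SchwartzMap.integral_inner_fourier_fourier g f
  simp_rw [← ft_neg_conj, ft_eq_fourier]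
  rw [integral_dil hκ fun w => 𝓕 (fun w : WithLp 2 (ℝ × E) => ψ (WithLp.ofLp w)) w *
    (starRingEnd ℂ) (𝓕 (fun w : WithLp 2 (ℝ × E) => (starRingEnd ℂ) (φ (WithLp.ofLp w))) w),
    Complex.real_smul, ← integral_ofLp]
  congr 1
  rw [← hf, ← hg, ← SchwartzMap.fourier_coe, ← SchwartzMap.fourier_coe]
  simp only [RCLike.inner_apply] at h
  rw [h, hf, hg]
  simp

theorem memLp_ft {κ : ℝ} (hκ : κ ≠ 0) {ψ : ℝ × E → ℂ} (hψ : ContDiff ℝ ∞ ψ)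
    (hψc : HasCompactSupport ψ) : MemLp (ft κ ψ) 2 := by
  obtain ⟨f, hf⟩ := exists_schwartz hψ hψc
  have h : ft κ ψ = (𝓕 f : SchwartzMap _ _) ∘ dil E κ := by
    funext ξ
    rw [ft_eq_fourier, ← hf, ← SchwartzMap.fourier_coe]
    rfl
  rw [h]
  exact (((𝓕 f).memLp 2 volume).smul_measure ENNReal.ofReal_ne_top).comp_measurePreserving
    (measurePreserving_dil hκ)

theorem lintegral_ft_sq {κ : ℝ} (hκ : κ ≠ 0) {ψ : ℝ × E → ℂ} (hψ : ContDiff ℝ ∞ ψ)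
    (hψc : HasCompactSupport ψ) :
    ∫⁻ ξ, ‖ft κ ψ ξ‖ₑ ^ 2 = ENNReal.ofReal (ftConst E κ) * ∫⁻ ζ, ‖ψ ζ‖ₑ ^ 2 := by
  obtain ⟨f, hf⟩ := exists_schwartz hψ hψc
  have h := congrArg ENNReal.ofReal (SchwartzMap.norm_fourier_toL2_eq f)
  rw [SchwartzMap.norm_toLp, SchwartzMap.norm_toLp, ENNReal.ofReal_toReal, ENNReal.ofReal_toReal]
    at h
  · have h2 := congrArg (· ^ 2) h
    simp only [eLpNorm_two_sq] at h2
    simp_rw [ft_eq_fourier]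
    rw [(measurePreserving_dil hκ).lintegral_comp_emb (measurableEmbedding_dil hκ)
      (fun w => ‖𝓕 (fun w : WithLp 2 (ℝ × E) => ψ (WithLp.ofLp w)) w‖ₑ ^ 2),
      lintegral_smul_measure, ← hf, ← SchwartzMap.fourier_coe, h2, hf, smul_eq_mul]
    congr 1
    exact (WithLp.volume_preserving_ofLp (U := ℝ) (V := E)).lintegral_comp_emb
      (MeasurableEquiv.toLp 2 (ℝ × E)).symm.measurableEmbedding (fun ζ => ‖ψ ζ‖ₑ ^ 2)
  · exact (f.memLp 2 volume).2.ne
  · exact ((𝓕 f).memLp 2 volume).2.ne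

/-- This is Fourier inversion evaluated at the origin. -/
theorem integral_ft {κ : ℝ} (hκ : κ ≠ 0) {G : ℝ × E → ℂ} (hG : Continuous G)
    (hGi : Integrable G) (hFi : Integrable (ft κ G)) :
    ∫ ξ, ft κ G ξ = ftConst E κ * G 0 := by
  set f : WithLp 2 (ℝ × E) → ℂ := fun w => G w.ofLp with hf
  have e : ft κ G = fun ξ => 𝓕 f (dil E κ ξ) := funext fun ξ => ft_eq_fourier κ G ξ
  have hfi : Integrable f := ((WithLp.volume_preserving_ofLp (U := ℝ) (V := E)).integrable_comp_emb
      (MeasurableEquiv.toLp 2 (ℝ × E)).symm.measurableEmbedding).2 hGi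
  have hFfi : Integrable (𝓕 f) := by
    have h1 := ((measurePreserving_dil hκ).integrable_comp_emb (measurableEmbedding_dil hκ)
      (g := 𝓕 f)).1 (by rw [e] at hFi; exact hFi)
    rwa [integrable_smul_measure (by simp [ftConst_pos hκ]) ENNReal.ofReal_ne_top] at h1
  have hfc : Continuous f := hG.comp (WithLp.prod_continuous_ofLp 2 ℝ E)
  have h2 := congrFun (hfc.fourierInv_fourier_eq hfi hFfi) 0
  rw [e, integral_dil hκ (𝓕 f), Complex.real_smul]
  congr 1
  rw [Real.fourierInv_eq'] at h2
  simpa [hf] using h2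

/-- Test functions are dense and the `L²` Fourier transform is unitary. Concretely, a vector
orthogonal to these transforms is, after undoing the dilation, orthogonal to `𝓕 F` for all `F` in a
dense set, hence for all `F`, hence to itself by surjectivity. -/
theorem dense_ft {κ : ℝ} (hκ : κ ≠ 0) :
    Dense {g : Lp ℂ 2 (volume : Measure (ℝ × E)) |
      ∃ ψ : ℝ × E → ℂ, ContDiff ℝ ∞ ψ ∧ HasCompactSupport ψ ∧ g =ᵐ[volume] ft κ ψ} := by
  have hadd : ∀ {f g : ℝ × E → ℂ}, Continuous f → HasCompactSupport f → Continuous g →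
      HasCompactSupport g → ft κ (f + g) = ft κ f + ft κ g := by
    intro f g hf hfc hg hgc
    funext ξ
    simp only [ft, Pi.add_apply, mul_add]
    refine integral_add ?_ ?_
    · exact ((by fun_prop : Continuous _)).integrable_of_hasCompactSupport hfc.mul_left
    · exact ((by fun_prop : Continuous _)).integrable_of_hasCompactSupport hgc.mul_left
  have hsmul : ∀ (c : ℂ) (f : ℝ × E → ℂ), ft κ (c • f) = c • ft κ f := by
    intro c f
    funext ξ
    simp only [ft, Pi.smul_apply, smul_eq_mul, mul_left_comm _ c, integral_const_mul]
  let S : Submodule ℂ (Lp ℂ 2 (volume : Measure (ℝ × E))) :=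
    { carrier := {g | ∃ ψ : ℝ × E → ℂ,
        ContDiff ℝ ∞ ψ ∧ HasCompactSupport ψ ∧ g =ᵐ[volume] ft κ ψ}
      zero_mem' := ⟨0, contDiff_const, HasCompactSupport.zero, by
        refine (Lp.coeFn_zero _ _ _).trans (Filter.Eventually.of_forall fun ξ => ?_)
        simp [ft]⟩
      add_mem' := by
        rintro f g ⟨ψ, h1, h2, h3⟩ ⟨φ, h4, h5, h6⟩
        refine ⟨ψ + φ, h1.add h4, h2.add h5, (Lp.coeFn_add _ _).trans ?_⟩
        rw [hadd h1.continuous h2 h4.continuous h5]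
        exact h3.add h6
      smul_mem' := by
        rintro c f ⟨ψ, h1, h2, h3⟩
        refine ⟨c • ψ, h1.const_smul c, h2.smul_left (f := fun _ => c), (Lp.coeFn_smul _ _).trans ?_⟩
        rw [hsmul]
        exact h3.const_smul c }
  suffices h : Dense (S : Set (Lp ℂ 2 (volume : Measure (ℝ × E)))) from h
  rw [Submodule.dense_iff_topologicalClosure_eq_top, Submodule.topologicalClosure_eq_top_iff,
    Submodule.eq_bot_iff]
  intro k hk
  rw [Submodule.mem_orthogonal] at hk
  let de : ℝ × E ≃ᵐ WithLp 2 (ℝ × E) := (MeasurableEquiv.smul₀ (-(κ / (2 * Real.pi)))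
    (neg_ne_zero.2 (by positivity))).trans (MeasurableEquiv.toLp 2 (ℝ × E))
  have hde : MeasurePreserving de volume (ENNReal.ofReal (ftConst E κ) • volume) :=
    measurePreserving_dil hκ
  have hc0 : ENNReal.ofReal (ftConst E κ) ≠ 0 := by simp [ftConst_pos hκ]
  have hk' : MemLp (k ∘ de.symm) 2 (volume : Measure (WithLp 2 (ℝ × E))) := by
    have h1 : MemLp (k ∘ de.symm) 2
        (ENNReal.ofReal (ftConst E κ) • (volume : Measure (WithLp 2 (ℝ × E)))) :=
      (Lp.memLp k).comp_measurePreserving (hde.symm de)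
    have h2 := h1.smul_measure (c := (ENNReal.ofReal (ftConst E κ))⁻¹) (ENNReal.inv_ne_top.2 hc0)
    rwa [smul_smul, ENNReal.inv_mul_cancel hc0 ENNReal.ofReal_ne_top, one_smul] at h2
  have hz : hk'.toLp _ = 0 := by
    have h0 : (fun F : Lp ℂ 2 (volume : Measure (WithLp 2 (ℝ × E))) =>
        inner ℂ (𝓕 F) (hk'.toLp _)) = fun _ => 0 := by
      refine Continuous.ext_on (Lp.dense_hasCompactSupport_contDiff (by norm_num))
        ((Lp.fourierTransformₗᵢ _ _).continuous.inner continuous_const) continuous_const ?_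
      rintro F ⟨φ, hφ1, hφ2, hφ3⟩
      let f : SchwartzMap (WithLp 2 (ℝ × E)) ℂ := hφ2.toSchwartzMap hφ3
      have hFf : F = f.toLp 2 := by
        apply Lp.ext
        exact hφ1.trans (f.coeFn_toLp 2 _).symm
      let ψ : ℝ × E → ℂ := fun ζ => φ (WithLp.toLp 2 ζ)
      have hψ1 : ContDiff ℝ ∞ ψ := hφ3.comp (WithLp.prodContinuousLinearEquiv 2 ℝ ℝ E).symm.contDiff
      have hψ2 : HasCompactSupport ψ :=
        hφ2.comp_homeomorph (WithLp.prodContinuousLinearEquiv 2 ℝ ℝ E).symm.toHomeomorph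
      have hft : ft κ ψ = fun ξ => 𝓕 f (de ξ) := by
        funext ξ
        rw [ft_eq_fourier]
        rfl
      have h1 := hk ((memLp_ft hκ hψ1 hψ2).toLp _) ⟨ψ, hψ1, hψ2, MemLp.coeFn_toLp _⟩
      simp only [hFf, SchwartzMap.toLp_fourier_eq]
      rw [L2_inner_eq] at h1 ⊢
      have h2 : ∫ ξ, (starRingEnd ℂ) (𝓕 f (de ξ)) * (k ∘ de.symm) (de ξ) = 0 := by
        rw [← h1]
        refine integral_congr_ae ?_
        filter_upwards [(memLp_ft hκ hψ1 hψ2).coeFn_toLp] with ξ hξ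
        rw [hξ, hft]
        simp
      rw [hde.integral_comp de.measurableEmbedding
        (fun w => (starRingEnd ℂ) (𝓕 f w) * (k ∘ de.symm) w), integral_smul_measure] at h2
      have h3 := (smul_eq_zero.1 h2).resolve_left
        (by rw [ENNReal.toReal_ofReal (ftConst_pos hκ).le]; exact (ftConst_pos hκ).ne')
      rw [← h3]
      refine integral_congr_ae ?_
      filter_upwards [hk'.coeFn_toLp, (𝓕 f).coeFn_toLp 2 volume] with w hw1 hw2
      rw [hw1, hw2]
    obtain ⟨F, hF⟩ := (Lp.fourierTransformₗᵢ (WithLp 2 (ℝ × E)) ℂ).surjective (hk'.toLp _)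
    have h1 := congrFun h0 F
    have h2 : 𝓕 F = hk'.toLp _ := hF
    simp only [h2] at h1
    exact inner_self_eq_zero.1 h1
  have h1 : (k ∘ de.symm) =ᵐ[volume] 0 := hk'.coeFn_toLp.symm.trans (hz ▸ Lp.coeFn_zero _ _ _)
  have h2 : (k ∘ de.symm) =ᵐ[ENNReal.ofReal (ftConst E κ) • volume] 0 :=
    Measure.smul_absolutelyContinuous.ae_le h1
  have h3 := hde.quasiMeasurePreserving.ae h2
  apply Lp.ext
  refine Filter.EventuallyEq.trans ?_ (Lp.coeFn_zero _ _ _).symm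
  filter_upwards [h3] with ξ hξ
  simpa using hξ

/-- A compact set carrying all the integrands reduces the integral to a fixed compact domain, where
joint continuity is enough. -/
theorem continuous_integral_of_support {X Y : Type*} [TopologicalSpace X]
    [FirstCountableTopology X] [LocallyCompactSpace X] [TopologicalSpace Y] [MeasurableSpace Y]
    [OpensMeasurableSpace Y] {μ : Measure Y}
    [IsLocallyFiniteMeasure μ] {f : X → Y → ℂ} (hf : Continuous (Function.uncurry f))
    {s : Set Y} (hs : IsCompact s) (h0 : ∀ x, ∀ y ∉ s, f x y = 0) :
    Continuous fun x => ∫ y, f x y ∂μ := by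
  have h := continuous_parametric_integral_of_continuous (μ := μ) hf hs
  refine h.congr fun x => ?_
  exact setIntegral_eq_integral_of_forall_compl_eq_zero fun y hy => h0 x y hy

theorem continuous_ft {X : Type*} [TopologicalSpace X] [FirstCountableTopology X]
    [LocallyCompactSpace X] (κ : ℝ) {U : X → ℝ × E → ℂ} (hU : Continuous (Function.uncurry U))
    {s : Set (ℝ × E)} (hs : IsCompact s) (h0 : ∀ x, ∀ ζ ∉ s, U x ζ = 0) :
    Continuous fun p : X × (ℝ × E) => ft κ (U p.1) p.2 := by
  refine continuous_integral_of_support ?_ hs fun p ζ hζ => by simp [h0 p.1 ζ hζ]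
  have : Continuous fun q : (X × (ℝ × E)) × (ℝ × E) => U q.1.1 q.2 :=
    hU.comp (by fun_prop : Continuous fun q : (X × (ℝ × E)) × (ℝ × E) => (q.1.1, q.2))
  simp only [Function.uncurry_def]
  fun_prop

end Fourier

/-! ### A calculus of weighted changes of variables. -/

section ChangeOfVariables

variable {X Y Z : Type*} [MeasurableSpace X] [MeasurableSpace Y] [MeasurableSpace Z]
  {μ : Measure X} {ν : Measure Y} {τ : Measure Z}

/-- `Θ` carries the measure `ρ μ` to the measure `c ν`. -/
structure ChangeVar (Θ : X → Y) (ρ : X → ℝ) (c : ℝ) (μ : Measure X) (ν : Measure Y) : Prop where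
  measurable : Measurable Θ
  measurable_density : Measurable ρ
  nonneg : ∀ x, 0 ≤ ρ x
  pos : 0 < c
  lintegral : ∀ f : Y → ℝ≥0∞, Measurable f →
    ∫⁻ x, f (Θ x) * ENNReal.ofReal (ρ x) ∂μ = ENNReal.ofReal c * ∫⁻ y, f y ∂ν

namespace ChangeVar

theorem measurePreserving {Θ : X → Y} {ρ : X → ℝ} {c : ℝ} (h : ChangeVar Θ ρ c μ ν) :
    MeasurePreserving Θ (μ.withDensity fun x => ENNReal.ofReal (ρ x))
      (ENNReal.ofReal c • ν) := by
  refine ⟨h.measurable, ?_⟩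
  ext s hs
  have h1 := h.lintegral (s.indicator 1) (measurable_one.indicator hs)
  rw [Measure.map_apply h.measurable hs, withDensity_apply _ (h.measurable hs),
    Measure.smul_apply, smul_eq_mul, ← lintegral_indicator_one hs, ← h1,
    ← lintegral_indicator (h.measurable hs)]
  refine lintegral_congr fun x => ?_
  by_cases hx : Θ x ∈ s <;> simp [hx, Set.indicator]

theorem integral {Θ : X → Y} {ρ : X → ℝ} {c : ℝ} (h : ChangeVar Θ ρ c μ ν) {f : Y → ℂ}
    (hf : Measurable f) : ∫ x, (ρ x : ℂ) * f (Θ x) ∂μ = c * ∫ y, f y ∂ν := by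
  have h1 := integral_map (μ := μ.withDensity fun x => ENNReal.ofReal (ρ x)) (φ := Θ)
    (f := f) h.measurable.aemeasurable hf.aestronglyMeasurable
  rw [h.measurePreserving.map_eq, integral_smul_measure, ENNReal.toReal_ofReal h.pos.le,
    Complex.real_smul, integral_withDensity_eq_integral_toReal_smul
      (by have := h.measurable_density; fun_prop) (by simp)] at h1
  rw [h1]
  refine integral_congr_ae (Filter.Eventually.of_forall fun x => ?_)
  simp [ENNReal.toReal_ofReal (h.nonneg x)]

theorem integrable {Θ : X → Y} {ρ : X → ℝ} {c : ℝ} (h : ChangeVar Θ ρ c μ ν) {f : Y → ℂ}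
    (hf : Measurable f) (hi : Integrable f ν) : Integrable (fun x => (ρ x : ℂ) * f (Θ x)) μ := by
  have hΘ := h.measurable
  have hρ := h.measurable_density
  refine ⟨(by fun_prop : Measurable _).aestronglyMeasurable, ?_⟩
  have h1 := h.lintegral (fun y => ‖f y‖ₑ) (by fun_prop)
  have h2 : ENNReal.ofReal c * ∫⁻ y, ‖f y‖ₑ ∂ν < ⊤ := ENNReal.mul_lt_top (by simp) hi.2
  rw [← h1] at h2
  refine lt_of_le_of_lt (le_of_eq (lintegral_congr fun x => ?_)) h2
  rw [enorm_mul, mul_comm, ← ofReal_norm (ρ x : ℂ), Complex.norm_real,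
    Real.norm_of_nonneg (h.nonneg x)]

theorem comp {Θ : X → Y} {ρ : X → ℝ} {c : ℝ} (h : ChangeVar Θ ρ c μ ν) {Θ' : Y → Z} {ρ' : Y → ℝ}
    {c' : ℝ} (h' : ChangeVar Θ' ρ' c' ν τ) :
    ChangeVar (fun x => Θ' (Θ x)) (fun x => ρ x * ρ' (Θ x)) (c * c') μ τ where
  measurable := h'.measurable.comp h.measurable
  measurable_density := h.measurable_density.mul (h'.measurable_density.comp h.measurable)
  nonneg x := mul_nonneg (h.nonneg x) (h'.nonneg _)
  pos := mul_pos h.pos h'.pos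
  lintegral f hf := by
    have hρ' := h'.measurable_density
    have hΘ' := h'.measurable
    rw [ENNReal.ofReal_mul h.pos.le, mul_assoc, ← h'.lintegral f hf,
      ← h.lintegral _ (by fun_prop)]
    refine lintegral_congr fun x => ?_
    rw [ENNReal.ofReal_mul (h.nonneg x), mul_comm (ENNReal.ofReal (ρ x)), mul_assoc]

theorem congr {Θ Θ' : X → Y} {ρ ρ' : X → ℝ} {c : ℝ} (h : ChangeVar Θ ρ c μ ν)
    (hΘ : ∀ x, Θ x = Θ' x) (hρ : ∀ x, ρ x = ρ' x) : ChangeVar Θ' ρ' c μ ν := by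
  rwa [← funext hΘ, ← funext hρ]

theorem mul_const {Θ : X → Y} {ρ : X → ℝ} {c r : ℝ} (h : ChangeVar Θ ρ c μ ν) (hr : 0 < r) :
    ChangeVar Θ (fun x => r * ρ x) (r * c) μ ν where
  measurable := h.measurable
  measurable_density := h.measurable_density.const_mul r
  nonneg x := mul_nonneg hr.le (h.nonneg x)
  pos := mul_pos hr h.pos
  lintegral f hf := by
    have hΘ := h.measurable
    have hρ := h.measurable_density
    rw [ENNReal.ofReal_mul hr.le, mul_assoc, ← h.lintegral f hf,
      ← lintegral_const_mul _ (by fun_prop)]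
    refine lintegral_congr fun x => ?_
    rw [ENNReal.ofReal_mul hr.le, mul_left_comm]

theorem of_measurePreserving {Θ : X → Y} (h : MeasurePreserving Θ μ ν) :
    ChangeVar Θ (fun _ => 1) 1 μ ν where
  measurable := h.measurable
  measurable_density := measurable_const
  nonneg _ := zero_le_one
  pos := zero_lt_one
  lintegral f hf := by simp [h.lintegral_comp hf]

theorem of_linearEquiv {V : Type*} [NormedAddCommGroup V] [NormedSpace ℝ V]
    [FiniteDimensional ℝ V] [MeasurableSpace V] [BorelSpace V] (μ : Measure V)
    [μ.IsAddHaarMeasure] (e : V ≃ₗ[ℝ] V) : ∃ c, ChangeVar e (fun _ => 1) c μ μ := by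
  have hd : LinearMap.det (e : V →ₗ[ℝ] V) ≠ 0 := (LinearEquiv.isUnit_det' e).ne_zero
  have hm : Measurable e := (LinearMap.continuous_of_finiteDimensional (e : V →ₗ[ℝ] V)).measurable
  refine ⟨|(LinearMap.det (e : V →ₗ[ℝ] V))⁻¹|, hm, measurable_const, fun _ => zero_le_one,
    abs_pos.2 (inv_ne_zero hd), fun f hf => ?_⟩
  have h := Measure.map_linearMap_addHaar_eq_smul_addHaar μ hd
  have h2 := lintegral_map (μ := μ) hf hm
  simp only [ENNReal.ofReal_one, mul_one]
  rw [← h2]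
  change ∫⁻ y, f y ∂(Measure.map (e : V →ₗ[ℝ] V) μ) = _
  rw [h, lintegral_smul_measure, smul_eq_mul]

/-- Triangular substitutions are built from this: the first coordinate is kept as a parameter while
the second is transformed in a way that may depend on it. -/
theorem of_fiber {W : Type*} [MeasurableSpace W] {ν' : Measure W} [SFinite μ] [SFinite ν']
    [SFinite ν] {Θ : X → W → Y} {ρ : X → W → ℝ} (h : ∀ x, ChangeVar (Θ x) (ρ x) 1 ν' ν)
    (hΘ : Measurable (Function.uncurry Θ)) (hρ : Measurable (Function.uncurry ρ)) :
    ChangeVar (fun p : X × W => (p.1, Θ p.1 p.2)) (fun p => ρ p.1 p.2) 1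
      (μ.prod ν') (μ.prod ν) where
  measurable := measurable_fst.prodMk hΘ
  measurable_density := hρ
  nonneg p := (h p.1).nonneg p.2
  pos := zero_lt_one
  lintegral f hf := by
    have hΘ' : Measurable fun p : X × W => Θ p.1 p.2 := hΘ
    have hρ' : Measurable fun p : X × W => ρ p.1 p.2 := hρ
    rw [lintegral_prod _ (by fun_prop), lintegral_prod _ (by fun_prop)]
    simp only [ENNReal.ofReal_one, one_mul]
    refine lintegral_congr fun x => ?_
    have := (h x).lintegral (fun y => f (x, y)) (by fun_prop)
    simpa using this

end ChangeVar

end ChangeOfVariables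

/-! ### The substitutions by midpoints, gaps and frequencies. -/

section Triangular

variable {E : Type*} [NormedAddCommGroup E] [InnerProductSpace ℝ E]
  [FiniteDimensional ℝ E] [MeasurableSpace E] [BorelSpace E]

/-- The map is triangular: a reparametrisation of the line, and over each of its points a dilation
and translation of `E`. Its Jacobian is the product of the diagonal ones. -/
theorem changeVar_affine {σ σ' k : ℝ → ℝ} {l : ℝ → E} (hσ : ∀ a, HasDerivAt σ (σ' a) a)
    (hbij : Function.Bijective σ) (hσ' : ∀ a, 0 ≤ σ' a) (hσm : Measurable σ') (hk : ∀ a, 0 < k a)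
    (hkm : Measurable k) (hl : Measurable l) :
    ChangeVar (fun p : ℝ × E => (σ p.1, k p.1 • p.2 + l p.1))
      (fun p => σ' p.1 * k p.1 ^ Module.finrank ℝ E) 1 volume volume := by
  have hσc : Continuous σ := continuous_iff_continuousAt.2 fun a => (hσ a).continuousAt
  refine ⟨by fun_prop, by fun_prop, fun p => mul_nonneg (hσ' _) (pow_nonneg (hk _).le _),
    zero_lt_one, fun f hf => ?_⟩
  rw [Measure.volume_eq_prod, lintegral_prod _ (by fun_prop), lintegral_prod _ (by fun_prop)]
  have h1 : ∀ a, ∫⁻ b : E, f (σ a, k a • b + l a) *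
      ENNReal.ofReal (σ' a * k a ^ Module.finrank ℝ E)
      = ENNReal.ofReal |σ' a| * ∫⁻ b, f (σ a, b) := by
    intro a
    have h2 := lintegral_map (μ := (volume : Measure E)) (f := fun b => f (σ a, b + l a))
      (g := fun b => k a • b) (by fun_prop) (by fun_prop)
    rw [Measure.map_addHaar_smul _ (hk a).ne', lintegral_smul_measure, smul_eq_mul,
      lintegral_add_right_eq_self (fun b => f (σ a, b))] at h2
    have h4 : ENNReal.ofReal (k a ^ Module.finrank ℝ E)⁻¹ *
        ENNReal.ofReal (k a ^ Module.finrank ℝ E) = 1 := by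
      have h5 : k a ^ Module.finrank ℝ E ≠ 0 := (pow_pos (hk a) _).ne'
      rw [← ENNReal.ofReal_mul (inv_nonneg.2 (pow_nonneg (hk a).le _)), inv_mul_cancel₀ h5,
        ENNReal.ofReal_one]
    rw [lintegral_mul_const _ (by fun_prop), ← h2, ENNReal.ofReal_mul (hσ' a),
      abs_of_nonneg (hσ' a), abs_of_pos (inv_pos.2 (pow_pos (hk a) _))]
    calc _ = ENNReal.ofReal (σ' a) * (∫⁻ b, f (σ a, b)) *
          (ENNReal.ofReal (k a ^ Module.finrank ℝ E)⁻¹ *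
            ENNReal.ofReal (k a ^ Module.finrank ℝ E)) := by ring
      _ = _ := by rw [h4, mul_one]
  simp only [h1, ENNReal.ofReal_one, one_mul]
  have h3 := lintegral_image_eq_lintegral_abs_deriv_mul (s := Set.univ) MeasurableSet.univ
    (fun a _ => (hσ a).hasDerivWithinAt) hbij.1.injOn (fun a => ∫⁻ b, f (a, b))
  rw [Set.image_univ, hbij.2.range_eq, Measure.restrict_univ] at h3
  exact h3.symm

theorem changeVar_scale {k : ℝ} (hk : 0 < k) :
    ChangeVar (fun p : ℝ × E => (p.1, k • p.2)) (fun _ => k ^ Module.finrank ℝ E) 1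
      volume volume := by
  refine (changeVar_affine (σ := id) (σ' := fun _ => 1) (k := fun _ => k) (l := fun _ => (0 : E))
    (fun a => hasDerivAt_id a) Function.bijective_id (fun _ => zero_le_one) measurable_const
    (fun _ => hk) measurable_const measurable_const).congr ?_ ?_ <;> simp

/-- The midpoint of two points of the kernel picture. -/
def mid (P Q : ℝ × E) : ℝ × E :=
  ((P.1 + Q.1) / 2, (Real.cosh ((P.1 - Q.1) / 2))⁻¹ • ((2 : ℝ)⁻¹ • (P.2 + Q.2)))

/-- The frequency attached to two points of the kernel picture. -/
def gap (P Q : ℝ × E) : ℝ × E :=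
  (Real.sinh (P.1 - Q.1), Real.cosh ((P.1 - Q.1) / 2) • ((2 : ℝ)⁻¹ • (P.2 - Q.2)))

theorem mid_comm (P Q : ℝ × E) : mid P Q = mid Q P := by
  have : (P.1 - Q.1) / 2 = -((Q.1 - P.1) / 2) := by ring
  simp only [mid, this, Real.cosh_neg, add_comm]

theorem gap_neg (P Q : ℝ × E) : gap Q P = -gap P Q := by
  have h1 : (Q.1 - P.1) / 2 = -((P.1 - Q.1) / 2) := by ring
  have h2 : Q.1 - P.1 = -(P.1 - Q.1) := by ring
  simp only [gap, h1, Real.cosh_neg]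
  rw [h2, Real.sinh_neg, ← neg_sub P.2 Q.2, smul_neg, smul_neg, Prod.neg_mk]

@[fun_prop]
theorem Continuous.mid {T : Type*} [TopologicalSpace T] {f g : T → ℝ × E} (hf : Continuous f)
    (hg : Continuous g) : Continuous fun x => OscKernel.mid (f x) (g x) := by
  unfold OscKernel.mid
  have : ∀ x, Real.cosh (((f x).1 - (g x).1) / 2) ≠ 0 := fun x => (Real.cosh_pos _).ne'
  fun_prop (disch := assumption)

@[fun_prop]
theorem Continuous.gap {T : Type*} [TopologicalSpace T] {f g : T → ℝ × E} (hf : Continuous f)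
    (hg : Continuous g) : Continuous fun x => OscKernel.gap (f x) (g x) := by
  unfold OscKernel.gap
  fun_prop

theorem bijective_sinh_two_mul (a : ℝ) : Function.Bijective fun t => Real.sinh (2 * (t - a)) := by
  refine Real.sinh_bijective.comp ⟨fun x y h => by simpa using h, fun y => ⟨y / 2 + a, by ring⟩⟩

theorem hasDerivAt_sinh_two_mul (a t : ℝ) :
    HasDerivAt (fun t => Real.sinh (2 * (t - a))) (2 * Real.cosh (2 * (t - a))) t := by
  have := (((hasDerivAt_id t).sub_const a).const_mul 2).sinh
  simpa [mul_comm] using this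

/-- After passing to half sum and half difference, the `E`-parts are scaled by `cosh⁻¹` and by
`cosh` of the same number, so these Jacobians cancel; what remains is the derivative of `sinh`. The
constant of the linear step is never needed. -/
theorem changeVar_mid_gap : ∃ c, ChangeVar (fun p : (ℝ × E) × (ℝ × E) => (mid p.1 p.2, gap p.1 p.2))
    (fun p => Real.cosh (p.1.1 - p.2.1)) c volume volume := by
  let e : ((ℝ × E) × (ℝ × E)) ≃ₗ[ℝ] ((ℝ × E) × (ℝ × E)) :=
    { toFun := fun p => ((2 : ℝ)⁻¹ • (p.1 + p.2), (2 : ℝ)⁻¹ • (p.1 - p.2))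
      map_add' := fun p q => by
        ext1 <;> simp only [Prod.fst_add, Prod.snd_add] <;> module
      map_smul' := fun r p => by
        ext1 <;> simp only [Prod.smul_fst, Prod.smul_snd, RingHom.id_apply] <;> module
      invFun := fun p => (p.1 + p.2, p.1 - p.2)
      left_inv := fun p => by ext1 <;> module
      right_inv := fun p => by ext1 <;> module }
  have : (volume : Measure ((ℝ × E) × (ℝ × E))).IsAddHaarMeasure :=
    Measure.prod.instIsAddHaarMeasure (volume : Measure (ℝ × E)) (volume : Measure (ℝ × E))
  obtain ⟨c, h1⟩ := ChangeVar.of_linearEquiv volume e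
  have hc : ∀ t, Real.cosh t ≠ 0 := fun t => (Real.cosh_pos t).ne'
  have hsw : ChangeVar Prod.swap (fun _ => 1) 1 (volume : Measure ((ℝ × E) × (ℝ × E))) volume :=
    ChangeVar.of_measurePreserving Measure.measurePreserving_swap
  have h2 : ChangeVar (fun p : (ℝ × E) × (ℝ × E) =>
      (p.1, (p.2.1, (Real.cosh p.1.1)⁻¹ • p.2.2)))
      (fun p => (Real.cosh p.1.1)⁻¹ ^ Module.finrank ℝ E) 1 volume volume :=
    ChangeVar.of_fiber (μ := (volume : Measure (ℝ × E))) (ν' := (volume : Measure (ℝ × E)))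
      (ν := (volume : Measure (ℝ × E)))
      (Θ := fun x w => (w.1, (Real.cosh x.1)⁻¹ • w.2))
      (ρ := fun x _ => (Real.cosh x.1)⁻¹ ^ Module.finrank ℝ E)
      (fun x => changeVar_scale (inv_pos.2 (Real.cosh_pos _)))
      (by unfold Function.uncurry; fun_prop) (by unfold Function.uncurry; fun_prop)
  have h3 : ChangeVar (fun p : (ℝ × E) × (ℝ × E) =>
      (p.1, (Real.sinh (2 * (p.2.1 - 0)), Real.cosh p.2.1 • p.2.2 + (0 : E))))
      (fun p => 2 * Real.cosh (2 * (p.2.1 - 0)) * Real.cosh p.2.1 ^ Module.finrank ℝ E) 1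
      volume volume :=
    ChangeVar.of_fiber (μ := (volume : Measure (ℝ × E))) (ν' := (volume : Measure (ℝ × E)))
      (ν := (volume : Measure (ℝ × E)))
      (Θ := fun _ w => (Real.sinh (2 * (w.1 - 0)), Real.cosh w.1 • w.2 + (0 : E)))
      (ρ := fun _ w => 2 * Real.cosh (2 * (w.1 - 0)) * Real.cosh w.1 ^ Module.finrank ℝ E)
      (fun _ => changeVar_affine (hasDerivAt_sinh_two_mul 0) (bijective_sinh_two_mul 0)
        (fun a => mul_nonneg zero_le_two (Real.cosh_pos _).le) (by fun_prop)
        (fun a => Real.cosh_pos a) (by fun_prop) measurable_const)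
      (by unfold Function.uncurry; fun_prop) (by unfold Function.uncurry; fun_prop)
  -- The factor `1/2` removes the 2 in the derivative of `s ↦ sinh (2 s)`, where `s` is half of `P.1
  -- - Q.1`.
  refine ⟨_, ((((h1.comp hsw).comp h2).comp (hsw.comp h3)).mul_const
    (by norm_num : (0 : ℝ) < 2⁻¹)).congr ?_ ?_⟩
  · intro p
    have : 2⁻¹ * (p.1.1 - p.2.1) = (p.1.1 - p.2.1) / 2 := by ring
    simp only [e, LinearEquiv.coe_mk, LinearMap.coe_mk, AddHom.coe_mk, Prod.swap, mid, gap,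
      Prod.smul_fst, Prod.smul_snd, Prod.fst_add, Prod.snd_add, Prod.fst_sub,
      smul_eq_mul, this, add_zero, sub_zero]
    refine Prod.ext (Prod.ext ?_ rfl) (Prod.ext ?_ rfl)
    · simp; ring
    · simp only []
      congr 1
      ring
  · intro p
    have : 2⁻¹ * (p.1.1 - p.2.1) = (p.1.1 - p.2.1) / 2 := by ring
    simp only [e, LinearEquiv.coe_mk, LinearMap.coe_mk, AddHom.coe_mk, Prod.swap,
      Prod.smul_fst, Prod.smul_snd, Prod.fst_add, Prod.snd_add, Prod.fst_sub,
      smul_eq_mul, this, sub_zero, one_mul, mul_one, inv_pow]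
    have h4 := pow_ne_zero (Module.finrank ℝ E) (hc ((p.1.1 - p.2.1) / 2))
    rw [mul_comm (2 * _), ← mul_assoc, ← mul_assoc, mul_assoc (2⁻¹ : ℝ), inv_mul_cancel₀ h4]
    rw [mul_one, ← mul_assoc]
    norm_num
    congr 1
    ring

/-- The frequency dual to the first point of the three-point phase. -/
def freq (w₀ w₁ w₂ : ℝ × E) : ℝ × E :=
  (Real.sinh (2 * (w₂.1 - w₁.1)),
    Real.cosh (w₁.1 - w₂.1) • (Real.cosh (w₀.1 - w₁.1) • w₂.2 - Real.cosh (w₂.1 - w₀.1) • w₁.2))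

/-- The key identity: at the midpoints of a triangle the frequency dual to one vertex depends only
on the endpoints of its side. The normalisation by `cosh⁻¹` in `mid` is chosen to cancel the `cosh`
factors of `freq`, after which the contributions of `Q` drop out. -/
theorem freq_mid (P Q R : ℝ × E) : freq (mid R P) (mid P Q) (mid Q R) = gap R P := by
  have h1 : (Q.1 + R.1) / 2 - (P.1 + Q.1) / 2 = (R.1 - P.1) / 2 := by ring
  have h2 : (P.1 + Q.1) / 2 - (Q.1 + R.1) / 2 = -((R.1 - P.1) / 2) := by ring
  have h3 : (R.1 + P.1) / 2 - (P.1 + Q.1) / 2 = -((Q.1 - R.1) / 2) := by ring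
  have h4 : (Q.1 + R.1) / 2 - (R.1 + P.1) / 2 = -((P.1 - Q.1) / 2) := by ring
  have h5 : 2 * ((R.1 - P.1) / 2) = R.1 - P.1 := by ring
  simp only [freq, mid, gap, h1, h2, h3, h4, h5, Real.cosh_neg, smul_smul,
    mul_inv_cancel₀ (Real.cosh_pos _).ne', one_mul, ← mul_assoc]
  refine Prod.ext rfl ?_
  simp only [smul_add, smul_sub]
  module

theorem changeVar_triple : ∃ c, ChangeVar
    (fun p : (ℝ × E) × (ℝ × E) × (ℝ × E) => (mid p.2.2 p.1, mid p.1 p.2.1, mid p.2.1 p.2.2))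
    (fun p => ((Real.cosh ((p.1.1 - p.2.2.1) / 2) * Real.cosh ((p.2.1.1 - p.1.1) / 2) *
      Real.cosh ((p.2.2.1 - p.2.1.1) / 2)) ^ Module.finrank ℝ E)⁻¹) c volume volume := by
  -- Taking midpoints of the sides of a triangle is invertible: each vertex is the sum of the
  -- midpoints of its two sides minus the third.
  let e : ((ℝ × E) × (ℝ × E) × (ℝ × E)) ≃ₗ[ℝ] ((ℝ × E) × (ℝ × E) × (ℝ × E)) :=
    { toFun := fun p => ((2 : ℝ)⁻¹ • (p.2.2 + p.1), (2 : ℝ)⁻¹ • (p.1 + p.2.1),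
        (2 : ℝ)⁻¹ • (p.2.1 + p.2.2))
      map_add' := fun p q => by
        refine Prod.ext ?_ (Prod.ext ?_ ?_) <;> simp only [Prod.fst_add, Prod.snd_add] <;> module
      map_smul' := fun r p => by
        refine Prod.ext ?_ (Prod.ext ?_ ?_) <;>
          simp only [Prod.smul_fst, Prod.smul_snd, RingHom.id_apply] <;> module
      invFun := fun p => (p.1 + p.2.1 - p.2.2, p.2.1 + p.2.2 - p.1, p.1 + p.2.2 - p.2.1)
      left_inv := fun p => by refine Prod.ext ?_ (Prod.ext ?_ ?_) <;> module
      right_inv := fun p => by refine Prod.ext ?_ (Prod.ext ?_ ?_) <;> module }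
  have i2 : (volume : Measure ((ℝ × E) × (ℝ × E))).IsAddHaarMeasure :=
    Measure.prod.instIsAddHaarMeasure (volume : Measure (ℝ × E)) (volume : Measure (ℝ × E))
  have i3 : (volume : Measure ((ℝ × E) × (ℝ × E) × (ℝ × E))).IsAddHaarMeasure :=
    Measure.prod.instIsAddHaarMeasure (volume : Measure (ℝ × E))
      (volume : Measure ((ℝ × E) × (ℝ × E)))
  obtain ⟨c, h1⟩ := ChangeVar.of_linearEquiv volume e
  -- One step scales the `E`-part of the first entry by a factor depending on the real coordinates
  -- of the other two and then rotates the triple. Real coordinates never change, so three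
  -- applications scale all entries and restore the order.
  have hrot : ChangeVar (fun p : (ℝ × E) × (ℝ × E) × (ℝ × E) =>
      (p.2.1, p.2.2, (p.1.1, (Real.cosh (p.2.1.1 - p.2.2.1))⁻¹ • p.1.2)))
      (fun p => (Real.cosh (p.2.1.1 - p.2.2.1))⁻¹ ^ Module.finrank ℝ E) 1 volume volume := by
    have hsw : ChangeVar Prod.swap (fun _ => 1) 1
        (volume : Measure ((ℝ × E) × (ℝ × E) × (ℝ × E)))
        (volume : Measure (((ℝ × E) × (ℝ × E)) × (ℝ × E))) :=
      ChangeVar.of_measurePreserving Measure.measurePreserving_swap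
    have hfib := ChangeVar.of_fiber (μ := (volume : Measure ((ℝ × E) × (ℝ × E))))
      (ν' := (volume : Measure (ℝ × E))) (ν := (volume : Measure (ℝ × E)))
      (Θ := fun x w => (w.1, (Real.cosh (x.1.1 - x.2.1))⁻¹ • w.2))
      (ρ := fun x _ => (Real.cosh (x.1.1 - x.2.1))⁻¹ ^ Module.finrank ℝ E)
      (fun x => changeVar_scale (inv_pos.2 (Real.cosh_pos _)))
      (by unfold Function.uncurry; fun_prop) (by unfold Function.uncurry; fun_prop)
    have has := ChangeVar.of_measurePreserving (measurePreserving_prodAssoc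
      (volume : Measure (ℝ × E)) (volume : Measure (ℝ × E)) (volume : Measure (ℝ × E)))
    have h := ((hsw.comp hfib).comp has).congr (Θ' := fun p : (ℝ × E) × (ℝ × E) × (ℝ × E) =>
      (p.2.1, p.2.2, (p.1.1, (Real.cosh (p.2.1.1 - p.2.2.1))⁻¹ • p.1.2)))
      (ρ' := fun p => (Real.cosh (p.2.1.1 - p.2.2.1))⁻¹ ^ Module.finrank ℝ E)
      (fun _ => rfl) (fun p => by simp [Prod.swap])
    rw [one_mul, one_mul] at h
    exact h
  refine ⟨_, (h1.comp (hrot.comp (hrot.comp hrot))).congr ?_ ?_⟩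
  · intro p
    have a1 : 2⁻¹ * (p.1.1 + p.2.1.1) - 2⁻¹ * (p.2.1.1 + p.2.2.1) = -((p.2.2.1 - p.1.1) / 2) := by
      ring
    have a2 : 2⁻¹ * (p.2.1.1 + p.2.2.1) - 2⁻¹ * (p.2.2.1 + p.1.1) = -((p.1.1 - p.2.1.1) / 2) := by
      ring
    have a3 : 2⁻¹ * (p.2.2.1 + p.1.1) - 2⁻¹ * (p.1.1 + p.2.1.1) = -((p.2.1.1 - p.2.2.1) / 2) := by
      ring
    simp only [e, LinearEquiv.coe_mk, LinearMap.coe_mk, AddHom.coe_mk, mid,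
      Prod.smul_fst, Prod.smul_snd, Prod.fst_add, Prod.snd_add, smul_eq_mul, a1, a2, a3,
      Real.cosh_neg]
    refine Prod.ext (Prod.ext ?_ rfl) (Prod.ext (Prod.ext ?_ rfl) (Prod.ext ?_ rfl)) <;>
      simp only [] <;> ring
  · intro p
    have a1 : 2⁻¹ * (p.1.1 + p.2.1.1) - 2⁻¹ * (p.2.1.1 + p.2.2.1) = (p.1.1 - p.2.2.1) / 2 := by
      ring
    have a2 : 2⁻¹ * (p.2.1.1 + p.2.2.1) - 2⁻¹ * (p.2.2.1 + p.1.1) = (p.2.1.1 - p.1.1) / 2 := by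
      ring
    have a3 : 2⁻¹ * (p.2.2.1 + p.1.1) - 2⁻¹ * (p.1.1 + p.2.1.1) = (p.2.2.1 - p.2.1.1) / 2 := by
      ring
    simp only [e, LinearEquiv.coe_mk, LinearMap.coe_mk, AddHom.coe_mk,
      Prod.smul_fst, Prod.fst_add, smul_eq_mul, a1, a2, a3, one_mul, inv_pow, mul_pow, mul_inv,
      mul_assoc]

end Triangular

/-! ### Darboux coordinates and the Liouville measure. -/

section Darboux

variable {V : Type*} [NormedAddCommGroup V] [NormedSpace ℝ V]

/-- A family of `n` pairs of vectors with the symplectic relations. -/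
structure IsSymplecticFamily (Ω : V →ₗ[ℝ] V →ₗ[ℝ] ℝ) {n : ℕ} (e f : Fin n → V) : Prop where
  left : ∀ i j, Ω (e i) (e j) = 0
  right : ∀ i j, Ω (f i) (f j) = 0
  pairing : ∀ i j, Ω (e i) (f j) = if i = j then 1 else 0

theorem IsSymplecticFamily.pairing_symm {Ω : V →ₗ[ℝ] V →ₗ[ℝ] ℝ} (hΩ : Ω.IsAlt) {n : ℕ}
    {e f : Fin n → V} (h : IsSymplecticFamily Ω e f) (i j : Fin n) :
    Ω (f i) (e j) = if j = i then -1 else 0 := by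
  rw [← hΩ.neg, h.pairing]
  split_ifs <;> simp

/-- The part of `v` orthogonal to a symplectic family. -/
def symplecticRest (Ω : V →ₗ[ℝ] V →ₗ[ℝ] ℝ) {n : ℕ} (e f : Fin n → V) (v : V) : V :=
  v - ∑ i, (Ω v (f i) • e i + Ω (e i) v • f i)

theorem symplecticRest_left {Ω : V →ₗ[ℝ] V →ₗ[ℝ] ℝ} {n : ℕ}
    {e f : Fin n → V} (h : IsSymplecticFamily Ω e f) (v : V) (j : Fin n) :
    Ω (e j) (symplecticRest Ω e f v) = 0 := by
  simp [symplecticRest, h.left, h.pairing, Finset.sum_ite_eq]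

theorem symplecticRest_right {Ω : V →ₗ[ℝ] V →ₗ[ℝ] ℝ} (hΩ : Ω.IsAlt) {n : ℕ}
    {e f : Fin n → V} (h : IsSymplecticFamily Ω e f) (v : V) (j : Fin n) :
    Ω (f j) (symplecticRest Ω e f v) = 0 := by
  simp only [symplecticRest, map_sub, map_sum, map_add, map_smul, h.right, h.pairing_symm hΩ,
    smul_eq_mul, mul_zero, add_zero, mul_ite, mul_neg, mul_one, Finset.sum_ite_eq',
    Finset.mem_univ, if_true]
  rw [← hΩ.neg]
  ring

/-- Symplectic Gram–Schmidt: a nonzero remainder `v'` pairs nontrivially with some `w`. Projecting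
`w` off the family does not change that pairing, since `v'` is orthogonal to the family, and the
projected `w` is rescaled to be dual to `v'`. -/
theorem exists_symplecticFamily_succ {Ω : V →ₗ[ℝ] V →ₗ[ℝ] ℝ} (hΩ : Ω.IsAlt)
    (hΩ' : Ω.Nondegenerate) {n : ℕ} {e f : Fin n → V} (h : IsSymplecticFamily Ω e f)
    {v : V} (hv : symplecticRest Ω e f v ≠ 0) :
    ∃ e' f' : Fin (n + 1) → V, IsSymplecticFamily Ω e' f' := by
  set v' := symplecticRest Ω e f v with hv'
  obtain ⟨w, hw⟩ : ∃ w, Ω v' w ≠ 0 := by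
    by_contra hc
    push Not at hc
    exact hv (hΩ'.1 v' hc)
  set w' := symplecticRest Ω e f w with hw'
  have l1 : ∀ j, Ω (e j) v' = 0 := symplecticRest_left h v
  have l2 : ∀ j, Ω (f j) v' = 0 := symplecticRest_right hΩ h v
  have l3 : ∀ j, Ω (e j) w' = 0 := symplecticRest_left h w
  have l4 : ∀ j, Ω (f j) w' = 0 := symplecticRest_right hΩ h w
  have l1' : ∀ j, Ω v' (e j) = 0 := fun j => by rw [← hΩ.neg, l1, neg_zero]
  have l2' : ∀ j, Ω v' (f j) = 0 := fun j => by rw [← hΩ.neg, l2, neg_zero]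
  have l4' : ∀ j, Ω w' (f j) = 0 := fun j => by rw [← hΩ.neg, l4, neg_zero]
  have h1 : Ω v' w' = Ω v' w := by
    rw [hw', symplecticRest]
    simp [l1', l2']
  refine ⟨Fin.cons v' e, Fin.cons ((Ω v' w)⁻¹ • w') f, ⟨?_, ?_, ?_⟩⟩
  · simp [Fin.forall_fin_succ, l1, l1', h.left, hΩ.self_eq_zero]
  · simp [Fin.forall_fin_succ, l4, l4', h.right, hΩ.self_eq_zero]
  · simp [Fin.forall_fin_succ, l2', l3, h.pairing, h1, hw, Fin.succ_ne_zero,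
      (Fin.succ_ne_zero _).symm]

variable [FiniteDimensional ℝ V]

theorem IsSymplecticFamily.linearIndependent {Ω : V →ₗ[ℝ] V →ₗ[ℝ] ℝ}
    {n : ℕ} {e f : Fin n → V} (h : IsSymplecticFamily Ω e f) : LinearIndependent ℝ e := by
  rw [Fintype.linearIndependent_iff]
  intro c hc j
  have h1 := congrArg (fun x => Ω x (f j)) hc
  simpa [h.pairing] using h1

/-- If no family exhausted `V`, families of every length would exist; their first halves are
linearly independent, which contradicts finite dimension. -/
theorem exists_symplecticFamily_spanning {Ω : V →ₗ[ℝ] V →ₗ[ℝ] ℝ} (hΩ : Ω.IsAlt)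
    (hΩ' : Ω.Nondegenerate) : ∃ (n : ℕ) (e f : Fin n → V), IsSymplecticFamily Ω e f ∧
      ∀ v, symplecticRest Ω e f v = 0 := by
  by_contra hc
  push Not at hc
  have h1 : ∀ n : ℕ, ∃ e f : Fin n → V, IsSymplecticFamily Ω e f := by
    intro n
    induction n with
    | zero => exact ⟨Fin.elim0, Fin.elim0, ⟨fun i => i.elim0, fun i => i.elim0, fun i => i.elim0⟩⟩
    | succ n ih =>
      obtain ⟨e, f, h⟩ := ih
      obtain ⟨v, hv⟩ := hc n e f h
      exact exists_symplecticFamily_succ hΩ hΩ' h hv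
  obtain ⟨e, f, h⟩ := h1 (Module.finrank ℝ V + 1)
  have := h.linearIndependent.fintype_card_le_finrank
  simp at this

/-- Darboux coordinates: a linear isomorphism of `V` with `E × E` carrying `Ω` to the standard
symplectic form. -/
def IsDarboux {E : Type*} [NormedAddCommGroup E] [InnerProductSpace ℝ E]
    (Ω : V →ₗ[ℝ] V →ₗ[ℝ] ℝ) (e : V ≃L[ℝ] E × E) : Prop :=
  ∀ x y, Ω x y = inner ℝ (e x).1 (e y).2 - inner ℝ (e x).2 (e y).1

theorem exists_darboux {Ω : V →ₗ[ℝ] V →ₗ[ℝ] ℝ} (hΩ : Ω.IsAlt) (hΩ' : Ω.Nondegenerate) :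
    ∃ (n : ℕ) (e : V ≃L[ℝ] EuclideanSpace ℝ (Fin n) × EuclideanSpace ℝ (Fin n)),
      IsDarboux Ω e := by
  obtain ⟨n, e, f, h, hs⟩ := exists_symplecticFamily_spanning hΩ hΩ'
  have hs' : ∀ v, v = ∑ i, (Ω v (f i) • e i + Ω (e i) v • f i) := fun v =>
    sub_eq_zero.1 (hs v)
  let φ : V ≃ₗ[ℝ] EuclideanSpace ℝ (Fin n) × EuclideanSpace ℝ (Fin n) :=
    { toFun := fun v => (WithLp.toLp 2 fun i => Ω v (f i), WithLp.toLp 2 fun i => Ω (e i) v)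
      map_add' := fun v w => by
        ext i <;> simp
      map_smul' := fun r v => by
        ext i <;> simp
      invFun := fun p => ∑ i, (p.1 i • e i + p.2 i • f i)
      left_inv := fun v => (hs' v).symm
      right_inv := fun p => by
        ext i
        · simp [h.pairing, h.right]
        · simp [h.pairing, h.left] }
  refine ⟨n, φ.toContinuousLinearEquiv, fun x y => ?_⟩
  conv_lhs => rw [hs' x]
  have h2 : ∀ i, Ω (f i) y = -Ω y (f i) := fun i => (hΩ.neg _ _).symm
  simp only [LinearEquiv.coe_toContinuousLinearEquiv', φ, LinearEquiv.coe_mk, LinearMap.coe_mk,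
    AddHom.coe_mk, map_sum, map_add, map_smul, LinearMap.sum_apply, LinearMap.add_apply,
    LinearMap.smul_apply, smul_eq_mul, PiLp.inner_apply, h2]
  simp [Finset.sum_add_distrib, mul_comm, sub_eq_add_neg]

variable [MeasurableSpace V] [BorelSpace V]

/-- The Gram matrix of `Ω` in a basis is `Aᵀ G A`, where `A` is the transition matrix to the Darboux
basis and `G` the Gram matrix there. As `|det G| = 1`, the square root in the definition of
`liouville` is `|det A|`, exactly the factor between the two Haar measures. -/
theorem liouville_eq_map {n : ℕ} {Ω : V →ₗ[ℝ] V →ₗ[ℝ] ℝ}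
    {e : V ≃L[ℝ] EuclideanSpace ℝ (Fin n) × EuclideanSpace ℝ (Fin n)} (he : IsDarboux Ω e) :
    liouville Ω = Measure.map e.symm volume := by
  let b₀ := ((EuclideanSpace.basisFun (Fin n) ℝ).toBasis.prod
    (EuclideanSpace.basisFun (Fin n) ℝ).toBasis).map e.symm.toLinearEquiv
  have h1 : Measure.map e.symm volume = b₀.addHaar := by
    rw [← Module.Basis.map_addHaar, Module.Basis.prod_addHaar, OrthonormalBasis.addHaar_eq_volume,
      Measure.volume_eq_prod]
  have hcard : Fintype.card (Fin n ⊕ Fin n) = Module.finrank ℝ V :=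
    (Module.finrank_eq_card_basis b₀).symm
  let ι : Fin n ⊕ Fin n ≃ Fin (Module.finrank ℝ V) := Fintype.equivFinOfCardEq hcard
  let b := Module.finBasis ℝ V
  let b₁ := b₀.reindex ι
  have h2 : b₁.addHaar = ENNReal.ofReal |b₁.det b| • b.addHaar := by
    have := Measure.addHaarMeasure_unique b₁.addHaar b.parallelepiped
    rw [Module.Basis.coe_parallelepiped, Measure.addHaar_parallelepiped] at this
    rw [Module.Basis.addHaar_def b]
    exact this
  have h3 : (Matrix.of fun i j => Ω (b i) (b j))
      = (b₁.toMatrix b).transpose * (Matrix.of fun i j => Ω (b₁ i) (b₁ j)) * b₁.toMatrix b := by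
    have h := LinearMap.BilinForm.toMatrix_mul_basis_toMatrix b₁ b (B := Ω)
    have h' : ∀ c : Module.Basis (Fin (Module.finrank ℝ V)) ℝ V,
        LinearMap.BilinForm.toMatrix c Ω = Matrix.of fun i j => Ω (c i) (c j) := fun c => by
      ext i j
      simp [LinearMap.BilinForm.toMatrix_apply]
    rw [h', h'] at h
    exact h.symm
  have h4 : |(Matrix.of fun i j => Ω (b₁ i) (b₁ j)).det| = 1 := by
    have h5 : (Matrix.of fun i j => Ω (b₁ i) (b₁ j))
        = ((Matrix.J (Fin n) ℝ).transpose).submatrix ι.symm ι.symm := by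
      ext i j
      obtain ⟨i, rfl⟩ := ι.surjective i
      obtain ⟨j, rfl⟩ := ι.surjective j
      simp only [Matrix.of_apply, b₁, Module.Basis.reindex_apply, Equiv.symm_apply_apply,
        Matrix.submatrix_apply, Matrix.transpose_apply, he _ _, b₀, Module.Basis.map_apply]
      rcases i with i | i <;> rcases j with j | j <;>
        simp [Matrix.J, Matrix.one_apply, EuclideanSpace.inner_single_left, eq_comm]
    rw [h5, Matrix.det_submatrix_equiv_self, Matrix.det_transpose]
    have h6 := Matrix.J_det_mul_J_det (l := Fin n) (R := ℝ)
    rcases mul_self_eq_one_iff.1 h6 with h7 | h7 <;> rw [h7] <;> simp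
  rw [h1, ← Module.Basis.addHaar_reindex b₀ ι, h2]
  unfold liouville
  rw [h3, Matrix.det_mul, Matrix.det_mul, Matrix.det_transpose, abs_mul, abs_mul, h4, mul_one,
    Real.sqrt_mul_self (abs_nonneg _)]
  rfl

end Darboux

/-! ### From functions to integral kernels. -/

section KernelPicture

variable {E : Type*} [NormedAddCommGroup E] [InnerProductSpace ℝ E]
  [FiniteDimensional ℝ E] [MeasurableSpace E] [BorelSpace E]

instance : (volume : Measure ((ℝ × E) × (ℝ × E))).IsAddHaarMeasure :=
  Measure.prod.instIsAddHaarMeasure (volume : Measure (ℝ × E)) (volume : Measure (ℝ × E))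

theorem lintegral_volume_prod {X Y : Type*} [MeasureSpace X] [MeasureSpace Y]
    [SFinite (volume : Measure X)] [SFinite (volume : Measure Y)] {f : X × Y → ℝ≥0∞}
    (hf : Measurable f) : ∫⁻ p, f p = ∫⁻ x, ∫⁻ y, f (x, y) :=
  lintegral_prod f hf.aemeasurable

theorem integral_volume_prod {X Y : Type*} [MeasureSpace X] [MeasureSpace Y]
    [SFinite (volume : Measure X)] [SFinite (volume : Measure Y)] {f : X × Y → ℂ}
    (hf : Integrable f) : ∫ p, f p = ∫ x, ∫ y, f (x, y) :=
  integral_prod f hf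

/-- Smooth compactly supported functions on `(ℝ × E) × (ℝ × E)`. -/
def IsTestW (U : (ℝ × E) × (ℝ × E) → ℂ) : Prop := ContDiff ℝ ∞ U ∧ HasCompactSupport U

/-- The partial Fourier transform in the second variable. -/
def pft (κ : ℝ) (U : (ℝ × E) × (ℝ × E) → ℂ) (w ξ : ℝ × E) : ℂ := ft κ (fun ζ => U (w, ζ)) ξ

namespace IsTestW

variable {κ : ℝ} {U : (ℝ × E) × (ℝ × E) → ℂ}

theorem contDiff_slice (h : IsTestW U) (w : ℝ × E) : ContDiff ℝ ∞ fun ζ => U (w, ζ) :=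
  h.1.comp (contDiff_const.prodMk contDiff_id)

theorem exists_compact (h : IsTestW U) : ∃ s t : Set (ℝ × E), IsCompact s ∧ IsCompact t ∧
    ∀ w ζ, (w ∉ s ∨ ζ ∉ t) → U (w, ζ) = 0 := by
  refine ⟨Prod.fst '' tsupport U, Prod.snd '' tsupport U, h.2.isCompact.image continuous_fst,
    h.2.isCompact.image continuous_snd, fun w ζ hw => image_eq_zero_of_notMem_tsupport fun hc => ?_⟩
  rcases hw with hw | hw
  · exact hw ⟨_, hc, rfl⟩
  · exact hw ⟨_, hc, rfl⟩

theorem hasCompactSupport_slice (h : IsTestW U) (w : ℝ × E) :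
    HasCompactSupport fun ζ => U (w, ζ) := by
  obtain ⟨s, t, -, ht, h0⟩ := h.exists_compact
  exact HasCompactSupport.intro ht fun ζ hζ => h0 w ζ (Or.inr hζ)

theorem continuous_pft (h : IsTestW U) (κ : ℝ) :
    Continuous fun p : (ℝ × E) × (ℝ × E) => pft κ U p.1 p.2 := by
  obtain ⟨s, t, -, ht, h0⟩ := h.exists_compact
  exact continuous_ft κ (U := fun w ζ => U (w, ζ)) h.1.continuous ht
    fun w ζ hζ => h0 w ζ (Or.inr hζ)

theorem continuous_pft_comp (h : IsTestW U) (κ : ℝ) {T : Type*} [TopologicalSpace T]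
    {f g : T → ℝ × E} (hf : Continuous f) (hg : Continuous g) :
    Continuous fun x => pft κ U (f x) (g x) :=
  Continuous.comp (g := fun p : (ℝ × E) × (ℝ × E) => pft κ U p.1 p.2)
    (f := fun x => (f x, g x)) (h.continuous_pft κ) (hf.prodMk hg)

theorem pft_eq_zero (h : IsTestW U) (κ : ℝ) : ∃ s : Set (ℝ × E), IsCompact s ∧
    ∀ w ∉ s, ∀ ξ, pft κ U w ξ = 0 := by
  obtain ⟨s, t, hs, -, h0⟩ := h.exists_compact
  exact ⟨s, hs, fun w hw ξ => by simp [pft, ft, h0 w _ (Or.inl hw)]⟩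

theorem lintegral_pft_sq (h : IsTestW U) (hκ : κ ≠ 0) :
    ∫⁻ p : (ℝ × E) × (ℝ × E), ‖pft κ U p.1 p.2‖ₑ ^ 2
      = ENNReal.ofReal (ftConst E κ) * ∫⁻ p, ‖U p‖ₑ ^ 2 := by
  have hm : Measurable fun p : (ℝ × E) × (ℝ × E) => ‖pft κ U p.1 p.2‖ₑ ^ 2 :=
    (h.continuous_pft κ).measurable.enorm.pow_const 2
  have hm' : Measurable fun p : (ℝ × E) × (ℝ × E) => ‖U p‖ₑ ^ 2 :=
    h.1.continuous.measurable.enorm.pow_const 2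
  have e1 : ∫⁻ p : (ℝ × E) × (ℝ × E), ‖pft κ U p.1 p.2‖ₑ ^ 2
      = ∫⁻ w : ℝ × E, ∫⁻ ξ : ℝ × E, ‖pft κ U w ξ‖ₑ ^ 2 := lintegral_volume_prod hm
  have e2 : ∫⁻ p : (ℝ × E) × (ℝ × E), ‖U p‖ₑ ^ 2
      = ∫⁻ w : ℝ × E, ∫⁻ ζ : ℝ × E, ‖U (w, ζ)‖ₑ ^ 2 := lintegral_volume_prod hm'
  have e3 : Measurable fun w : ℝ × E => ∫⁻ ζ : ℝ × E, ‖U (w, ζ)‖ₑ ^ 2 :=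
    hm'.lintegral_prod_right'
  have e4 : ∀ w : ℝ × E, ∫⁻ ξ : ℝ × E, ‖pft κ U w ξ‖ₑ ^ 2
      = ENNReal.ofReal (ftConst E κ) * ∫⁻ ζ : ℝ × E, ‖U (w, ζ)‖ₑ ^ 2 := fun w =>
    lintegral_ft_sq hκ (h.contDiff_slice w) (h.hasCompactSupport_slice w)
  calc ∫⁻ p : (ℝ × E) × (ℝ × E), ‖pft κ U p.1 p.2‖ₑ ^ 2
      = ∫⁻ w : ℝ × E, ∫⁻ ξ : ℝ × E, ‖pft κ U w ξ‖ₑ ^ 2 := e1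
    _ = ∫⁻ w : ℝ × E, ENNReal.ofReal (ftConst E κ) * ∫⁻ ζ : ℝ × E, ‖U (w, ζ)‖ₑ ^ 2 :=
        lintegral_congr e4
    _ = ENNReal.ofReal (ftConst E κ) * ∫⁻ w : ℝ × E, ∫⁻ ζ : ℝ × E, ‖U (w, ζ)‖ₑ ^ 2 :=
        lintegral_const_mul _ e3
    _ = ENNReal.ofReal (ftConst E κ) * ∫⁻ p, ‖U p‖ₑ ^ 2 := by rw [e2]

end IsTestW

/-- The integral kernel attached to a function on `(ℝ × E) × (ℝ × E)`. -/
def ker (κ : ℝ) (U : (ℝ × E) × (ℝ × E) → ℂ) (p : (ℝ × E) × (ℝ × E)) : ℂ :=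
  (Real.sqrt (Real.cosh (p.1.1 - p.2.1)) : ℂ) * pft κ U (mid p.1 p.2) (gap p.1 p.2)

theorem continuous_ker {U : (ℝ × E) × (ℝ × E) → ℂ} (h : IsTestW U) (κ : ℝ) :
    Continuous (ker κ U) := by
  have h1 : Continuous fun p : (ℝ × E) × (ℝ × E) => pft κ U (mid p.1 p.2) (gap p.1 p.2) :=
    h.continuous_pft_comp κ (by fun_prop) (by fun_prop)
  unfold ker
  fun_prop

/-- Conjugating `U` conjugates its transform and reflects the frequency, while swapping the two
points fixes `mid` and reverses `gap`. So complex conjugation becomes the adjoint of kernels. -/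
theorem ker_conj (κ : ℝ) (U : (ℝ × E) × (ℝ × E) → ℂ) (p : (ℝ × E) × (ℝ × E)) :
    ker κ (fun q => (starRingEnd ℂ) (U q)) p = (starRingEnd ℂ) (ker κ U p.swap) := by
  have h1 : p.2.1 - p.1.1 = -(p.1.1 - p.2.1) := by ring
  have h2 := congrArg (starRingEnd ℂ) (ft_neg_conj κ (fun ζ => U (mid p.1 p.2, ζ)) (gap p.1 p.2))
  rw [Complex.conj_conj] at h2
  simp only [ker, Prod.swap, map_mul, Complex.conj_ofReal, pft, h2]
  rw [h1, Real.cosh_neg, mid_comm p.2 p.1, gap_neg p.1 p.2]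

theorem ker_add {U U' : (ℝ × E) × (ℝ × E) → ℂ} (h : IsTestW U) (h' : IsTestW U') (κ : ℝ) :
    ker κ (U + U') = ker κ U + ker κ U' := by
  funext p
  simp only [ker, pft, ft, Pi.add_apply, mul_add]
  rw [integral_add, mul_add]
  · have := (h.contDiff_slice (mid p.1 p.2)).continuous
    exact ((by fun_prop : Continuous fun ζ : ℝ × E => Complex.exp ((κ * pair ζ (gap p.1 p.2) : ℝ) *
      Complex.I)).mul this).integrable_of_hasCompactSupport
      (h.hasCompactSupport_slice _).mul_left
  · have := (h'.contDiff_slice (mid p.1 p.2)).continuous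
    exact ((by fun_prop : Continuous fun ζ : ℝ × E => Complex.exp ((κ * pair ζ (gap p.1 p.2) : ℝ) *
      Complex.I)).mul this).integrable_of_hasCompactSupport
      (h'.hasCompactSupport_slice _).mul_left

theorem ker_smul (κ : ℝ) (c : ℂ) (U : (ℝ × E) × (ℝ × E) → ℂ) :
    ker κ (c • U) = c • ker κ U := by
  funext p
  simp only [ker, pft, ft, Pi.smul_apply, smul_eq_mul, mul_left_comm _ c, integral_const_mul]

/-- The factor `√cosh` in `ker` is the square root of the Jacobian of `(mid, gap)`; after that
substitution only the fibrewise Plancherel formula is left. -/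
theorem exists_lintegral_ker_sq {κ : ℝ} (hκ : κ ≠ 0) : ∃ c : ℝ, 0 < c ∧
    ∀ U : (ℝ × E) × (ℝ × E) → ℂ, IsTestW U →
      ∫⁻ p, ‖ker κ U p‖ₑ ^ 2 = ENNReal.ofReal c * ∫⁻ p, ‖U p‖ₑ ^ 2 := by
  obtain ⟨c, hc⟩ := changeVar_mid_gap (E := E)
  refine ⟨c * ftConst E κ, mul_pos hc.pos (ftConst_pos hκ), fun U hU => ?_⟩
  have hm : Measurable fun p : (ℝ × E) × (ℝ × E) => ‖pft κ U p.1 p.2‖ₑ ^ 2 :=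
    (hU.continuous_pft κ).measurable.enorm.pow_const 2
  rw [ENNReal.ofReal_mul hc.pos.le, mul_assoc, ← hU.lintegral_pft_sq hκ,
    ← hc.lintegral (fun q => ‖pft κ U q.1 q.2‖ₑ ^ 2) hm]
  refine lintegral_congr fun p => ?_
  rw [ker, enorm_mul, mul_pow, mul_comm]
  congr 1
  rw [← ofReal_norm, Complex.norm_real, Real.norm_of_nonneg (Real.sqrt_nonneg _),
    ← ENNReal.ofReal_pow (Real.sqrt_nonneg _), Real.sq_sqrt (Real.cosh_pos _).le]

/-- The inverse of `(mid, gap)`. -/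
def unmidgap (p : (ℝ × E) × (ℝ × E)) : (ℝ × E) × (ℝ × E) :=
  ((p.1.1 + Real.arsinh p.2.1 / 2, Real.cosh (Real.arsinh p.2.1 / 2) • p.1.2
      + (Real.cosh (Real.arsinh p.2.1 / 2))⁻¹ • p.2.2),
    (p.1.1 - Real.arsinh p.2.1 / 2, Real.cosh (Real.arsinh p.2.1 / 2) • p.1.2
      - (Real.cosh (Real.arsinh p.2.1 / 2))⁻¹ • p.2.2))

theorem unmidgap_mid_gap (P Q : ℝ × E) : unmidgap (mid P Q, gap P Q) = (P, Q) := by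
  have h := (Real.cosh_pos ((P.1 - Q.1) / 2)).ne'
  simp only [unmidgap, mid, gap, Real.arsinh_sinh, smul_smul, ← mul_assoc, mul_inv_cancel₀ h,
    inv_mul_cancel₀ h, one_mul]
  refine Prod.ext (Prod.ext ?_ ?_) (Prod.ext ?_ ?_)
  · simp only []; ring
  · simp only []; module
  · simp only []; ring
  · simp only []; module

theorem continuous_unmidgap : Continuous (unmidgap : (ℝ × E) × (ℝ × E) → _) := by
  have h : ∀ p : (ℝ × E) × (ℝ × E), Real.cosh (Real.arsinh p.2.1 / 2) ≠ 0 :=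
    fun p => (Real.cosh_pos _).ne'
  have h2 := Real.continuous_arsinh
  unfold unmidgap
  fun_prop (disch := assumption)

theorem isTestW_mul {φ ψ : ℝ × E → ℂ} (h1 : ContDiff ℝ ∞ φ) (h2 : HasCompactSupport φ)
    (h3 : ContDiff ℝ ∞ ψ) (h4 : HasCompactSupport ψ) :
    IsTestW fun p : (ℝ × E) × (ℝ × E) => φ p.1 * ψ p.2 := by
  refine ⟨(h1.comp contDiff_fst).mul (h3.comp contDiff_snd),
    HasCompactSupport.intro (h2.isCompact.prod h4.isCompact) fun p hp => ?_⟩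
  rw [Set.mem_prod, not_and_or] at hp
  rcases hp with hp | hp
  · rw [image_eq_zero_of_notMem_tsupport hp, zero_mul]
  · rw [image_eq_zero_of_notMem_tsupport hp, mul_zero]

/-- Products `φ(w) ψ(ζ)` already suffice. For fixed `ψ`, varying `φ` shows that almost every slice
`k(w, ·)` is orthogonal to `ft κ ψ`; such transforms are dense, so `ae_eq_zero_of_dense` applies
with the variables exchanged. -/
theorem eq_zero_of_integral_pft {κ : ℝ} (hκ : κ ≠ 0) {k : (ℝ × E) × (ℝ × E) → ℂ}
    (hk : Measurable k) (hk2 : ∫⁻ p, ‖k p‖ₑ ^ 2 < ⊤)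
    (h : ∀ U, IsTestW U → ∫ p : (ℝ × E) × (ℝ × E), (starRingEnd ℂ) (pft κ U p.1 p.2) * k p = 0) :
    k =ᵐ[volume] 0 := by
  have hk' : Measurable fun p : (ℝ × E) × (ℝ × E) => k p.swap := hk.comp measurable_swap
  have hk2' : ∫⁻ p : (ℝ × E) × (ℝ × E), ‖k p.swap‖ₑ ^ 2 ∂(volume.prod volume) < ⊤ := by
    rwa [lintegral_prod_swap (μ := volume) (ν := volume) fun p : (ℝ × E) × (ℝ × E) => ‖k p‖ₑ ^ 2]
  have key : (fun p : (ℝ × E) × (ℝ × E) => k p.swap) =ᵐ[volume.prod volume] 0 := by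
    refine ae_eq_zero_of_dense hk' hk2' (dense_ft hκ) ?_
    rintro g ⟨ψ, h1, h2, h3⟩
    have hg : ∀ w, ∫ ξ, (starRingEnd ℂ) (g ξ) * k (w, ξ)
        = ∫ ξ, (starRingEnd ℂ) (ft κ ψ ξ) * k (w, ξ) := fun w => by
      refine integral_congr_ae ?_
      filter_upwards [h3] with ξ hξ
      rw [hξ]
    simp only [Prod.swap_prod_mk, hg]
    have hF : Continuous (ft κ ψ) :=
      (continuous_ft κ (X := Unit) (U := fun _ => ψ) (h1.continuous.comp continuous_snd)
        h2.isCompact (fun _ ζ hζ => image_eq_zero_of_notMem_tsupport hζ)).comp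
        (by fun_prop : Continuous fun ξ : ℝ × E => ((), ξ))
    have hF2 := lintegral_lt_top_of_memLp_two (memLp_ft hκ h1 h2)
    have hsm : StronglyMeasurable fun w => ∫ ξ, (starRingEnd ℂ) (ft κ ψ ξ) * k (w, ξ) := by
      refine StronglyMeasurable.integral_prod_right'
        (f := fun q : (ℝ × E) × (ℝ × E) => (starRingEnd ℂ) (ft κ ψ q.2) * k q) ?_
      have : Measurable fun q : (ℝ × E) × (ℝ × E) => (starRingEnd ℂ) (ft κ ψ q.2) :=
        (Complex.continuous_conj.comp (hF.comp continuous_snd)).measurable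
      exact (this.mul hk).stronglyMeasurable
    -- Square integrability, from Cauchy–Schwarz on each slice, supplies the local integrability
    -- required to test against `φ`.
    have hL2 : MemLp (fun w => ∫ ξ, (starRingEnd ℂ) (ft κ ψ ξ) * k (w, ξ)) 2 volume := by
      refine memLp_two_of_lintegral hsm.aestronglyMeasurable ?_
      calc ∫⁻ w, ‖∫ ξ, (starRingEnd ℂ) (ft κ ψ ξ) * k (w, ξ)‖ₑ ^ 2
          ≤ ∫⁻ w, (∫⁻ ξ, ‖ft κ ψ ξ‖ₑ ^ 2) * ∫⁻ ξ, ‖k (w, ξ)‖ₑ ^ 2 := by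
            refine lintegral_mono fun w => ?_
            refine le_trans (pow_le_pow_left' (enorm_integral_le_lintegral_enorm _) 2) ?_
            simp only [enorm_mul, RCLike.enorm_conj]
            exact lintegral_mul_sq_le (by fun_prop) (by fun_prop)
        _ = (∫⁻ ξ, ‖ft κ ψ ξ‖ₑ ^ 2) * ∫⁻ p, ‖k p‖ₑ ^ 2 := by
            rw [lintegral_const_mul _ (by fun_prop),
              lintegral_volume_prod (f := fun p : (ℝ × E) × (ℝ × E) => ‖k p‖ₑ ^ 2) (by fun_prop)]
        _ < ⊤ := ENNReal.mul_lt_top hF2 hk2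
    refine ae_eq_zero_of_integral_contDiff_smul_eq_zero
      (hL2.locallyIntegrable (by norm_num)) fun φ hφ hφc => ?_
    have hφ' : ContDiff ℝ ∞ fun w => (φ w : ℂ) := Complex.ofRealCLM.contDiff.comp hφ
    have hφc' : HasCompactSupport fun w => (φ w : ℂ) :=
      hφc.comp_left (g := fun r : ℝ => (r : ℂ)) (by simp)
    have h0 := h _ (isTestW_mul hφ' hφc' h1 h2)
    have hpft : ∀ w ξ, pft κ (fun p : (ℝ × E) × (ℝ × E) => (φ p.1 : ℂ) * ψ p.2) w ξ
        = φ w * ft κ ψ ξ := fun w ξ => by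
      simp only [pft, ft, mul_left_comm _ (φ w : ℂ), integral_const_mul]
    simp only [hpft, map_mul, Complex.conj_ofReal] at h0
    have hint : Integrable (fun p : (ℝ × E) × (ℝ × E) =>
        (φ p.1 : ℂ) * (starRingEnd ℂ) (ft κ ψ p.2) * k p) (volume.prod volume) := by
      have hm1 : MemLp (fun p : (ℝ × E) × (ℝ × E) =>
          (φ p.1 : ℂ) * (starRingEnd ℂ) (ft κ ψ p.2)) 2 (volume.prod volume) :=
        HS.memLp_rankOne (hφ'.continuous.memLp_of_hasCompactSupport hφc')
          ((memLp_ft hκ h1 h2).star)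
      exact hm1.integrable_mul (memLp_two_of_lintegral hk.aestronglyMeasurable hk2)
    rw [integral_volume_prod hint] at h0
    rw [← h0]
    refine integral_congr_ae (Filter.Eventually.of_forall fun w => ?_)
    simp only [mul_assoc, integral_const_mul, Complex.real_smul]
  have := (Measure.measurePreserving_swap (μ := (volume : Measure (ℝ × E)))
    (ν := (volume : Measure (ℝ × E)))).quasiMeasurePreserving.ae key
  exact this

/-- Totality of the kernels follows from that of the partial Fourier transforms by the substitution
`(mid, gap)`. -/
theorem eq_zero_of_integral_ker {κ : ℝ} (hκ : κ ≠ 0) {k : (ℝ × E) × (ℝ × E) → ℂ}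
    (hk : Measurable k) (hk2 : ∫⁻ p, ‖k p‖ₑ ^ 2 < ⊤)
    (h : ∀ U, IsTestW U → ∫ p : (ℝ × E) × (ℝ × E), (starRingEnd ℂ) (ker κ U p) * k p = 0) :
    k =ᵐ[volume] 0 := by
  obtain ⟨c, hc⟩ := changeVar_mid_gap (E := E)
  -- Dividing by `√cosh` leaves, against `ker`, exactly one factor of the Jacobian `cosh = √cosh ·
  -- √cosh`.
  let k₁ : (ℝ × E) × (ℝ × E) → ℂ := fun p =>
    ((Real.sqrt (Real.cosh (p.1.1 - p.2.1)))⁻¹ : ℝ) * k p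
  have hk₁ : Measurable k₁ := by fun_prop
  let k' : (ℝ × E) × (ℝ × E) → ℂ := fun q => k₁ (unmidgap q)
  have hk' : Measurable k' := hk₁.comp continuous_unmidgap.measurable
  have e1 : ∀ p : (ℝ × E) × (ℝ × E), k' (mid p.1 p.2, gap p.1 p.2) = k₁ p := fun p => by
    simp only [k', unmidgap_mid_gap]
  have hs : ∀ p : (ℝ × E) × (ℝ × E), 0 < Real.sqrt (Real.cosh (p.1.1 - p.2.1)) := fun p =>
    Real.sqrt_pos.2 (Real.cosh_pos _)
  have hs2 : ∀ p : (ℝ × E) × (ℝ × E), Real.cosh (p.1.1 - p.2.1)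
      = Real.sqrt (Real.cosh (p.1.1 - p.2.1)) * Real.sqrt (Real.cosh (p.1.1 - p.2.1)) := fun p =>
    (Real.mul_self_sqrt (Real.cosh_pos _).le).symm
  have e2 : ∫⁻ p, ‖k p‖ₑ ^ 2 = ENNReal.ofReal c * ∫⁻ q, ‖k' q‖ₑ ^ 2 := by
    rw [← hc.lintegral (fun q => ‖k' q‖ₑ ^ 2) (by fun_prop)]
    refine lintegral_congr fun p => ?_
    rw [e1, enorm_mul, mul_pow, ← ofReal_norm ((_ : ℝ) : ℂ), Complex.norm_real,
      Real.norm_of_nonneg (inv_nonneg.2 (hs p).le), ← ENNReal.ofReal_pow (inv_nonneg.2 (hs p).le),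
      mul_right_comm, ← ENNReal.ofReal_mul (by positivity), inv_pow, Real.sq_sqrt
      (Real.cosh_pos _).le, inv_mul_cancel₀ (Real.cosh_pos _).ne', ENNReal.ofReal_one, one_mul]
  have hc0 : ENNReal.ofReal c ≠ 0 := by simp [hc.pos]
  have hk'2 : ∫⁻ q, ‖k' q‖ₑ ^ 2 < ⊤ := by
    rw [e2] at hk2
    exact (ENNReal.mul_lt_top_iff.1 hk2).elim (fun h => h.2)
      (fun h => h.elim (fun h => absurd h hc0) (fun h => by rw [h]; exact ENNReal.zero_lt_top))
  have hz : k' =ᵐ[volume] 0 := by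
    refine eq_zero_of_integral_pft hκ hk' hk'2 fun U hU => ?_
    have hcont : Continuous fun q : (ℝ × E) × (ℝ × E) => (starRingEnd ℂ) (pft κ U q.1 q.2) :=
      Complex.continuous_conj.comp (hU.continuous_pft κ)
    have h1 := hc.integral (f := fun q => (starRingEnd ℂ) (pft κ U q.1 q.2) * k' q)
      (hcont.measurable.mul hk')
    have h2 : ∫ p : (ℝ × E) × (ℝ × E), (Real.cosh (p.1.1 - p.2.1) : ℂ) *
        ((starRingEnd ℂ) (pft κ U (mid p.1 p.2) (gap p.1 p.2)) * k' (mid p.1 p.2, gap p.1 p.2))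
        = 0 := by
      rw [← h U hU]
      refine integral_congr_ae (Filter.Eventually.of_forall fun p => ?_)
      have h3 : (Real.sqrt (Real.cosh (p.1.1 - p.2.1)) : ℂ) ≠ 0 := by
        exact_mod_cast (hs p).ne'
      simp only [e1, k₁, ker, map_mul, Complex.conj_ofReal, Complex.ofReal_inv]
      rw [hs2 p]
      simp only [Complex.ofReal_mul, Real.sqrt_mul_self (Real.sqrt_nonneg _)]
      field_simp
    rw [h2] at h1
    have hcC : (c : ℂ) ≠ 0 := by exact_mod_cast hc.pos.ne'
    exact (mul_eq_zero.1 h1.symm).resolve_left hcC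
  have e3 : ∫⁻ q, ‖k' q‖ₑ ^ 2 = 0 := by
    rw [lintegral_eq_zero_iff (by fun_prop)]
    filter_upwards [hz] with q hq
    simp [hq]
  rw [e3, mul_zero, lintegral_eq_zero_iff (by fun_prop)] at e2
  filter_upwards [e2] with p hp
  simpa using hp

/-- The amplitude in Darboux coordinates. -/
def wAmp (w₀ w₁ w₂ : ℝ × E) : ℝ :=
  Real.sqrt (Real.cosh (2 * (w₁.1 - w₂.1)) * Real.cosh (2 * (w₂.1 - w₀.1))
      * Real.cosh (2 * (w₀.1 - w₁.1)))
    * (Real.cosh (w₁.1 - w₂.1) * Real.cosh (w₂.1 - w₀.1) * Real.cosh (w₀.1 - w₁.1))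
        ^ Module.finrank ℝ E

@[fun_prop]
theorem Continuous.wAmp {T : Type*} [TopologicalSpace T] {f g h : T → ℝ × E} (hf : Continuous f)
    (hg : Continuous g) (hh : Continuous h) :
    Continuous fun x => OscKernel.wAmp (f x) (g x) (h x) := by
  unfold OscKernel.wAmp
  fun_prop

@[fun_prop]
theorem Continuous.freq {T : Type*} [TopologicalSpace T] {f g h : T → ℝ × E} (hf : Continuous f)
    (hg : Continuous g) (hh : Continuous h) :
    Continuous fun x => OscKernel.freq (f x) (g x) (h x) := by
  unfold OscKernel.freq
  fun_prop

/-- The three-point integrand in the frequency picture. -/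
def tri (κ : ℝ) (U₀ U₁ U₂ : (ℝ × E) × (ℝ × E) → ℂ) (w : (ℝ × E) × (ℝ × E) × (ℝ × E)) : ℂ :=
  (wAmp w.1 w.2.1 w.2.2 : ℂ) * (pft κ U₀ w.1 (freq w.1 w.2.1 w.2.2) *
    (pft κ U₁ w.2.1 (freq w.2.1 w.2.2 w.1) * pft κ U₂ w.2.2 (freq w.2.2 w.1 w.2.1)))

theorem continuous_tri {U₀ U₁ U₂ : (ℝ × E) × (ℝ × E) → ℂ} (h₀ : IsTestW U₀) (h₁ : IsTestW U₁)
    (h₂ : IsTestW U₂) (κ : ℝ) : Continuous (tri κ U₀ U₁ U₂) := by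
  have c0 : Continuous fun w : (ℝ × E) × (ℝ × E) × (ℝ × E) =>
    pft κ U₀ w.1 (freq w.1 w.2.1 w.2.2) := h₀.continuous_pft_comp κ (by fun_prop) (by fun_prop)
  have c1 : Continuous fun w : (ℝ × E) × (ℝ × E) × (ℝ × E) =>
    pft κ U₁ w.2.1 (freq w.2.1 w.2.2 w.1) := h₁.continuous_pft_comp κ (by fun_prop) (by fun_prop)
  have c2 : Continuous fun w : (ℝ × E) × (ℝ × E) × (ℝ × E) =>
    pft κ U₂ w.2.2 (freq w.2.2 w.1 w.2.1) := h₂.continuous_pft_comp κ (by fun_prop) (by fun_prop)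
  unfold tri
  fun_prop

/-- The left side is the trace of three composed kernels. By `freq_mid` in its three rotations and
the Jacobian of `changeVar_triple`, the amplitude reduces to the three factors `√cosh` built into
`ker`; this is where the precise form of the amplitude matters. -/
theorem exists_integral_tri (κ : ℝ) : ∃ c : ℝ, 0 < c ∧
    ∀ U₀ U₁ U₂ : (ℝ × E) × (ℝ × E) → ℂ, IsTestW U₀ → IsTestW U₁ → IsTestW U₂ →
      ∫ p : (ℝ × E) × (ℝ × E) × (ℝ × E),
        ker κ U₀ (p.2.2, p.1) * (ker κ U₁ (p.1, p.2.1) * ker κ U₂ p.2)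
        = c * ∫ w, tri κ U₀ U₁ U₂ w := by
  obtain ⟨c, hc⟩ := changeVar_triple (E := E)
  refine ⟨c, hc.pos, fun U₀ U₁ U₂ h₀ h₁ h₂ => ?_⟩
  rw [← hc.integral (continuous_tri h₀ h₁ h₂ κ).measurable]
  refine integral_congr_ae (Filter.Eventually.of_forall fun p => ?_)
  obtain ⟨P, Q, R⟩ := p
  simp only [tri, ker, freq_mid P Q R, freq_mid Q R P, freq_mid R P Q]
  have a1 : 2 * ((mid P Q).1 - (mid Q R).1) = -(R.1 - P.1) := by simp only [mid]; ring
  have a2 : 2 * ((mid Q R).1 - (mid R P).1) = -(P.1 - Q.1) := by simp only [mid]; ring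
  have a3 : 2 * ((mid R P).1 - (mid P Q).1) = -(Q.1 - R.1) := by simp only [mid]; ring
  have b1 : (mid P Q).1 - (mid Q R).1 = (P.1 - R.1) / 2 := by simp only [mid]; ring
  have b2 : (mid Q R).1 - (mid R P).1 = (Q.1 - P.1) / 2 := by simp only [mid]; ring
  have b3 : (mid R P).1 - (mid P Q).1 = (R.1 - Q.1) / 2 := by simp only [mid]; ring
  have hw : ((Real.cosh ((P.1 - R.1) / 2) * Real.cosh ((Q.1 - P.1) / 2) *
      Real.cosh ((R.1 - Q.1) / 2)) ^ Module.finrank ℝ E)⁻¹ * wAmp (mid R P) (mid P Q) (mid Q R)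
      = Real.sqrt (Real.cosh (R.1 - P.1)) * (Real.sqrt (Real.cosh (P.1 - Q.1)) *
        Real.sqrt (Real.cosh (Q.1 - R.1))) := by
    have hne : (Real.cosh ((P.1 - R.1) / 2) * Real.cosh ((Q.1 - P.1) / 2) *
      Real.cosh ((R.1 - Q.1) / 2)) ^ Module.finrank ℝ E ≠ 0 := by positivity
    rw [wAmp, a1, a2, a3, b1, b2, b3, Real.cosh_neg, Real.cosh_neg, Real.cosh_neg,
      mul_comm (Real.sqrt _), ← mul_assoc, inv_mul_cancel₀ hne, one_mul,
      Real.sqrt_mul (by positivity), Real.sqrt_mul (by positivity), mul_assoc]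
  have hw' := congrArg (fun r : ℝ => (r : ℂ)) hw
  simp only [Complex.ofReal_mul] at hw'
  generalize pft κ U₀ (mid R P) (gap R P) = x
  generalize pft κ U₁ (mid P Q) (gap P Q) = y
  generalize pft κ U₂ (mid Q R) (gap Q R) = z
  linear_combination (-(x * y * z)) * hw'

end KernelPicture

/-! ### Smooth structure, Haar measure and Darboux chart of the group. -/

section Coordinates

variable {V : Type*} [NormedAddCommGroup V] [NormedSpace ℝ V] {Ω : V →ₗ[ℝ] V →ₗ[ℝ] ℝ}

namespace R0

@[simp] theorem mk_a (a : ℝ) (x : V) (z : ℝ) : (mk a x z : R0 Ω).a = a := rfl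
@[simp] theorem mk_x (a : ℝ) (x : V) (z : ℝ) : (mk a x z : R0 Ω).x = x := rfl
@[simp] theorem mk_z (a : ℝ) (x : V) (z : ℝ) : (mk a x z : R0 Ω).z = z := rfl

theorem continuous_a : Continuous (a : R0 Ω → ℝ) := continuous_fst (X := ℝ) (Y := V × ℝ)

theorem continuous_x : Continuous (x : R0 Ω → V) :=
  continuous_fst.comp (continuous_snd (X := ℝ) (Y := V × ℝ))

theorem continuous_z : Continuous (z : R0 Ω → ℝ) :=
  continuous_snd.comp (continuous_snd (X := ℝ) (Y := V × ℝ))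

theorem contDiff_a : ContDiff ℝ ∞ (a : R0 Ω → ℝ) := contDiff_fst (E := ℝ) (F := V × ℝ)

theorem contDiff_x : ContDiff ℝ ∞ (x : R0 Ω → V) :=
  contDiff_fst.comp (contDiff_snd (E := ℝ) (F := V × ℝ))

theorem contDiff_z : ContDiff ℝ ∞ (z : R0 Ω → ℝ) :=
  contDiff_snd.comp (contDiff_snd (E := ℝ) (F := V × ℝ))

theorem contDiff_mk {X : Type*} [NormedAddCommGroup X] [NormedSpace ℝ X] {f : X → ℝ} {g : X → V}
    {h : X → ℝ} (hf : ContDiff ℝ ∞ f) (hg : ContDiff ℝ ∞ g) (hh : ContDiff ℝ ∞ h) :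
    ContDiff ℝ ∞ fun p => (mk (f p) (g p) (h p) : R0 Ω) := hf.prodMk (hg.prodMk hh)

@[fun_prop]
theorem _root_.Continuous.r0_a {T : Type*} [TopologicalSpace T] {f : T → R0 Ω}
    (hf : Continuous f) : Continuous fun t => (f t).a := continuous_a.comp hf

@[fun_prop]
theorem _root_.Continuous.r0_x {T : Type*} [TopologicalSpace T] {f : T → R0 Ω}
    (hf : Continuous f) : Continuous fun t => (f t).x := continuous_x.comp hf

@[fun_prop]
theorem _root_.Continuous.r0_z {T : Type*} [TopologicalSpace T] {f : T → R0 Ω}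
    (hf : Continuous f) : Continuous fun t => (f t).z := continuous_z.comp hf

variable [FiniteDimensional ℝ V]

instance : FiniteDimensional ℝ (R0 Ω) := inferInstanceAs (FiniteDimensional ℝ (ℝ × V × ℝ))

theorem contDiff_mul_left (g : R0 Ω) : ContDiff ℝ ∞ fun h : R0 Ω => g * h := by
  have hx := contDiff_x (Ω := Ω)
  have ha := contDiff_a (Ω := Ω)
  have hz := contDiff_z (Ω := Ω)
  have hΩ : ContDiff ℝ ∞ fun h : R0 Ω => Ω g.x h.x :=
    (Ω g.x).toContinuousLinearMap.contDiff.comp hx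
  exact contDiff_mk (f := fun h : R0 Ω => g.a + h.a)
    (g := fun h : R0 Ω => Real.exp (-h.a) • g.x + h.x)
    (h := fun h : R0 Ω => Real.exp (-2 * h.a) * g.z + h.z + 1 / 2 * Ω g.x h.x * Real.exp (-h.a))
    (by fun_prop) (by fun_prop)
    ((((by fun_prop : ContDiff ℝ ∞ fun h : R0 Ω => Real.exp (-2 * h.a) * g.z)).add hz).add
      ((contDiff_const.mul hΩ).mul (by fun_prop)))

variable [MeasurableSpace V] [BorelSpace V]

instance : BorelSpace (R0 Ω) := inferInstanceAs (BorelSpace (ℝ × V × ℝ))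

end R0

variable [FiniteDimensional ℝ V]

theorem continuous_form : Continuous fun p : V × V => Ω p.1 p.2 := by
  have : (fun p : V × V => Ω p.1 p.2) = fun p : V × V => Ω.toContinuousBilinearMap p.1 p.2 := by
    funext p; rfl
  rw [this]
  fun_prop

@[fun_prop]
theorem Continuous.form {T : Type*} [TopologicalSpace T] {f g : T → V}
    (hf : Continuous f) (hg : Continuous g) : Continuous fun t => Ω (f t) (g t) :=
  continuous_form.comp (hf.prodMk hg)

theorem Continuous.phase {T : Type*} [TopologicalSpace T] {f g h : T → R0 Ω}
    (hf : Continuous f) (hg : Continuous g) (hh : Continuous h) :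
    Continuous fun t => OscKernel.phase (f t) (g t) (h t) := by
  unfold OscKernel.phase SV
  fun_prop

theorem Continuous.amplitude {T : Type*} [TopologicalSpace T] {f g h : T → R0 Ω}
    (hf : Continuous f) (hg : Continuous g) (hh : Continuous h) :
    Continuous fun t => OscKernel.amplitude (f t) (g t) (h t) := by
  unfold OscKernel.amplitude
  fun_prop

theorem amplitude_mul_left (g g₀ g₁ g₂ : R0 Ω) :
    amplitude (g * g₀) (g * g₁) (g * g₂) = amplitude g₀ g₁ g₂ := by
  simp only [amplitude, R0.mul_a, add_sub_add_left_eq_sub]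

theorem continuous_integrand (θ : ℝ) {u v : R0 Ω → ℂ} (hu : Continuous u) (hv : Continuous v)
    (g₀ : R0 Ω) : Continuous (integrand θ u v g₀) := by
  have h1 : Continuous fun p : R0 Ω × R0 Ω => phase g₀ p.1 p.2 :=
    Continuous.phase continuous_const continuous_fst continuous_snd
  have h2 : Continuous fun p : R0 Ω × R0 Ω => amplitude g₀ p.1 p.2 :=
    Continuous.amplitude continuous_const continuous_fst continuous_snd
  unfold integrand
  fun_prop

theorem hasCompactSupport_integrand (θ : ℝ) {u v : R0 Ω → ℂ} (hu : HasCompactSupport u)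
    (hv : HasCompactSupport v) (g₀ : R0 Ω) : HasCompactSupport (integrand θ u v g₀) := by
  refine HasCompactSupport.intro (hu.isCompact.prod hv.isCompact) fun p hp => ?_
  rw [Set.mem_prod, not_and_or] at hp
  rcases hp with hp | hp <;> simp [integrand, image_eq_zero_of_notMem_tsupport hp]

theorem IsTest.mul_left {u : R0 Ω → ℂ} (hu : IsTest u) (g : R0 Ω) :
    IsTest fun h => u (g * h) := by
  refine ⟨hu.1.comp (R0.contDiff_mul_left g), ?_⟩
  refine HasCompactSupport.intro (K := (fun h => g⁻¹ * h) '' tsupport u)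
    (hu.2.isCompact.image (R0.contDiff_mul_left g⁻¹).continuous) fun h hh => ?_
  refine image_eq_zero_of_notMem_tsupport fun hc => hh ⟨_, hc, ?_⟩
  simp

variable [MeasurableSpace V] [BorelSpace V]

instance : SigmaFinite (haarR0 Ω) := by
  have : SigmaFinite (Real.toNNReal (2 / Real.sqrt (Real.pi ^ dimR0 V)) •
    (volume : Measure ℝ).prod ((liouville Ω).prod (volume : Measure ℝ)) : Measure (ℝ × V × ℝ)) :=
    inferInstance
  exact this

instance : IsLocallyFiniteMeasure (liouville Ω) := by
  unfold liouville; infer_instance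

instance : IsLocallyFiniteMeasure (haarR0 Ω) := by
  have : IsLocallyFiniteMeasure (Real.toNNReal (2 / Real.sqrt (Real.pi ^ dimR0 V)) •
    (volume : Measure ℝ).prod ((liouville Ω).prod (volume : Measure ℝ)) : Measure (ℝ × V × ℝ)) :=
    inferInstance
  exact this

theorem IsTest.memLp {u : R0 Ω → ℂ} (hu : IsTest u) : MemLp u 2 (haarR0 Ω) :=
  hu.1.continuous.memLp_of_hasCompactSupport hu.2

theorem integrable_integrand (θ : ℝ) {u v : R0 Ω → ℂ} (hu : IsTest u) (hv : IsTest v)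
    (g₀ : R0 Ω) : Integrable (integrand θ u v g₀) ((haarR0 Ω).prod (haarR0 Ω)) :=
  (continuous_integrand θ hu.1.continuous hv.1.continuous g₀).integrable_of_hasCompactSupport
    (hasCompactSupport_integrand θ hu.2 hv.2 g₀)

/-- The density of the Haar measure. -/
def haarConst (V : Type*) [NormedAddCommGroup V] [NormedSpace ℝ V] : ℝ :=
  2 / Real.sqrt (Real.pi ^ dimR0 V)

theorem haarConst_pos : 0 < haarConst V := by unfold haarConst; positivity

section Darboux

variable {E : Type*} [NormedAddCommGroup E] [InnerProductSpace ℝ E]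
  [FiniteDimensional ℝ E] [MeasurableSpace E] [BorelSpace E]

/-- The coordinates `((a, b), (z, η))` on `R₀` attached to Darboux coordinates `(b, η)` on `V`. -/
def chart (Ω : V →ₗ[ℝ] V →ₗ[ℝ] ℝ) (e : V ≃L[ℝ] E × E) : ((ℝ × E) × (ℝ × E)) ≃L[ℝ] R0 Ω where
  toFun p := R0.mk p.1.1 (e.symm (p.1.2, p.2.2)) p.2.1
  invFun g := ((g.a, (e g.x).1), (g.z, (e g.x).2))
  map_add' p q := by
    have := e.symm.map_add (p.1.2, p.2.2) (q.1.2, q.2.2)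
    exact R0.ext' rfl this rfl
  map_smul' r p := by
    have := e.symm.map_smul r (p.1.2, p.2.2)
    exact R0.ext' rfl this rfl
  left_inv p := by simp
  right_inv g := by
    refine R0.ext' rfl ?_ rfl
    simp
  continuous_toFun := (R0.contDiff_mk (Ω := Ω) (f := fun p : (ℝ × E) × (ℝ × E) => p.1.1)
    (g := fun p => e.symm (p.1.2, p.2.2)) (h := fun p => p.2.1) (by fun_prop) (by fun_prop)
    (by fun_prop)).continuous
  continuous_invFun := by fun_prop

variable {e : V ≃L[ℝ] E × E}

@[simp] theorem chart_a (p : (ℝ × E) × (ℝ × E)) : (chart Ω e p).a = p.1.1 := rfl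
@[simp] theorem chart_x (p : (ℝ × E) × (ℝ × E)) : (chart Ω e p).x = e.symm (p.1.2, p.2.2) := rfl
@[simp] theorem chart_z (p : (ℝ × E) × (ℝ × E)) : (chart Ω e p).z = p.2.1 := rfl

theorem isTestW_comp_chart {u : R0 Ω → ℂ} (hu : IsTest u) :
    IsTestW fun p => u (chart Ω e p) :=
  ⟨hu.1.comp (chart Ω e).contDiff, hu.2.comp_homeomorph (chart Ω e).toHomeomorph⟩

theorem isTest_comp_chart_symm {U : (ℝ × E) × (ℝ × E) → ℂ} (hU : IsTestW U) :
    IsTest fun g => U ((chart Ω e).symm g) :=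
  ⟨hU.1.comp (chart Ω e).symm.contDiff, hU.2.comp_homeomorph (chart Ω e).symm.toHomeomorph⟩

theorem finrank_of_chart (e : V ≃L[ℝ] E × E) : Module.finrank ℝ V = 2 * Module.finrank ℝ E := by
  rw [e.toLinearEquiv.finrank_eq, Module.finrank_prod, two_mul]

/-- The subspaces `E × 0` and `0 × E` are isotropic, so every term of `S_V` contains exactly one
`η`; the remaining terms are linear in the `z`'s. The phase is therefore linear in the variables `ζ
= (z, η)`, and `freq` collects the coefficients. -/
theorem phase_chart (he : IsDarboux Ω e) (p₀ p₁ p₂ : (ℝ × E) × (ℝ × E)) :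
    phase (chart Ω e p₀) (chart Ω e p₁) (chart Ω e p₂)
      = pair p₀.2 (freq p₀.1 p₁.1 p₂.1) + (pair p₁.2 (freq p₁.1 p₂.1 p₀.1)
        + pair p₂.2 (freq p₂.1 p₀.1 p₁.1)) := by
  obtain ⟨⟨a₀, b₀⟩, ⟨z₀, η₀⟩⟩ := p₀
  obtain ⟨⟨a₁, b₁⟩, ⟨z₁, η₁⟩⟩ := p₁
  obtain ⟨⟨a₂, b₂⟩, ⟨z₂, η₂⟩⟩ := p₂
  have s1 : Real.sinh (2 * (a₁ - a₀)) = -Real.sinh (2 * (a₀ - a₁)) := by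
    rw [← Real.sinh_neg]; congr 1; ring
  have s2 : Real.sinh (2 * (a₂ - a₁)) = -Real.sinh (2 * (a₁ - a₂)) := by
    rw [← Real.sinh_neg]; congr 1; ring
  have s3 : Real.sinh (2 * (a₀ - a₂)) = -Real.sinh (2 * (a₂ - a₀)) := by
    rw [← Real.sinh_neg]; congr 1; ring
  simp only [phase, SV, chart_a, chart_x, chart_z, map_smul, LinearMap.smul_apply, he _ _,
    ContinuousLinearEquiv.apply_symm_apply, pair, freq, smul_eq_mul, inner_smul_right,
    inner_sub_right, s1, s2, s3, real_inner_comm b₀, real_inner_comm b₁,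
    real_inner_comm b₂]
  ring

/-- The exponent `dim R₀ - 2 = dim V` equals `2 dim E`, so the square root of that power is an
honest power. -/
theorem amplitude_chart (p₀ p₁ p₂ : (ℝ × E) × (ℝ × E)) :
    amplitude (chart Ω e p₀) (chart Ω e p₁) (chart Ω e p₂) = wAmp p₀.1 p₁.1 p₂.1 := by
  have hd : dimR0 V - 2 = Module.finrank ℝ E * 2 := by
    rw [dimR0, Nat.add_sub_cancel, finrank_of_chart e, mul_comm]
  simp only [amplitude, wAmp, chart_a, hd, pow_mul]
  rw [Real.sqrt_mul (by positivity), Real.sqrt_sq (by positivity)]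

theorem measurePreserving_chart (hm : liouville Ω = Measure.map e.symm volume) :
    MeasurePreserving (chart Ω e) (Real.toNNReal (haarConst V) • volume) (haarR0 Ω) := by
  have h0 : MeasurePreserving (e.symm : E × E → V) volume (liouville Ω) :=
    ⟨e.symm.continuous.measurable, hm.symm⟩
  have h1 : MeasurePreserving
      (MeasurableEquiv.prodAssoc : (ℝ × E) × (ℝ × E) ≃ᵐ ℝ × E × (ℝ × E))
      (((volume : Measure ℝ).prod (volume : Measure E)).prod
        ((volume : Measure ℝ).prod (volume : Measure E)))
      ((volume : Measure ℝ).prod ((volume : Measure E).prod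
        ((volume : Measure ℝ).prod (volume : Measure E)))) := measurePreserving_prodAssoc _ _ _
  have h2 : MeasurePreserving (fun q : E × (ℝ × E) => (e.symm (q.1, q.2.2), q.2.1))
      ((volume : Measure E).prod ((volume : Measure ℝ).prod (volume : Measure E)))
      ((liouville Ω).prod (volume : Measure ℝ)) := by
    have h3 : MeasurePreserving (Prod.map id Prod.swap : E × (ℝ × E) → E × (E × ℝ))
        ((volume : Measure E).prod ((volume : Measure ℝ).prod (volume : Measure E)))
        ((volume : Measure E).prod ((volume : Measure E).prod (volume : Measure ℝ))) :=
      (MeasurePreserving.id _).prod Measure.measurePreserving_swap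
    have h4 := (measurePreserving_prodAssoc (volume : Measure E) (volume : Measure E)
      (volume : Measure ℝ)).symm
    have h5 : MeasurePreserving (Prod.map (e.symm : E × E → V) (id : ℝ → ℝ))
        (((volume : Measure E).prod (volume : Measure E)).prod (volume : Measure ℝ))
        ((liouville Ω).prod (volume : Measure ℝ)) := h0.prod (MeasurePreserving.id _)
    exact h5.comp (h4.comp h3)
  have h6 : MeasurePreserving (chart Ω e)
      (((volume : Measure ℝ).prod (volume : Measure E)).prod
        ((volume : Measure ℝ).prod (volume : Measure E)))
      ((volume : Measure ℝ).prod ((liouville Ω).prod (volume : Measure ℝ))) :=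
    ((MeasurePreserving.id _).prod h2).comp h1
  exact h6.smul_measure _

theorem chart_measurableEmbedding : MeasurableEmbedding (chart Ω e) :=
  (chart Ω e).toHomeomorph.measurableEmbedding

theorem integral_haarR0 (hm : liouville Ω = Measure.map e.symm volume) (f : R0 Ω → ℂ) :
    ∫ g, f g ∂haarR0 Ω = haarConst V * ∫ p, f (chart Ω e p) := by
  rw [← (measurePreserving_chart hm).integral_comp chart_measurableEmbedding,
    integral_smul_nnreal_measure, NNReal.smul_def, Real.coe_toNNReal _ haarConst_pos.le,
    Complex.real_smul]

theorem lintegral_haarR0 (hm : liouville Ω = Measure.map e.symm volume) (f : R0 Ω → ℝ≥0∞) :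
    ∫⁻ g, f g ∂haarR0 Ω = ENNReal.ofReal (haarConst V) * ∫⁻ p, f (chart Ω e p) := by
  rw [← (measurePreserving_chart hm).lintegral_comp_emb chart_measurableEmbedding,
    lintegral_smul_measure]
  rfl

/-- Invariance here refers to vector addition of coordinates, not to the group law; integration by
parts along straight lines relies on it. -/
theorem isAddHaarMeasure_haarR0 (hm : liouville Ω = Measure.map e.symm volume) :
    (haarR0 Ω).IsAddHaarMeasure := by
  have h1 := (measurePreserving_chart hm).map_eq
  have h2 : (Real.toNNReal (haarConst V) • volume : Measure ((ℝ × E) × (ℝ × E))).IsAddHaarMeasure :=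
    Measure.IsAddHaarMeasure.smul _ (by simp [haarConst_pos]) (by simp)
  rw [← h1]
  exact ContinuousLinearEquiv.isAddHaarMeasure_map (chart Ω e) _

end Darboux

end Coordinates

/-! ### Rearrangements of product measures. -/

section ProductRearrangement

variable {X Y Z T : Type*} [MeasureSpace X] [MeasureSpace Y] [MeasureSpace Z] [MeasureSpace T]
  [SFinite (volume : Measure X)] [SFinite (volume : Measure Y)] [SFinite (volume : Measure Z)]
  [SFinite (volume : Measure T)]

theorem measurePreserving_prodRightComm :
    MeasurePreserving (fun p : (X × Y) × Z => ((p.1.1, p.2), p.1.2)) := by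
  have h1 := measurePreserving_prodAssoc (volume : Measure X) (volume : Measure Y)
    (volume : Measure Z)
  have h2 : MeasurePreserving (Prod.map id Prod.swap : X × (Y × Z) → X × (Z × Y))
      ((volume : Measure X).prod ((volume : Measure Y).prod (volume : Measure Z)))
      ((volume : Measure X).prod ((volume : Measure Z).prod (volume : Measure Y))) :=
    (MeasurePreserving.id _).prod Measure.measurePreserving_swap
  have h3 := (measurePreserving_prodAssoc (volume : Measure X) (volume : Measure Z)
    (volume : Measure Y)).symm
  exact h3.comp (h2.comp h1)

theorem measurePreserving_prodProdProdComm :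
    MeasurePreserving (fun p : (X × Y) × (Z × T) => ((p.1.1, p.2.1), (p.1.2, p.2.2))) := by
  have h1 := (measurePreserving_prodAssoc (volume : Measure (X × Y)) (volume : Measure Z)
    (volume : Measure T)).symm
  have h2 : MeasurePreserving
      (Prod.map (fun p : (X × Y) × Z => ((p.1.1, p.2), p.1.2)) id : ((X × Y) × Z) × T → _)
      ((volume : Measure ((X × Y) × Z)).prod (volume : Measure T))
      ((volume : Measure ((X × Z) × Y)).prod (volume : Measure T)) :=
    measurePreserving_prodRightComm.prod (MeasurePreserving.id _)
  have h3 := measurePreserving_prodAssoc (volume : Measure (X × Z)) (volume : Measure Y)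
    (volume : Measure T)
  exact h3.comp (h2.comp h1)

theorem measurePreserving_prodAssocComm :
    MeasurePreserving (fun p : (X × Y) × Z => (p.1.1, p.2, p.1.2)) := by
  have h3 := measurePreserving_prodAssoc (volume : Measure X) (volume : Measure Z)
    (volume : Measure Y)
  exact h3.comp measurePreserving_prodRightComm

end ProductRearrangement

/-- A variant of `Homeomorph.prodAssoc` exchanging the last two factors. -/
def prodRightCommHomeomorph (X Y Z : Type*) [TopologicalSpace X] [TopologicalSpace Y]
    [TopologicalSpace Z] : (X × Y) × Z ≃ₜ (X × Z) × Y where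
  toFun p := ((p.1.1, p.2), p.1.2)
  invFun p := ((p.1.1, p.2), p.1.2)
  left_inv _ := rfl
  right_inv _ := rfl
  continuous_toFun := by fun_prop
  continuous_invFun := by fun_prop

/-! ### The star product in Darboux coordinates as a kernel composition. -/

section KernelPicture

variable {E : Type*} [NormedAddCommGroup E] [InnerProductSpace ℝ E]
  [FiniteDimensional ℝ E] [MeasurableSpace E] [BorelSpace E]

instance : SFinite (volume : Measure ((ℝ × E) × ((ℝ × E) × (ℝ × E)))) :=
  by
  have h1 : SFinite (volume : Measure (ℝ × E)) := inferInstance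
  have h2 : SFinite (volume : Measure ((ℝ × E) × (ℝ × E))) := inferInstance
  exact Measure.prod.instSFinite (μ := volume) (ν := volume)

/-- The integrand of the product in the frequency picture. -/
def starWIntegrand (κ : ℝ) (U₁ U₂ : (ℝ × E) × (ℝ × E) → ℂ) (p q : (ℝ × E) × (ℝ × E)) : ℂ :=
  (wAmp p.1 q.1 q.2 : ℂ) * (Complex.exp ((κ * pair p.2 (freq p.1 q.1 q.2) : ℝ) * Complex.I) *
    (pft κ U₁ q.1 (freq q.1 q.2 p.1) * pft κ U₂ q.2 (freq q.2 p.1 q.1)))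

/-- The product in Darboux coordinates. -/
def starW (κ : ℝ) (U₁ U₂ : (ℝ × E) × (ℝ × E) → ℂ) (p : (ℝ × E) × (ℝ × E)) : ℂ :=
  ∫ q, starWIntegrand κ U₁ U₂ p q

variable {κ : ℝ} {U₀ U₁ U₂ : (ℝ × E) × (ℝ × E) → ℂ}

theorem continuous_starWIntegrand (h₁ : IsTestW U₁) (h₂ : IsTestW U₂) (κ : ℝ) :
    Continuous (Function.uncurry (starWIntegrand κ U₁ U₂)) := by
  have c1 : Continuous fun r : ((ℝ × E) × (ℝ × E)) × ((ℝ × E) × (ℝ × E)) =>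
      pft κ U₁ r.2.1 (freq r.2.1 r.2.2 r.1.1) := h₁.continuous_pft_comp κ (by fun_prop) (by fun_prop)
  have c2 : Continuous fun r : ((ℝ × E) × (ℝ × E)) × ((ℝ × E) × (ℝ × E)) =>
      pft κ U₂ r.2.2 (freq r.2.2 r.1.1 r.2.1) := h₂.continuous_pft_comp κ (by fun_prop) (by fun_prop)
  unfold starWIntegrand Function.uncurry
  fun_prop

theorem starWIntegrand_eq_zero (h₁ : IsTestW U₁) (h₂ : IsTestW U₂) (κ : ℝ) :
    ∃ s : Set ((ℝ × E) × (ℝ × E)), IsCompact s ∧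
      ∀ p, ∀ q ∉ s, starWIntegrand κ U₁ U₂ p q = 0 := by
  obtain ⟨s₁, hs₁, k₁⟩ := h₁.pft_eq_zero κ
  obtain ⟨s₂, hs₂, k₂⟩ := h₂.pft_eq_zero κ
  refine ⟨s₁ ×ˢ s₂, hs₁.prod hs₂, fun p q hq => ?_⟩
  rw [Set.mem_prod, not_and_or] at hq
  rcases hq with hq | hq
  · simp [starWIntegrand, k₁ _ hq]
  · simp [starWIntegrand, k₂ _ hq]

theorem continuous_starW (h₁ : IsTestW U₁) (h₂ : IsTestW U₂) (κ : ℝ) :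
    Continuous (starW κ U₁ U₂) := by
  obtain ⟨s, hs, h0⟩ := starWIntegrand_eq_zero h₁ h₂ κ
  exact continuous_integral_of_support (continuous_starWIntegrand h₁ h₂ κ) hs h0

/-- The output variable `ζ₀` enters the product only through an exponential, so integrating against
`U₀` produces its partial Fourier transform as well and makes the three functions play symmetric
roles. -/
theorem integral_mul_starW (h₀ : IsTestW U₀) (h₁ : IsTestW U₁) (h₂ : IsTestW U₂) (κ : ℝ) :
    ∫ p, U₀ p * starW κ U₁ U₂ p = ∫ w, tri κ U₀ U₁ U₂ w := by
  obtain ⟨s, hs, h0⟩ := starWIntegrand_eq_zero h₁ h₂ κ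
  let F : ((ℝ × E) × (ℝ × E)) × ((ℝ × E) × (ℝ × E)) → ℂ := fun r =>
    U₀ r.1 * starWIntegrand κ U₁ U₂ r.1 r.2
  have hFc : Continuous F :=
    (h₀.1.continuous.comp continuous_fst).mul (continuous_starWIntegrand h₁ h₂ κ)
  have hFs : HasCompactSupport F := by
    refine HasCompactSupport.intro (h₀.2.isCompact.prod hs) fun r hr => ?_
    rw [Set.mem_prod, not_and_or] at hr
    rcases hr with hr | hr
    · simp [F, image_eq_zero_of_notMem_tsupport hr]
    · simp [F, h0 _ _ hr]
  have hi : Integrable F ((volume : Measure ((ℝ × E) × (ℝ × E))).prod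
      (volume : Measure ((ℝ × E) × (ℝ × E)))) := hFc.integrable_of_hasCompactSupport hFs
  let σ := prodRightCommHomeomorph (ℝ × E) ((ℝ × E) × (ℝ × E)) (ℝ × E)
  have hσ : MeasurePreserving σ
      ((volume : Measure ((ℝ × E) × ((ℝ × E) × (ℝ × E)))).prod (volume : Measure (ℝ × E)))
      ((volume : Measure ((ℝ × E) × (ℝ × E))).prod (volume : Measure ((ℝ × E) × (ℝ × E)))) :=
    measurePreserving_prodRightComm
  have hi' : Integrable (fun r => F (σ r))
      ((volume : Measure ((ℝ × E) × ((ℝ × E) × (ℝ × E)))).prod (volume : Measure (ℝ × E))) :=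
    (hσ.integrable_comp_emb σ.measurableEmbedding).2 hi
  calc ∫ p, U₀ p * starW κ U₁ U₂ p
      = ∫ p, ∫ q, F (p, q) := by simp only [starW, F, integral_const_mul]
    _ = ∫ r, F r ∂(volume : Measure ((ℝ × E) × (ℝ × E))).prod
          (volume : Measure ((ℝ × E) × (ℝ × E))) := (integral_prod F hi).symm
    _ = ∫ r, F (σ r) ∂(volume : Measure ((ℝ × E) × ((ℝ × E) × (ℝ × E)))).prod
          (volume : Measure (ℝ × E)) := (hσ.integral_comp σ.measurableEmbedding F).symm
    _ = ∫ w : (ℝ × E) × ((ℝ × E) × (ℝ × E)), ∫ ζ : ℝ × E, F (σ (w, ζ)) := integral_prod _ hi'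
    _ = ∫ w, tri κ U₀ U₁ U₂ w := by
      refine integral_congr_ae (Filter.Eventually.of_forall fun w => ?_)
      simp only [tri]
      rw [pft, ft, ← integral_mul_const, ← integral_const_mul]
      refine integral_congr_ae (Filter.Eventually.of_forall fun ζ => ?_)
      simp only [F, σ, prodRightCommHomeomorph, Homeomorph.homeomorph_mk_coe, Equiv.coe_fn_mk,
        starWIntegrand]
      ring

/-- The weak form of multiplicativity: tested against any `U₀`, the star product acts as the
composition of kernels. -/
theorem exists_integral_mul_starW (hκ : κ ≠ 0) : ∃ c : ℝ, 0 < c ∧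
    ∀ U₀ U₁ U₂ : (ℝ × E) × (ℝ × E) → ℂ, IsTestW U₀ → IsTestW U₁ → IsTestW U₂ →
      ∫ p, U₀ p * starW κ U₁ U₂ p
        = c * ∫ z : (ℝ × E) × (ℝ × E), kcomp volume (ker κ U₁) (ker κ U₂) z * ker κ U₀ z.swap := by
  obtain ⟨c, hc, h⟩ := exists_integral_tri (E := E) κ
  obtain ⟨c', hc', hk⟩ := exists_lintegral_ker_sq (E := E) hκ
  have hfin : ∀ U : (ℝ × E) × (ℝ × E) → ℂ, IsTestW U →
      ∫⁻ z, ‖ker κ U z‖ₑ ^ 2 ∂(volume : Measure (ℝ × E)).prod volume < ⊤ := fun U hU => by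
    have h1 := lintegral_lt_top_of_memLp_two
      (hU.1.continuous.memLp_of_hasCompactSupport (μ := volume) (p := 2) hU.2)
    exact (hk U hU).trans_lt (ENNReal.mul_lt_top (by simp) h1)
  refine ⟨c⁻¹, inv_pos.2 hc, fun U₀ U₁ U₂ h₀ h₁ h₂ => ?_⟩
  have m0 := continuous_ker h₀ κ
  have m1 := continuous_ker h₁ κ
  have m2 := continuous_ker h₂ κ
  have h3 := (integral_kcomp_mul (μ := (volume : Measure (ℝ × E))) (F := ker κ U₁) (G := ker κ U₂)
    (H := fun z => ker κ U₀ z.swap) m1.measurable m2.measurable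
    (m0.comp continuous_swap).measurable (hfin U₁ h₁) (hfin U₂ h₂) (by
      rw [lintegral_prod_swap (μ := (volume : Measure (ℝ × E))) (ν := (volume : Measure (ℝ × E)))
        fun z => ‖ker κ U₀ z‖ₑ ^ 2]
      exact hfin U₀ h₀)).2
  let σ : ((ℝ × E) × (ℝ × E)) × (ℝ × E) ≃ₜ (ℝ × E) × (ℝ × E) × (ℝ × E) :=
    (prodRightCommHomeomorph (ℝ × E) (ℝ × E) (ℝ × E)).trans (Homeomorph.prodAssoc _ _ _)
  have hσ : MeasurePreserving σ
      (((volume : Measure (ℝ × E)).prod (volume : Measure (ℝ × E))).prod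
        (volume : Measure (ℝ × E))) volume := measurePreserving_prodAssocComm
  have h4 := hσ.integral_comp σ.measurableEmbedding fun p : (ℝ × E) × (ℝ × E) × (ℝ × E) =>
    ker κ U₀ (p.2.2, p.1) * (ker κ U₁ (p.1, p.2.1) * ker κ U₂ p.2)
  have h5 : ∫ z : (ℝ × E) × (ℝ × E), kcomp volume (ker κ U₁) (ker κ U₂) z * ker κ U₀ z.swap
      = c * ∫ w, tri κ U₀ U₁ U₂ w := by
    rw [← h U₀ U₁ U₂ h₀ h₁ h₂, ← h4]
    refine h3.trans (integral_congr_ae (Filter.Eventually.of_forall fun w => ?_))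
    exact mul_comm _ _
  rw [integral_mul_starW h₀ h₁ h₂, h5, ← mul_assoc, Complex.ofReal_inv, inv_mul_cancel₀, one_mul]
  exact_mod_cast hc.ne'

end KernelPicture

/-! ### The product on the group in terms of the chart. -/

section Group

variable {V : Type*} [NormedAddCommGroup V] [NormedSpace ℝ V] {Ω : V →ₗ[ℝ] V →ₗ[ℝ] ℝ}
  [FiniteDimensional ℝ V] [MeasurableSpace V] [BorelSpace V]
  {E : Type*} [NormedAddCommGroup E] [InnerProductSpace ℝ E]
  [FiniteDimensional ℝ E] [MeasurableSpace E] [BorelSpace E] {e : V ≃L[ℝ] E × E}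

/-- The constant relating the products on `R₀` and in Darboux coordinates. -/
def starConst (V : Type*) [NormedAddCommGroup V] [NormedSpace ℝ V] (θ : ℝ) : ℝ :=
  haarConst V ^ 2 / θ ^ dimR0 V

theorem starConst_ne_zero {θ : ℝ} (hθ : θ ≠ 0) : starConst V θ ≠ 0 :=
  div_ne_zero (pow_ne_zero _ haarConst_pos.ne') (pow_ne_zero _ hθ)

theorem integrand_chart (he : IsDarboux Ω e) (θ : ℝ) (u v : R0 Ω → ℂ)
    (p₀ p₁ p₂ : (ℝ × E) × (ℝ × E)) :
    integrand θ u v (chart Ω e p₀) (chart Ω e p₁, chart Ω e p₂)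
      = (wAmp p₀.1 p₁.1 p₂.1 : ℂ) *
        Complex.exp ((2 / θ * pair p₀.2 (freq p₀.1 p₁.1 p₂.1) : ℝ) * Complex.I) *
        ((Complex.exp ((2 / θ * pair p₁.2 (freq p₁.1 p₂.1 p₀.1) : ℝ) * Complex.I)
            * u (chart Ω e p₁)) *
          (Complex.exp ((2 / θ * pair p₂.2 (freq p₂.1 p₀.1 p₁.1) : ℝ) * Complex.I)
            * v (chart Ω e p₂))) := by
  have h1 : 2 * Complex.I / (θ : ℂ) *
      ((pair p₀.2 (freq p₀.1 p₁.1 p₂.1) + (pair p₁.2 (freq p₁.1 p₂.1 p₀.1)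
        + pair p₂.2 (freq p₂.1 p₀.1 p₁.1)) : ℝ) : ℂ)
      = (2 / θ * pair p₀.2 (freq p₀.1 p₁.1 p₂.1) : ℝ) * Complex.I
        + ((2 / θ * pair p₁.2 (freq p₁.1 p₂.1 p₀.1) : ℝ) * Complex.I
        + (2 / θ * pair p₂.2 (freq p₂.1 p₀.1 p₁.1) : ℝ) * Complex.I) := by
    push_cast; ring
  rw [integrand, phase_chart he, amplitude_chart, h1, Complex.exp_add, Complex.exp_add]
  ring

theorem starProd_chart (he : IsDarboux Ω e) (hm : liouville Ω = Measure.map e.symm volume)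
    (θ : ℝ) {u v : R0 Ω → ℂ} (hu : IsTest u) (hv : IsTest v) (p : (ℝ × E) × (ℝ × E)) :
    starProd θ u v (chart Ω e p) = starConst V θ *
      starW (2 / θ) (fun q => u (chart Ω e q)) (fun q => v (chart Ω e q)) p := by
  let F : ((ℝ × E) × (ℝ × E)) × ((ℝ × E) × (ℝ × E)) → ℂ := fun q =>
    integrand θ u v (chart Ω e p) (chart Ω e q.1, chart Ω e q.2)
  have hFi : Integrable F ((volume : Measure ((ℝ × E) × (ℝ × E))).prod
      (volume : Measure ((ℝ × E) × (ℝ × E)))) :=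
    ((continuous_integrand θ hu.1.continuous hv.1.continuous _).comp
      (by fun_prop : Continuous fun q : ((ℝ × E) × (ℝ × E)) × ((ℝ × E) × (ℝ × E)) =>
        (chart Ω e q.1, chart Ω e q.2))).integrable_of_hasCompactSupport
      ((hasCompactSupport_integrand θ hu.2 hv.2 _).comp_homeomorph
        ((chart Ω e).toHomeomorph.prodCongr (chart Ω e).toHomeomorph))
  -- Regrouping `(w₁, ζ₁), (w₂, ζ₂)` as `(w₁, w₂), (ζ₁, ζ₂)` lets the inner integral factor into two
  -- Fourier transforms.
  let σ := Homeomorph.prodProdProdComm (ℝ × E) (ℝ × E) (ℝ × E) (ℝ × E)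
  have hσ : MeasurePreserving σ
      ((volume : Measure ((ℝ × E) × (ℝ × E))).prod (volume : Measure ((ℝ × E) × (ℝ × E))))
      ((volume : Measure ((ℝ × E) × (ℝ × E))).prod (volume : Measure ((ℝ × E) × (ℝ × E)))) :=
    measurePreserving_prodProdProdComm
  have hFi' : Integrable (fun q => F (σ q)) ((volume : Measure ((ℝ × E) × (ℝ × E))).prod
      (volume : Measure ((ℝ × E) × (ℝ × E)))) :=
    (hσ.integrable_comp_emb σ.measurableEmbedding).2 hFi
  have h1 : ∫ q, integrand θ u v (chart Ω e p) q ∂(haarR0 Ω).prod (haarR0 Ω)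
      = haarConst V * (haarConst V * ∫ q, F q ∂(volume : Measure ((ℝ × E) × (ℝ × E))).prod
        (volume : Measure ((ℝ × E) × (ℝ × E)))) := by
    rw [integral_prod _ (integrable_integrand θ hu hv _), integral_haarR0 hm, integral_prod _ hFi]
    simp only [integral_haarR0 hm, integral_const_mul, F]
  have h2 : ∫ q, F q ∂(volume : Measure ((ℝ × E) × (ℝ × E))).prod
        (volume : Measure ((ℝ × E) × (ℝ × E)))
      = starW (2 / θ) (fun q => u (chart Ω e q)) (fun q => v (chart Ω e q)) p := by
    rw [← hσ.integral_comp σ.measurableEmbedding F, integral_prod _ hFi', starW]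
    refine integral_congr_ae (Filter.Eventually.of_forall fun q => ?_)
    have h3 := integral_prod_mul (μ := (volume : Measure (ℝ × E))) (ν := (volume : Measure (ℝ × E)))
      (fun ζ => Complex.exp ((2 / θ * pair ζ (freq q.1 q.2 p.1) : ℝ) * Complex.I)
        * u (chart Ω e (q.1, ζ)))
      (fun ζ => Complex.exp ((2 / θ * pair ζ (freq q.2 p.1 q.1) : ℝ) * Complex.I)
        * v (chart Ω e (q.2, ζ)))
    simp only [starWIntegrand, pft, ft]
    rw [← h3, ← mul_assoc, ← integral_const_mul]
    refine integral_congr_ae (Filter.Eventually.of_forall fun ζ => ?_)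
    exact integrand_chart he θ u v p (q.1, ζ.1) (q.2, ζ.2)
  rw [starProd, h1, h2, starConst]
  push_cast
  ring

theorem continuous_starProd (he : IsDarboux Ω e) (hm : liouville Ω = Measure.map e.symm volume)
    (θ : ℝ) {u v : R0 Ω → ℂ} (hu : IsTest u) (hv : IsTest v) : Continuous (starProd θ u v) := by
  have h1 : Continuous fun p => starProd θ u v (chart Ω e p) := by
    simp only [starProd_chart he hm θ hu hv]
    exact continuous_const.mul
      (continuous_starW (isTestW_comp_chart hu) (isTestW_comp_chart hv) _)
  have h2 : starProd θ u v = fun g => starProd θ u v (chart Ω e ((chart Ω e).symm g)) := by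
    funext g; simp
  rw [h2]
  exact h1.comp (chart Ω e).symm.continuous

end Group

/-- A densely defined isometry with total range extends to a unitary. -/
theorem exists_unitary_extension {T H K : Type*} [AddCommGroup T] [Module ℂ T]
    [NormedAddCommGroup H] [InnerProductSpace ℂ H] [CompleteSpace H]
    [NormedAddCommGroup K] [InnerProductSpace ℂ K] [CompleteSpace K]
    (ι : T →ₗ[ℂ] H) (Ψ : T →ₗ[ℂ] K) (hι : DenseRange ι) (hn : ∀ t, ‖Ψ t‖ = ‖ι t‖)
    (hΨ : ∀ k, (∀ t, inner ℂ (Ψ t) k = 0) → k = 0) :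
    ∃ U : H ≃ₗᵢ[ℂ] K, ∀ t, U (ι t) = Ψ t := by
  have hb : ∃ C, ∀ t, ‖Ψ t‖ ≤ C * ‖ι t‖ := ⟨1, fun t => by rw [hn, one_mul]⟩
  let L : H →L[ℂ] K := Ψ.extendOfNorm ι
  have hL : ∀ t, L (ι t) = Ψ t := LinearMap.extendOfNorm_eq hι hb
  have hLn : ∀ x, ‖L x‖ = ‖x‖ := fun x =>
    hι.induction_on x (isClosed_eq (by fun_prop) (by fun_prop)) fun t => by rw [hL, hn]
  let I : H →ₗᵢ[ℂ] K := ⟨L.toLinearMap, hLn⟩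
  have hI : ∀ t, I (ι t) = Ψ t := hL
  have hc : IsComplete (LinearMap.range I.toLinearMap : Set K) :=
    (LinearIsometry.isComplete_map_iff I (p := ⊤)).2 isComplete_univ |> fun h => by
      simpa [Submodule.map_top] using h
  have : CompleteSpace (LinearMap.range I.toLinearMap) := hc.completeSpace_coe
  have htop : LinearMap.range I.toLinearMap = ⊤ := by
    rw [← Submodule.orthogonal_eq_bot_iff, Submodule.eq_bot_iff]
    intro k hk
    rw [Submodule.mem_orthogonal] at hk
    exact hΨ k fun t => hk _ ⟨ι t, hI t⟩
  exact ⟨LinearIsometryEquiv.ofSurjective I (LinearMap.range_eq_top.1 htop), hI⟩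

/-! ### The unitary from `L²` of the group onto square integrable kernels. -/

section Group

variable {V : Type*} [NormedAddCommGroup V] [NormedSpace ℝ V] {Ω : V →ₗ[ℝ] V →ₗ[ℝ] ℝ}

theorem IsTest.add {u v : R0 Ω → ℂ} (hu : IsTest u) (hv : IsTest v) : IsTest (u + v) :=
  ⟨hu.1.add hv.1, hu.2.add hv.2⟩

theorem IsTest.smul (c : ℂ) {u : R0 Ω → ℂ} (hu : IsTest u) : IsTest (c • u) :=
  ⟨contDiff_const.smul hu.1, hu.2.smul_left (f := fun _ => c)⟩

theorem IsTest.conj {u : R0 Ω → ℂ} (hu : IsTest u) : IsTest fun g => (starRingEnd ℂ) (u g) :=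
  ⟨Complex.conjCLE.contDiff.comp hu.1, hu.2.comp_left (map_zero _)⟩

/-- The space of test functions. -/
def testSpace (Ω : V →ₗ[ℝ] V →ₗ[ℝ] ℝ) : Submodule ℂ (R0 Ω → ℂ) where
  carrier := {u | IsTest u}
  add_mem' := IsTest.add
  zero_mem' := ⟨contDiff_const, HasCompactSupport.zero⟩
  smul_mem' c _ := IsTest.smul c

variable [FiniteDimensional ℝ V] [MeasurableSpace V] [BorelSpace V]

/-- The inclusion of the test functions in `L²`. -/
def testToL2 (Ω : V →ₗ[ℝ] V →ₗ[ℝ] ℝ) : testSpace Ω →ₗ[ℂ] L2 Ω where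
  toFun u := IsTest.memLp (u := u.1) u.2 |>.toLp u.1
  map_add' _ _ := rfl
  map_smul' _ _ := rfl

theorem denseRange_testToL2 : DenseRange (testToL2 Ω) := by
  refine (Lp.dense_hasCompactSupport_contDiff (F := ℂ) (μ := haarR0 Ω) (p := 2)
    (by norm_num)).mono ?_
  rintro f ⟨g, hfg, hg, hg'⟩
  refine ⟨⟨g, hg', hg⟩, ?_⟩
  exact Lp.ext ((MemLp.coeFn_toLp (IsTest.memLp ⟨hg', hg⟩)).trans hfg.symm)

variable {E : Type*} [NormedAddCommGroup E] [InnerProductSpace ℝ E]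
  [FiniteDimensional ℝ E] [MeasurableSpace E] [BorelSpace E] {e : V ≃L[ℝ] E × E}

theorem memLp_ker {κ : ℝ} (hκ : κ ≠ 0) {U : (ℝ × E) × (ℝ × E) → ℂ} (hU : IsTestW U) :
    MemLp (ker κ U) 2 ((volume : Measure (ℝ × E)).prod (volume : Measure (ℝ × E))) := by
  obtain ⟨c', hc', hk⟩ := exists_lintegral_ker_sq (E := E) hκ
  have h1 := lintegral_lt_top_of_memLp_two
    (hU.1.continuous.memLp_of_hasCompactSupport (μ := volume) (p := 2) hU.2)
  exact memLp_two_of_lintegral (continuous_ker hU κ).aestronglyMeasurable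
    ((hk U hU).trans_lt (ENNReal.mul_lt_top (by simp) h1))

/-- The map from test functions to square integrable kernels. -/
def testToHS (Ω : V →ₗ[ℝ] V →ₗ[ℝ] ℝ) (e : V ≃L[ℝ] E × E) {κ : ℝ} (hκ : κ ≠ 0) :
    testSpace Ω →ₗ[ℂ] HS (volume : Measure (ℝ × E)) where
  toFun u := (memLp_ker hκ (isTestW_comp_chart (e := e) u.2)).toLp _
  map_add' u v := by
    rw [← MemLp.toLp_add]
    refine MemLp.toLp_congr _ _ (Filter.Eventually.of_forall fun z => ?_)
    exact congrFun (ker_add (isTestW_comp_chart (e := e) u.2) (isTestW_comp_chart (e := e) v.2) κ) z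
  map_smul' c u := by
    rw [RingHom.id_apply, ← MemLp.toLp_const_smul]
    refine MemLp.toLp_congr _ _ (Filter.Eventually.of_forall fun z => ?_)
    exact congrFun (ker_smul κ c fun p => u.1 (chart Ω e p)) z

theorem coeFn_testToHS {κ : ℝ} (hκ : κ ≠ 0) (u : testSpace Ω) :
    (testToHS Ω e hκ u : (ℝ × E) × (ℝ × E) → ℂ) =ᵐ[volume.prod volume]
      ker κ fun p => u.1 (chart Ω e p) :=
  MemLp.coeFn_toLp (memLp_ker hκ (isTestW_comp_chart (e := e) u.2))

theorem exists_unitary_ker (hm : liouville Ω = Measure.map e.symm volume) {κ : ℝ} (hκ : κ ≠ 0) :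
    ∃ s : ℝ, 0 < s ∧ ∃ Φ : L2 Ω ≃ₗᵢ[ℂ] HS (volume : Measure (ℝ × E)),
      ∀ u, Φ (testToL2 Ω u) = (s : ℂ) • testToHS Ω e hκ u := by
  obtain ⟨c, hc, hk⟩ := exists_lintegral_ker_sq (E := E) hκ
  have hγ := haarConst_pos (V := V)
  -- The map to kernels multiplies squared norms by `c / haarConst V`; `s` normalises it to an
  -- isometry.
  let s := Real.sqrt (haarConst V / c)
  have hs : 0 < s := Real.sqrt_pos.2 (div_pos hγ hc)
  refine ⟨s, hs, exists_unitary_extension (testToL2 Ω) ((s : ℂ) • testToHS Ω e hκ)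
    denseRange_testToL2 (fun u => ?_) fun k hk0 => ?_⟩
  · have hu : IsTestW fun p => u.1 (chart Ω e p) := isTestW_comp_chart u.2
    have h1 : eLpNorm (ker κ fun p => u.1 (chart Ω e p)) 2 (volume.prod volume) ^ 2
        = ENNReal.ofReal (c / haarConst V) * eLpNorm u.1 2 (haarR0 Ω) ^ 2 := by
      rw [eLpNorm_two_sq, eLpNorm_two_sq, lintegral_haarR0 hm, ← mul_assoc,
        ← ENNReal.ofReal_mul (by positivity), div_mul_cancel₀ _ hγ.ne']
      exact hk _ hu
    have h2 := congrArg ENNReal.toReal h1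
    rw [ENNReal.toReal_mul, ENNReal.toReal_pow, ENNReal.toReal_pow,
      ENNReal.toReal_ofReal (by positivity)] at h2
    have h3 : ‖testToHS Ω e hκ u‖ ^ 2 = c / haarConst V * ‖testToL2 Ω u‖ ^ 2 := by
      have e1 : ‖testToHS Ω e hκ u‖ = _ := Lp.norm_toLp _ (memLp_ker hκ hu)
      have e2 : ‖testToL2 Ω u‖ = _ := Lp.norm_toLp _ (IsTest.memLp u.2)
      rw [e1, e2, h2]
    rw [LinearMap.smul_apply, norm_smul, Complex.norm_real, Real.norm_of_nonneg hs.le]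
    refine (sq_eq_sq₀ (by positivity) (by positivity)).1 ?_
    rw [mul_pow, h3, Real.sq_sqrt (by positivity)]
    field_simp
  · have h1 : (k : (ℝ × E) × (ℝ × E) → ℂ) =ᵐ[volume] 0 := by
      refine eq_zero_of_integral_ker hκ k.measurable_coe k.lintegral_lt_top fun U hU => ?_
      have h2 := hk0 ⟨fun g => U ((chart Ω e).symm g), isTest_comp_chart_symm hU⟩
      rw [LinearMap.smul_apply, inner_smul_left, mul_eq_zero, or_iff_right
        (by simpa using hs.ne'), L2_inner_eq] at h2
      rw [← h2]
      refine integral_congr_ae ?_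
      filter_upwards [coeFn_testToHS (e := e) hκ
        ⟨fun g => U ((chart Ω e).symm g), isTest_comp_chart_symm hU⟩] with z hz
      rw [hz]
      simp
    exact (Lp.eq_zero_iff_ae_eq_zero).2 h1

end Group

theorem HS.continuous_adj {X : Type*} [MeasurableSpace X] {μ : Measure X} [SigmaFinite μ] :
    Continuous (HS.adj : HS μ → HS μ) :=
  continuous_Lp_star.comp
    (Lp.isometry_compMeasurePreserving (Measure.measurePreserving_swap)).continuous

/-- A bounded bilinear map from a Hilbert algebra structure with submultiplicative norm. -/
def IsHilbertAlgebra.toBilin {H : Type*} [NormedAddCommGroup H] [InnerProductSpace ℂ H]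
    {mul : H → H → H} {J : H → H} (h : IsHilbertAlgebra mul J) (C : ℝ)
    (hC : ∀ x y, ‖mul x y‖ ≤ C * ‖x‖ * ‖y‖) : H →L[ℂ] H →L[ℂ] H :=
  LinearMap.mkContinuous₂ (LinearMap.mk₂ ℂ mul h.add_mul h.smul_mul h.mul_add h.mul_smul) C hC

/-! ### Left invariance, and the extension of the product to `L²`. -/

section Group

variable {V : Type*} [NormedAddCommGroup V] [NormedSpace ℝ V] {Ω : V →ₗ[ℝ] V →ₗ[ℝ] ℝ}
  [FiniteDimensional ℝ V] [MeasurableSpace V] [BorelSpace V]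

theorem star_testToL2 (u : testSpace Ω) :
    star (testToL2 Ω u) = testToL2 Ω ⟨fun g => (starRingEnd ℂ) (u.1 g), IsTest.conj u.2⟩ := by
  refine Lp.ext ?_
  filter_upwards [Lp.coeFn_star (testToL2 Ω u), MemLp.coeFn_toLp (IsTest.memLp u.2),
    MemLp.coeFn_toLp (IsTest.memLp (IsTest.conj u.2))] with g h1 h2 h3
  rw [h1, Pi.star_apply]
  refine Eq.trans ?_ h3.symm
  exact congrArg star h2

theorem leftReg_testToL2 (g : R0 Ω) (u : testSpace Ω) :
    leftReg g (testToL2 Ω u) = testToL2 Ω ⟨fun h => u.1 (g⁻¹ * h), IsTest.mul_left u.2 g⁻¹⟩ :=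
  rfl

theorem continuous_leftReg (g : R0 Ω) : Continuous (leftReg g : L2 Ω → L2 Ω) :=
  (Lp.isometry_compMeasurePreserving (measurePreserving_mul_left Ω g⁻¹)).continuous

theorem cosh_mul_exp_sub (a b c : ℝ) :
    Real.cosh (a - b) * Real.exp (-c) - Real.cosh (c - a) * Real.exp (-b)
      = Real.sinh (b - c) * Real.exp (-a) := by
  simp only [Real.cosh_eq, Real.sinh_eq, add_mul, div_mul_eq_mul_div, sub_mul, ← Real.exp_add]
  ring_nf

theorem sinh_mul_exp_cyclic (a b c : ℝ) :
    Real.sinh (2 * (a - b)) * Real.exp (-2 * c) + Real.sinh (2 * (b - c)) * Real.exp (-2 * a)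
      + Real.sinh (2 * (c - a)) * Real.exp (-2 * b) = 0 := by
  simp only [Real.sinh_eq, div_mul_eq_mul_div, sub_mul, ← Real.exp_add]
  ring_nf

/-- Translation adds terms in `g.x` and `g.z`. With `sinh 2t = 2 sinh t cosh t`, the terms `Ω(g.x,
gᵢ.x)` coming from `S_V` and from the `z`-coordinates cancel by `cosh_mul_exp_sub`, and the
coefficient of `g.z` vanishes by `sinh_mul_exp_cyclic`. -/
theorem phase_mul_left (hΩ : Ω.IsAlt) (g g₀ g₁ g₂ : R0 Ω) :
    phase (g * g₀) (g * g₁) (g * g₂) = phase g₀ g₁ g₂ := by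
  have h0 : Ω g.x g.x = 0 := hΩ g.x
  have e0 : Ω g₀.x g.x = -Ω g.x g₀.x := (hΩ.neg _ _).symm
  have e1 : Ω g₁.x g.x = -Ω g.x g₁.x := (hΩ.neg _ _).symm
  have e2 : Ω g₂.x g.x = -Ω g.x g₂.x := (hΩ.neg _ _).symm
  have k0 := cosh_mul_exp_sub g₀.a g₁.a g₂.a
  have k1 := cosh_mul_exp_sub g₁.a g₂.a g₀.a
  have k2 := cosh_mul_exp_sub g₂.a g₀.a g₁.a
  have k := sinh_mul_exp_cyclic g₀.a g₁.a g₂.a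
  simp only [phase, SV, R0.mul_a, R0.mul_x, R0.mul_z, add_sub_add_left_eq_sub, map_add, map_smul,
    LinearMap.add_apply, LinearMap.smul_apply, smul_eq_mul, h0, e0, e1, e2]
  simp only [Real.sinh_two_mul] at k ⊢
  linear_combination (Real.cosh (g₁.a - g₂.a) * Ω g.x g₀.x) * k0
    + (Real.cosh (g₂.a - g₀.a) * Ω g.x g₁.x) * k1
    + (Real.cosh (g₀.a - g₁.a) * Ω g.x g₂.x) * k2 - g.z * k

theorem starProd_mul_left (hΩ : Ω.IsAlt) (θ : ℝ) {u v : R0 Ω → ℂ} (hu : IsTest u) (hv : IsTest v)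
    (g g₀ : R0 Ω) :
    starProd θ (fun h => u (g⁻¹ * h)) (fun h => v (g⁻¹ * h)) g₀ = starProd θ u v (g⁻¹ * g₀) := by
  have hmp := (measurePreserving_mul_left Ω g⁻¹).prod (measurePreserving_mul_left Ω g⁻¹)
  have hc : AEStronglyMeasurable (integrand θ u v (g⁻¹ * g₀))
      (Measure.map (Prod.map (fun h : R0 Ω => g⁻¹ * h) fun h => g⁻¹ * h)
        ((haarR0 Ω).prod (haarR0 Ω))) := by
    rw [hmp.map_eq]
    exact (integrable_integrand θ hu hv _).aestronglyMeasurable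
  have h1 := integral_map hmp.measurable.aemeasurable hc
  rw [hmp.map_eq] at h1
  rw [starProd, starProd, h1]
  congr 1
  refine integral_congr_ae (Filter.Eventually.of_forall fun p => ?_)
  simp only [integrand, Prod.map_fst, Prod.map_snd, phase_mul_left hΩ, amplitude_mul_left]

variable {E : Type*} [NormedAddCommGroup E] [InnerProductSpace ℝ E]
  [FiniteDimensional ℝ E] [MeasurableSpace E] [BorelSpace E] {e : V ≃L[ℝ] E × E}

theorem adj_testToHS {κ : ℝ} (hκ : κ ≠ 0) (u : testSpace Ω) :
    HS.adj (testToHS Ω e hκ u)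
      = testToHS Ω e hκ ⟨fun g => (starRingEnd ℂ) (u.1 g), IsTest.conj u.2⟩ := by
  refine Lp.ext ?_
  have h0 := (Measure.measurePreserving_swap (μ := (volume : Measure (ℝ × E)))
    (ν := (volume : Measure (ℝ × E)))).quasiMeasurePreserving.ae (coeFn_testToHS (e := e) hκ u)
  filter_upwards [HS.coeFn_adj (testToHS Ω e hκ u), h0, coeFn_testToHS (e := e) hκ
    ⟨fun g => (starRingEnd ℂ) (u.1 g), IsTest.conj u.2⟩] with z h1 h2 h3
  rw [h1, h2, h3, ker_conj]

theorem unitary_star {κ : ℝ} (hκ : κ ≠ 0) {s : ℝ} {Φ : L2 Ω ≃ₗᵢ[ℂ] HS (volume : Measure (ℝ × E))}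
    (hΦ : ∀ u, Φ (testToL2 Ω u) = (s : ℂ) • testToHS Ω e hκ u) (f : L2 Ω) :
    Φ (star f) = HS.adj (Φ f) := by
  refine denseRange_testToL2.induction_on f (isClosed_eq
    (Φ.continuous.comp continuous_Lp_star) (HS.continuous_adj.comp Φ.continuous)) fun u => ?_
  have h1 : HS.adj ((s : ℂ) • testToHS Ω e hκ u) = (s : ℂ) • HS.adj (testToHS Ω e hκ u) := by
    have := HS.isHilbertAlgebra (μ := (volume : Measure (ℝ × E))).inv_smul (s : ℂ)
      (testToHS Ω e hκ u)
    rwa [Complex.conj_ofReal] at this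
  rw [star_testToL2, hΦ, hΦ, h1, adj_testToHS]

theorem exists_integral_starProd (he : IsDarboux Ω e)
    (hm : liouville Ω = Measure.map e.symm volume) {θ : ℝ} (hθ : θ ≠ 0) :
    ∃ c : ℝ, c ≠ 0 ∧ ∀ w u v : R0 Ω → ℂ, IsTest w → IsTest u → IsTest v →
      ∫ g, w g * starProd θ u v g ∂haarR0 Ω
        = c * ∫ z : (ℝ × E) × (ℝ × E), kcomp volume (ker (2 / θ) fun p => u (chart Ω e p))
          (ker (2 / θ) fun p => v (chart Ω e p)) z
            * ker (2 / θ) (fun p => w (chart Ω e p)) z.swap := by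
  obtain ⟨c, hc, h⟩ := exists_integral_mul_starW (E := E) (div_ne_zero two_ne_zero hθ)
  refine ⟨haarConst V * (starConst V θ * c), mul_ne_zero haarConst_pos.ne'
    (mul_ne_zero (starConst_ne_zero hθ) hc.ne'), fun w u v hw hu hv => ?_⟩
  rw [integral_haarR0 hm]
  simp only [starProd_chart he hm θ hu hv, mul_left_comm _ (starConst V θ : ℂ), integral_const_mul]
  rw [h _ _ _ (isTestW_comp_chart hw) (isTestW_comp_chart hu) (isTestW_comp_chart hv)]
  push_cast
  ring

/-- The product is defined by transporting kernel composition, which makes boundedness and the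
algebra axioms immediate. On test functions it is identified with the oscillatory integral by
pairing with test functions, so square integrability of `starProd` comes out without a direct
estimate. -/
theorem exists_extension (he : IsDarboux Ω e)
    (hm : liouville Ω = Measure.map e.symm volume) {θ : ℝ} (hθ : θ ≠ 0) :
    ∃ M : L2 Ω →L[ℂ] L2 Ω →L[ℂ] L2 Ω, Extends θ M ∧
      IsHilbertAlgebra (fun f h : L2 Ω => M f h) star := by
  have hκ : 2 / θ ≠ 0 := div_ne_zero two_ne_zero hθ
  have := isAddHaarMeasure_haarR0 hm
  obtain ⟨s, hs, Φ, hΦ⟩ := exists_unitary_ker hm hκ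
  obtain ⟨c₀, hc₀, hint⟩ := exists_integral_starProd he hm hθ
  -- The pairing of a product with a test function involves three images under `Φ`, each carrying a
  -- factor `s`.
  let c : ℝ := c₀ / s ^ 3
  have hc : (c : ℂ) ≠ 0 := by
    exact_mod_cast div_ne_zero hc₀ (pow_ne_zero _ hs.ne')
  have hHS := HS.isHilbertAlgebra (μ := (volume : Measure (ℝ × E)))
  have hA := hHS.transport Φ hc (Complex.conj_ofReal c) (unitary_star hκ hΦ)
  have hb : ∀ f h : L2 Ω, ‖(c : ℂ) • Φ.symm (HS.mul (Φ f) (Φ h))‖ ≤ ‖(c : ℂ)‖ * ‖f‖ * ‖h‖ := by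
    intro f h
    rw [norm_smul, LinearIsometryEquiv.norm_map, mul_assoc]
    gcongr
    simpa using HS.norm_mul_le (Φ f) (Φ h)
  refine ⟨hA.toBilin _ hb, fun u v hu hv => ?_, hA⟩
  let g : L2 Ω := hA.toBilin _ hb (hu.memLp.toLp u) (hv.memLp.toLp v)
  have hg : (c : ℂ) • Φ.symm (HS.mul (Φ (testToL2 Ω ⟨u, hu⟩)) (Φ (testToL2 Ω ⟨v, hv⟩))) = g := rfl
  have hgmul : (HS.mul (testToHS Ω e hκ ⟨u, hu⟩) (testToHS Ω e hκ ⟨v, hv⟩) :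
      (ℝ × E) × (ℝ × E) → ℂ) =ᵐ[volume.prod volume]
      kcomp volume (ker (2 / θ) fun p => u (chart Ω e p))
        (ker (2 / θ) fun p => v (chart Ω e p)) :=
    (HS.coeFn_mul _ _).trans (kcomp_congr (coeFn_testToHS hκ ⟨u, hu⟩) (coeFn_testToHS hκ ⟨v, hv⟩))
  have hae : starProd θ u v =ᵐ[haarR0 Ω] g := by
    refine ae_eq_of_integral_contDiff_smul_eq
      (continuous_starProd he hm θ hu hv).locallyIntegrable
      ((Lp.memLp g).locallyIntegrable (by norm_num)) fun φ hφ hφc => ?_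
    have hw : IsTest fun x : R0 Ω => (φ x : ℂ) := ⟨Complex.ofRealCLM.contDiff.comp hφ,
      hφc.comp_left (g := fun r : ℝ => (r : ℂ)) (by simp)⟩
    have h1 : ∫ x, φ x • g x ∂haarR0 Ω = inner ℂ (testToL2 Ω ⟨_, hw⟩) g := by
      rw [L2_inner_eq]
      refine integral_congr_ae ?_
      filter_upwards [MemLp.coeFn_toLp hw.memLp] with x hx
      have hx' : (testToL2 Ω ⟨_, hw⟩ : R0 Ω → ℂ) x = φ x := hx
      rw [hx', Complex.conj_ofReal, Complex.real_smul]
    have h2 : inner ℂ (testToHS Ω e hκ ⟨_, hw⟩)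
          (HS.mul (testToHS Ω e hκ ⟨u, hu⟩) (testToHS Ω e hκ ⟨v, hv⟩))
        = ∫ z : (ℝ × E) × (ℝ × E), kcomp volume (ker (2 / θ) fun p => u (chart Ω e p))
          (ker (2 / θ) fun p => v (chart Ω e p)) z
            * ker (2 / θ) (fun p => (φ (chart Ω e p) : ℂ)) z.swap := by
      rw [L2_inner_eq]
      refine integral_congr_ae ?_
      filter_upwards [hgmul, coeFn_testToHS (e := e) hκ ⟨_, hw⟩] with z h3 h4
      -- For real `φ` the kernel is self-adjoint, which turns the inner product into the trace
      -- pairing.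
      have h5 := ker_conj (2 / θ) (fun p => (φ (chart Ω e p) : ℂ)) z.swap
      simp only [Complex.conj_ofReal, Prod.swap_swap] at h5
      rw [h3, h4, mul_comm, ← h5]
    have h3 : inner ℂ (testToL2 Ω ⟨_, hw⟩) g = c₀ * inner ℂ (testToHS Ω e hκ ⟨_, hw⟩)
          (HS.mul (testToHS Ω e hκ ⟨u, hu⟩) (testToHS Ω e hκ ⟨v, hv⟩)) := by
      rw [← hg, ← Φ.inner_map_map, map_smul, Φ.apply_symm_apply, hΦ, hΦ, hΦ, hHS.smul_mul,
        hHS.mul_smul, inner_smul_right, inner_smul_right, inner_smul_right, inner_smul_left,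
        Complex.conj_ofReal]
      have hs' : (s : ℂ) ≠ 0 := by exact_mod_cast hs.ne'
      simp only [c]
      push_cast
      field_simp
    rw [h1, h3, h2, ← hint _ u v hw hu hv]
    simp only [Complex.real_smul]
  have hmem : MemLp (starProd θ u v) 2 (haarR0 Ω) := (memLp_congr_ae hae).2 (Lp.memLp g)
  refine ⟨hu.memLp, hv.memLp, hmem, ?_⟩
  exact Lp.ext (hae.symm.trans (MemLp.coeFn_toLp hmem).symm)

theorem Extends.testToL2 {θ : ℝ} {M : L2 Ω →L[ℂ] L2 Ω →L[ℂ] L2 Ω} (h : Extends θ M)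
    (u v : testSpace Ω) : (M (testToL2 Ω u) (testToL2 Ω v) : R0 Ω → ℂ)
      =ᵐ[haarR0 Ω] starProd θ u.1 v.1 := by
  obtain ⟨hu, hv, huv, h1⟩ := h u.1 v.1 u.2 v.2
  have h2 : M (OscKernel.testToL2 Ω u) (OscKernel.testToL2 Ω v) = huv.toLp _ := h1
  rw [h2]
  exact MemLp.coeFn_toLp huv

theorem Extends.unique {θ : ℝ} {M M' : L2 Ω →L[ℂ] L2 Ω →L[ℂ] L2 Ω} (h : Extends θ M)
    (h' : Extends θ M') : M' = M := by
  refine ContinuousLinearMap.ext fun f => ContinuousLinearMap.ext fun k => ?_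
  refine denseRange_testToL2.induction_on₂ (isClosed_eq (by fun_prop) (by fun_prop))
    (fun u v => ?_) f k
  exact Lp.ext ((h'.testToL2 u v).trans (h.testToL2 u v).symm)

theorem Extends.leftReg {θ : ℝ} {M : L2 Ω →L[ℂ] L2 Ω →L[ℂ] L2 Ω} (h : Extends θ M)
    (hΩ : Ω.IsAlt) (g : R0 Ω) (f k : L2 Ω) :
    M (OscKernel.leftReg g f) (OscKernel.leftReg g k) = OscKernel.leftReg g (M f k) := by
  have hc := continuous_leftReg (Ω := Ω) g
  refine denseRange_testToL2.induction_on₂ (p := fun f k =>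
    M (OscKernel.leftReg g f) (OscKernel.leftReg g k) = OscKernel.leftReg g (M f k))
    (isClosed_eq (by fun_prop) (by fun_prop)) (fun u v => ?_) f k
  rw [leftReg_testToL2, leftReg_testToL2]
  refine Lp.ext ((h.testToL2 _ _).trans ?_)
  have h1 := Lp.coeFn_compMeasurePreserving (M (OscKernel.testToL2 Ω u) (OscKernel.testToL2 Ω v))
    (measurePreserving_mul_left Ω g⁻¹)
  have h2 := (measurePreserving_mul_left Ω g⁻¹).quasiMeasurePreserving.ae (h.testToL2 u v)
  refine Filter.EventuallyEq.trans ?_ h1.symm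
  filter_upwards [h2] with x hx
  rw [starProd_mul_left hΩ θ u.2 v.2, Function.comp_apply, hx]

end Group

/-! ### Amplitudes generated by hyperbolic functions. -/

/-- Linear functions of three real variables. -/
def IsLin (l : ℝ → ℝ → ℝ → ℝ) : Prop := ∃ α β γ : ℝ, ∀ a b c, l a b c = α * a + β * b + γ * c

theorem isLin_sub₁₂ : IsLin fun _ b c => b - c := ⟨0, 1, -1, by intros; ring⟩
theorem isLin_sub₂₀ : IsLin fun a _ c => c - a := ⟨-1, 0, 1, by intros; ring⟩
theorem isLin_sub₀₁ : IsLin fun a b _ => a - b := ⟨1, -1, 0, by intros; ring⟩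

theorem IsLin.const_mul {l : ℝ → ℝ → ℝ → ℝ} (h : IsLin l) (r : ℝ) :
    IsLin fun a b c => r * l a b c := by
  obtain ⟨α, β, γ, h⟩ := h
  exact ⟨r * α, r * β, r * γ, fun a b c => by simp only [h]; ring⟩

/-- The amplitudes of exponential type generated by hyperbolic functions. -/
inductive Amp : (ℝ → ℝ → ℝ → ℝ) → Prop
  | const (r : ℝ) : Amp fun _ _ _ => r
  | cosh {l : ℝ → ℝ → ℝ → ℝ} (h : IsLin l) : Amp fun a b c => Real.cosh (l a b c)
  | sinh {l : ℝ → ℝ → ℝ → ℝ} (h : IsLin l) : Amp fun a b c => Real.sinh (l a b c)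
  | inv_cosh {l : ℝ → ℝ → ℝ → ℝ} (h : IsLin l) : Amp fun a b c => (Real.cosh (l a b c))⁻¹
  | sqrt_cosh {l : ℝ → ℝ → ℝ → ℝ} (h : IsLin l) :
      Amp fun a b c => Real.sqrt (Real.cosh (l a b c))
  | add {B B' : ℝ → ℝ → ℝ → ℝ} (h : Amp B) (h' : Amp B') : Amp fun a b c => B a b c + B' a b c
  | mul {B B' : ℝ → ℝ → ℝ → ℝ} (h : Amp B) (h' : Amp B') : Amp fun a b c => B a b c * B' a b c

namespace Amp

variable {B B' : ℝ → ℝ → ℝ → ℝ}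

theorem congr (h : Amp B) (h' : ∀ a b c, B a b c = B' a b c) : Amp B' := by
  have : B = B' := by funext a b c; exact h' a b c
  rwa [← this]

theorem pow (h : Amp B) (n : ℕ) : Amp fun a b c => B a b c ^ n := by
  induction n with
  | zero => exact (Amp.const 1).congr fun a b c => (pow_zero _).symm
  | succ n ih => exact (ih.mul h).congr fun a b c => (pow_succ _ _).symm

theorem continuous (h : Amp B) : Continuous fun p : ℝ × ℝ × ℝ => B p.1 p.2.1 p.2.2 := by
  have hl : ∀ {l : ℝ → ℝ → ℝ → ℝ}, IsLin l →
      Continuous fun p : ℝ × ℝ × ℝ => l p.1 p.2.1 p.2.2 := by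
    rintro l ⟨α, β, γ, h⟩
    simp only [h]
    fun_prop
  induction h with
  | const r => fun_prop
  | cosh h => exact Real.continuous_cosh.comp (hl h)
  | sinh h => exact Real.continuous_sinh.comp (hl h)
  | inv_cosh h => exact (Real.continuous_cosh.comp (hl h)).inv₀ fun p => (Real.cosh_pos _).ne'
  | sqrt_cosh h => exact (Real.continuous_cosh.comp (hl h)).sqrt
  | add h h' ih ih' => exact ih.add ih'
  | mul h h' ih ih' => exact ih.mul ih'

theorem continuous_comp (h : Amp B) {T : Type*} [TopologicalSpace T] {f g k : T → ℝ}
    (hf : Continuous f) (hg : Continuous g) (hk : Continuous k) :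
    Continuous fun t => B (f t) (g t) (k t) :=
  h.continuous.comp (hf.prodMk (hg.prodMk hk))

/-- Only the second variable is differentiated, since every integration by parts below acts on the
second point. Having `cosh⁻¹` among the generators keeps the derivative of `√cosh` inside the class
and allows division by the `cosh` coefficients of the phase derivatives. -/
theorem exists_hasDerivAt (h : Amp B) : ∃ B', Amp B' ∧
    ∀ a b c, HasDerivAt (fun t => B a t c) (B' a b c) b := by
  have hl : ∀ {l : ℝ → ℝ → ℝ → ℝ}, IsLin l → ∃ β : ℝ, ∀ a b c,
      HasDerivAt (fun t => l a t c) β b := by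
    rintro l ⟨α, β, γ, h⟩
    refine ⟨β, fun a b c => ?_⟩
    simp only [h]
    simpa using (((hasDerivAt_id b).const_mul β).const_add (α * a)).add_const (γ * c)
  induction h with
  | const r => exact ⟨_, Amp.const 0, fun a b c => hasDerivAt_const b r⟩
  | cosh h =>
    obtain ⟨β, hβ⟩ := hl h
    exact ⟨_, (Amp.sinh h).mul (Amp.const β), fun a b c => (hβ a b c).cosh⟩
  | sinh h =>
    obtain ⟨β, hβ⟩ := hl h
    exact ⟨_, (Amp.cosh h).mul (Amp.const β), fun a b c => (hβ a b c).sinh⟩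
  | inv_cosh h =>
    obtain ⟨β, hβ⟩ := hl h
    refine ⟨_, ((Amp.sinh h).mul (Amp.const (-β))).mul ((Amp.inv_cosh h).pow 2),
      fun a b c => ?_⟩
    refine ((hβ a b c).cosh.fun_inv (Real.cosh_pos _).ne').congr_deriv ?_
    rw [inv_pow, div_eq_mul_inv]
    ring
  | sqrt_cosh h =>
    obtain ⟨β, hβ⟩ := hl h
    refine ⟨_, (((Amp.sinh h).mul (Amp.const (β / 2))).mul (Amp.sqrt_cosh h)).mul
      (Amp.inv_cosh h), fun a b c => ?_⟩
    refine ((hβ a b c).cosh.sqrt (Real.cosh_pos _).ne').congr_deriv ?_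
    rename_i l
    have h1 : Real.sqrt (Real.cosh (l a b c)) ≠ 0 :=
      (Real.sqrt_pos.2 (Real.cosh_pos _)).ne'
    have h2 : Real.cosh (l a b c) =
        Real.sqrt (Real.cosh (l a b c)) * Real.sqrt (Real.cosh (l a b c)) :=
      (Real.mul_self_sqrt (Real.cosh_pos _).le).symm
    generalize Real.sqrt (Real.cosh (l a b c)) = r at *
    rw [h2]
    field_simp
  | add h h' ih ih' =>
    obtain ⟨D, hD, hd⟩ := ih
    obtain ⟨D', hD', hd'⟩ := ih'
    exact ⟨_, hD.add hD', fun a b c => (hd a b c).add (hd' a b c)⟩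
  | mul h h' ih ih' =>
    obtain ⟨D, hD, hd⟩ := ih
    obtain ⟨D', hD', hd'⟩ := ih'
    exact ⟨_, (hD.mul h').add (h.mul hD'), fun a b c => (hd a b c).mul (hd' a b c)⟩

theorem exists_bound (h : Amp B) : ∃ C K : ℝ, 0 ≤ C ∧ 0 ≤ K ∧
    ∀ a b c, |B a b c| ≤ C * Real.exp (K * (|a| + |b| + |c|)) := by
  have hcosh : ∀ x : ℝ, Real.cosh x ≤ Real.exp |x| := fun x => by
    rw [← Real.cosh_abs, Real.cosh_eq]
    have : Real.exp (-|x|) ≤ Real.exp |x| := Real.exp_le_exp.2 (by linarith [abs_nonneg x])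
    linarith
  have hl : ∀ {l : ℝ → ℝ → ℝ → ℝ}, IsLin l → ∃ K : ℝ, 0 ≤ K ∧
      ∀ a b c, Real.cosh (l a b c) ≤ 1 * Real.exp (K * (|a| + |b| + |c|)) := by
    rintro l ⟨α, β, γ, h⟩
    refine ⟨|α| + |β| + |γ|, by positivity, fun a b c => ?_⟩
    rw [one_mul]
    refine (hcosh _).trans (Real.exp_le_exp.2 ?_)
    rw [h]
    have h1 := abs_add_three (α * a) (β * b) (γ * c)
    rw [abs_mul, abs_mul, abs_mul] at h1
    nlinarith [mul_nonneg (abs_nonneg α) (abs_nonneg b), mul_nonneg (abs_nonneg α) (abs_nonneg c),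
      mul_nonneg (abs_nonneg β) (abs_nonneg a), mul_nonneg (abs_nonneg β) (abs_nonneg c),
      mul_nonneg (abs_nonneg γ) (abs_nonneg a), mul_nonneg (abs_nonneg γ) (abs_nonneg b)]
  induction h with
  | const r => exact ⟨|r|, 0, abs_nonneg r, le_rfl, fun a b c => by simp⟩
  | cosh h =>
    obtain ⟨K, hK, hb⟩ := hl h
    exact ⟨1, K, zero_le_one, hK, fun a b c => by
      rw [abs_of_pos (Real.cosh_pos _)]; exact hb a b c⟩
  | sinh h =>
    obtain ⟨K, hK, hb⟩ := hl h
    exact ⟨1, K, zero_le_one, hK, fun a b c => by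
      rw [← Real.sqrt_sq_eq_abs, Real.sinh_sq]
      refine (Real.sqrt_le_sqrt (sub_le_self _ zero_le_one)).trans ?_
      rw [Real.sqrt_sq (Real.cosh_pos _).le]
      exact hb a b c⟩
  | inv_cosh h =>
    refine ⟨1, 0, zero_le_one, le_rfl, fun a b c => ?_⟩
    rw [abs_of_pos (inv_pos.2 (Real.cosh_pos _))]
    simpa using inv_le_one_of_one_le₀ (Real.one_le_cosh _)
  | sqrt_cosh h =>
    obtain ⟨K, hK, hb⟩ := hl h
    exact ⟨1, K, zero_le_one, hK, fun a b c => by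
      rw [abs_of_nonneg (Real.sqrt_nonneg _)]
      refine le_trans (Real.sqrt_le_iff.2 ⟨(Real.cosh_pos _).le, ?_⟩) (hb a b c)
      exact le_self_pow₀ (Real.one_le_cosh _) two_ne_zero⟩
  | add h h' ih ih' =>
    obtain ⟨C, K, hC, hK, hb⟩ := ih
    obtain ⟨C', K', hC', hK', hb'⟩ := ih'
    refine ⟨C + C', K + K', by positivity, by positivity, fun a b c => ?_⟩
    refine (abs_add_le _ _).trans ((add_le_add (hb a b c) (hb' a b c)).trans ?_)
    rw [add_mul]
    gcongr <;> linarith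
  | mul h h' ih ih' =>
    obtain ⟨C, K, hC, hK, hb⟩ := ih
    obtain ⟨C', K', hC', hK', hb'⟩ := ih'
    refine ⟨C * C', K + K', by positivity, by positivity, fun a b c => ?_⟩
    rw [abs_mul, add_mul, Real.exp_add, mul_mul_mul_comm]
    exact mul_le_mul (hb a b c) (hb' a b c) (abs_nonneg _) (by positivity)

end Amp

/-! ### Integration by parts in oscillatory integrals. -/

theorem integral_lineDeriv_eq_zero {X : Type*} [NormedAddCommGroup X] [NormedSpace ℝ X]
    [FiniteDimensional ℝ X] [MeasurableSpace X] [BorelSpace X] {μ : Measure X}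
    [μ.IsAddHaarMeasure] {G G' : X → ℂ} {v : X} (hG : Integrable G μ) (hG' : Integrable G' μ)
    (h : ∀ x, HasLineDerivAt ℝ G (G' x) x v) : ∫ x, G' x ∂μ = 0 := by
  have h1 := integral_bilinear_hasLineDerivAt_right_eq_neg_left_of_integrable (μ := μ)
    (f := fun _ : X => (1 : ℂ)) (f' := fun _ => 0) (g := G) (g' := G') (v := v)
    (B := ContinuousLinearMap.mul ℝ ℂ) (by simp) (by simpa using hG') (by simpa using hG)
    (fun x _ => by simpa using! hasDerivAt_const (0 : ℝ) (1 : ℂ)) (fun x _ => h x)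
  simpa using h1

section Oscillatory

variable {V : Type*} [NormedAddCommGroup V] [NormedSpace ℝ V] {Ω : V →ₗ[ℝ] V →ₗ[ℝ] ℝ}

/-- The directional derivative of a function. -/
def dirDeriv (u : R0 Ω → ℂ) (d g : R0 Ω) : ℂ := fderiv ℝ u g d

theorem IsTest.dirDeriv {u : R0 Ω → ℂ} (hu : IsTest u) (d : R0 Ω) :
    IsTest (OscKernel.dirDeriv u d) :=
  ⟨(hu.1.fderiv_right (m := ∞) (by simp)).clm_apply contDiff_const, hu.2.fderiv_apply ℝ d⟩

theorem IsTest.hasDerivAt {u : R0 Ω → ℂ} (hu : IsTest u) (d g : R0 Ω) :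
    HasDerivAt (fun t : ℝ => u (g + t • d)) (OscKernel.dirDeriv u d g) 0 :=
  ((hu.1.differentiable (by simp) g).hasFDerivAt.hasLineDerivAt d)

theorem IsTest.smooth_mul {u : R0 Ω → ℂ} (hu : IsTest u) {f : R0 Ω → ℝ} (hf : ContDiff ℝ ∞ f) :
    IsTest fun g => (f g : ℂ) * u g :=
  ⟨(Complex.ofRealCLM.contDiff.comp hf).mul hu.1, hu.2.mul_left⟩

@[simp] theorem R0.add_a (g h : R0 Ω) : (g + h).a = g.a + h.a := rfl
@[simp] theorem R0.add_x (g h : R0 Ω) : (g + h).x = g.x + h.x := rfl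
@[simp] theorem R0.add_z (g h : R0 Ω) : (g + h).z = g.z + h.z := rfl
@[simp] theorem R0.smul_a (t : ℝ) (g : R0 Ω) : (t • g).a = t * g.a := rfl
@[simp] theorem R0.smul_x (t : ℝ) (g : R0 Ω) : (t • g).x = t • g.x := rfl
@[simp] theorem R0.smul_z (t : ℝ) (g : R0 Ω) : (t • g).z = t * g.z := rfl

/-- The integrand of an oscillatory integral with amplitude `B`. -/
def oscIntegrand (κ : ℝ) (B : ℝ → ℝ → ℝ → ℝ) (u v : R0 Ω → ℂ) (g₀ : R0 Ω) (p : R0 Ω × R0 Ω) : ℂ :=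
  (B g₀.a p.1.a p.2.a : ℂ) * Complex.exp ((κ * phase g₀ p.1 p.2 : ℝ) * Complex.I)
    * (u p.1 * v p.2)

/-- The phase derivative in the direction `w ∈ V` of the second point. -/
def phaseX (w : V) (g₀ g₁ g₂ : R0 Ω) : ℝ :=
  Real.cosh (g₁.a - g₂.a) * Real.cosh (g₂.a - g₀.a) * Ω g₀.x w
    + Real.cosh (g₂.a - g₀.a) * Real.cosh (g₀.a - g₁.a) * Ω w g₂.x

theorem hasDerivAt_phase_x (w : V) (g₀ g₁ g₂ : R0 Ω) :
    HasDerivAt (fun t : ℝ => phase g₀ (g₁ + t • (R0.mk 0 w 0 : R0 Ω)) g₂)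
      (phaseX w g₀ g₁ g₂) 0 := by
  have h : ∀ t : ℝ, phase g₀ (g₁ + t • (R0.mk 0 w 0 : R0 Ω)) g₂
      = phase g₀ g₁ g₂ + t * phaseX w g₀ g₁ g₂ := fun t => by
    simp only [phase, SV, phaseX, R0.add_a, R0.add_x, R0.add_z, R0.smul_a, R0.smul_x, R0.smul_z,
      R0.mk_a, R0.mk_x, R0.mk_z, mul_zero, add_zero, map_add, map_smul, LinearMap.add_apply,
      LinearMap.smul_apply, smul_eq_mul]
    ring
  simp only [h]
  simpa using ((hasDerivAt_id (0 : ℝ)).mul_const (phaseX w g₀ g₁ g₂)).const_add (phase g₀ g₁ g₂)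

theorem hasDerivAt_phase_z (g₀ g₁ g₂ : R0 Ω) :
    HasDerivAt (fun t : ℝ => phase g₀ (g₁ + t • (R0.mk 0 0 1 : R0 Ω)) g₂)
      (-Real.sinh (2 * (g₂.a - g₀.a))) 0 := by
  have h : ∀ t : ℝ, phase g₀ (g₁ + t • (R0.mk 0 0 1 : R0 Ω)) g₂
      = phase g₀ g₁ g₂ + t * -Real.sinh (2 * (g₂.a - g₀.a)) := fun t => by
    simp only [phase, SV, R0.add_a, R0.add_x, R0.add_z, R0.smul_a, R0.smul_x, R0.smul_z,
      R0.mk_a, R0.mk_x, R0.mk_z, mul_zero, add_zero, smul_zero]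
    ring
  simp only [h]
  simpa using ((hasDerivAt_id (0 : ℝ)).mul_const
    (-Real.sinh (2 * (g₂.a - g₀.a)))).const_add (phase g₀ g₁ g₂)

/-- The phase derivative in the coordinate `a` of the second point. -/
def phaseA (g₀ g₁ g₂ : R0 Ω) : ℝ :=
  Real.sinh (g₁.a - g₂.a) * Real.cosh (g₂.a - g₀.a) * Ω g₀.x g₁.x
    - Real.cosh (g₂.a - g₀.a) * Real.sinh (g₀.a - g₁.a) * Ω g₁.x g₂.x
    + (Real.cosh (g₀.a - g₁.a) * Real.sinh (g₁.a - g₂.a)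
      - Real.sinh (g₀.a - g₁.a) * Real.cosh (g₁.a - g₂.a)) * Ω g₂.x g₀.x
    + 2 * Real.cosh (2 * (g₀.a - g₁.a)) * g₂.z - 2 * Real.cosh (2 * (g₁.a - g₂.a)) * g₀.z

theorem hasDerivAt_phase_a (g₀ g₁ g₂ : R0 Ω) :
    HasDerivAt (fun t : ℝ => phase g₀ (g₁ + t • (R0.mk 1 0 0 : R0 Ω)) g₂)
      (phaseA g₀ g₁ g₂) 0 := by
  have h0 : HasDerivAt (fun t : ℝ => g₁.a + t) 1 0 := (hasDerivAt_id 0).const_add _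
  have h1 : HasDerivAt (fun t : ℝ => g₁.a + t - g₂.a) 1 0 := h0.sub_const _
  have h2 : HasDerivAt (fun t : ℝ => g₀.a - (g₁.a + t)) (-1) 0 := h0.const_sub _
  have c1 := h1.cosh
  have c2 := h2.cosh
  have s1 := (h1.const_mul 2).sinh
  have s2 := (h2.const_mul 2).sinh
  have h := ((((c1.mul_const (Real.cosh (g₂.a - g₀.a))).mul_const (Ω g₀.x g₁.x)).add
    ((c2.const_mul (Real.cosh (g₂.a - g₀.a))).mul_const (Ω g₁.x g₂.x))).add
    ((c2.mul c1).mul_const (Ω g₂.x g₀.x))).sub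
    (((s2.mul_const g₂.z).add (s1.mul_const g₀.z)).add_const
      (Real.sinh (2 * (g₂.a - g₀.a)) * g₁.z))
  refine (h.congr_deriv ?_).congr_of_eventuallyEq (Filter.Eventually.of_forall fun t => ?_)
  · simp only [phaseA, add_zero]
    ring
  · simp only [phase, SV, R0.add_a, R0.add_x, R0.add_z, R0.smul_a, R0.smul_x, R0.smul_z,
      R0.mk_a, R0.mk_x, R0.mk_z, mul_zero, mul_one, add_zero, smul_zero, map_smul,
      LinearMap.smul_apply, smul_eq_mul, Pi.add_apply, Pi.sub_apply, Pi.mul_apply]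
    ring

variable [FiniteDimensional ℝ V]

theorem continuous_oscIntegrand (κ : ℝ) {B : ℝ → ℝ → ℝ → ℝ} (hB : Amp B) {u v : R0 Ω → ℂ}
    (hu : Continuous u) (hv : Continuous v) (g₀ : R0 Ω) :
    Continuous (oscIntegrand κ B u v g₀) := by
  have h1 : Continuous fun p : R0 Ω × R0 Ω => phase g₀ p.1 p.2 :=
    Continuous.phase continuous_const continuous_fst continuous_snd
  have h2 : Continuous fun p : R0 Ω × R0 Ω => B g₀.a p.1.a p.2.a :=
    hB.continuous_comp continuous_const (by fun_prop) (by fun_prop)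
  exact ((Complex.continuous_ofReal.comp h2).mul
    (by fun_prop : Continuous fun p : R0 Ω × R0 Ω =>
      Complex.exp ((κ * phase g₀ p.1 p.2 : ℝ) * Complex.I))).mul
    ((hu.comp continuous_fst).mul (hv.comp continuous_snd))

theorem hasCompactSupport_oscIntegrand (κ : ℝ) (B : ℝ → ℝ → ℝ → ℝ) {u v : R0 Ω → ℂ}
    (hu : HasCompactSupport u) (hv : HasCompactSupport v) (g₀ : R0 Ω) :
    HasCompactSupport (oscIntegrand κ B u v g₀) := by
  refine HasCompactSupport.intro (hu.isCompact.prod hv.isCompact) fun p hp => ?_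
  rw [Set.mem_prod, not_and_or] at hp
  rcases hp with hp | hp <;> simp [oscIntegrand, image_eq_zero_of_notMem_tsupport hp]

variable [MeasurableSpace V] [BorelSpace V]

theorem integrable_mul_oscIntegrand (κ : ℝ) {B : ℝ → ℝ → ℝ → ℝ} (hB : Amp B) {u v : R0 Ω → ℂ}
    (hu : IsTest u) (hv : IsTest v) (g₀ : R0 Ω) {f : R0 Ω × R0 Ω → ℝ} (hf : Continuous f) :
    Integrable (fun p => (f p : ℂ) * oscIntegrand κ B u v g₀ p)
      ((haarR0 Ω).prod (haarR0 Ω)) := by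
  have h1 := continuous_oscIntegrand κ hB hu.1.continuous hv.1.continuous g₀
  exact (by fun_prop : Continuous _).integrable_of_hasCompactSupport
    (hasCompactSupport_oscIntegrand κ B hu.2 hv.2 g₀).mul_left

theorem integrable_oscIntegrand (κ : ℝ) {B : ℝ → ℝ → ℝ → ℝ} (hB : Amp B) {u v : R0 Ω → ℂ}
    (hu : IsTest u) (hv : IsTest v) (g₀ : R0 Ω) :
    Integrable (oscIntegrand κ B u v g₀) ((haarR0 Ω).prod (haarR0 Ω)) :=
  (continuous_oscIntegrand κ hB hu.1.continuous hv.1.continuous g₀).integrable_of_hasCompactSupport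
    (hasCompactSupport_oscIntegrand κ B hu.2 hv.2 g₀)

/-- The oscillatory integral with amplitude `B`. -/
def osc (κ : ℝ) (B : ℝ → ℝ → ℝ → ℝ) (u v : R0 Ω → ℂ) (g₀ : R0 Ω) : ℂ :=
  ∫ p, oscIntegrand κ B u v g₀ p ∂(haarR0 Ω).prod (haarR0 Ω)

variable [(haarR0 Ω).IsAddHaarMeasure]

/-- The integral of the derivative of the integrand along `(d, 0)` is zero. The derivative falls on
the exponential, giving `S'`; on the amplitude, which sees only the `a`-component of `d`; or on `u`.
-/
theorem osc_integration_by_parts {κ : ℝ} (hκ : κ ≠ 0) (d : R0 Ω) {B B' : ℝ → ℝ → ℝ → ℝ} (hB : Amp B)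
    (hB' : Amp B') (hd : ∀ a b c, HasDerivAt (fun t => B a t c) (B' a b c) b)
    {S' : R0 Ω → R0 Ω → R0 Ω → ℝ} (hSc : ∀ g₀, Continuous fun p : R0 Ω × R0 Ω => S' g₀ p.1 p.2)
    (hS : ∀ g₀ g₁ g₂, HasDerivAt (fun t : ℝ => phase g₀ (g₁ + t • d) g₂) (S' g₀ g₁ g₂) 0)
    {u v : R0 Ω → ℂ} (hu : IsTest u) (hv : IsTest v) (g₀ : R0 Ω) :
    ∫ p, (S' g₀ p.1 p.2 : ℂ) * oscIntegrand κ B u v g₀ p ∂(haarR0 Ω).prod (haarR0 Ω)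
      = Complex.I / κ * (d.a * osc κ B' u v g₀ + osc κ B (dirDeriv u d) v g₀) := by
  have i1 := integrable_mul_oscIntegrand κ hB hu hv g₀ (hSc g₀)
  have i2 := integrable_oscIntegrand κ hB' hu hv g₀
  have i3 := integrable_oscIntegrand κ hB (hu.dirDeriv d) hv g₀
  have hBt : ∀ a b c r : ℝ, HasDerivAt (fun t : ℝ => B a (b + t * r) c) (r * B' a b c) 0 := by
    intro a b c r
    have h1 : HasDerivAt (fun t : ℝ => b + t * r) r 0 := by
      simpa using ((hasDerivAt_id (0 : ℝ)).mul_const r).const_add b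
    have h2 : HasDerivAt (fun t : ℝ => B a (b + t * r) c) (r • B' a b c) 0 :=
      HasDerivAt.scomp (0 : ℝ) (g₁ := fun t => B a t c) (h := fun t : ℝ => b + t * r)
        (by simpa using hd a b c) h1
    simpa only [smul_eq_mul] using h2
  have hline : ∀ p : R0 Ω × R0 Ω, HasLineDerivAt ℝ (oscIntegrand κ B u v g₀)
      (d.a * oscIntegrand κ B' u v g₀ p + (κ * Complex.I) *
        ((S' g₀ p.1 p.2 : ℂ) * oscIntegrand κ B u v g₀ p)
        + oscIntegrand κ B (dirDeriv u d) v g₀ p) p (d, 0) := by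
    intro p
    have e1 : HasDerivAt (fun t : ℝ => (B g₀.a (p.1.a + t * d.a) p.2.a : ℂ))
        ((d.a * B' g₀.a p.1.a p.2.a : ℝ) : ℂ) 0 := (hBt _ _ _ _).ofReal_comp
    have e2 : HasDerivAt (fun t : ℝ => Complex.exp
        ((κ * phase g₀ (p.1 + t • d) p.2 : ℝ) * Complex.I))
        (Complex.exp ((κ * phase g₀ p.1 p.2 : ℝ) * Complex.I) *
          ((κ * S' g₀ p.1 p.2 : ℝ) * Complex.I)) 0 := by
      have := ((((hS g₀ p.1 p.2).const_mul κ).ofReal_comp).mul_const Complex.I).cexp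
      simpa using this
    have e3 := (hu.hasDerivAt d p.1).mul_const (v p.2)
    have e4 := (e1.mul e2).mul e3
    refine (e4.congr_deriv ?_).congr_of_eventuallyEq (Filter.Eventually.of_forall fun t => ?_)
    · simp only [oscIntegrand, zero_smul, add_zero, zero_mul]
      push_cast
      simp only [Pi.mul_apply, zero_smul, add_zero, zero_mul]
      ring
    · simp only [oscIntegrand, Prod.fst_add, Prod.snd_add, Prod.smul_fst, Prod.smul_snd, smul_zero,
        add_zero, R0.add_a, R0.smul_a, Pi.mul_apply]
  have hint := integral_lineDeriv_eq_zero (μ := (haarR0 Ω).prod (haarR0 Ω))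
    (integrable_oscIntegrand κ hB hu hv g₀)
    (((i2.const_mul (d.a : ℂ)).add (i1.const_mul (κ * Complex.I))).add i3) hline
  rw [integral_add' ((i2.const_mul (d.a : ℂ)).add (i1.const_mul (κ * Complex.I))) i3,
    integral_add' (i2.const_mul (d.a : ℂ)) (i1.const_mul (κ * Complex.I)), integral_const_mul,
    integral_const_mul] at hint
  have hκ' : (κ : ℂ) ≠ 0 := by exact_mod_cast hκ
  have h3 := congrArg (fun x => Complex.I / κ * x) hint
  simp only [mul_zero] at h3
  simp only [osc]
  have hI : Complex.I / κ * (κ * Complex.I) = -1 := by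
    field_simp
    exact Complex.I_sq
  linear_combination (-1 : ℂ) * h3 +
    hI * ∫ p, (S' g₀ p.1 p.2 : ℂ) * oscIntegrand κ B u v g₀ p ∂(haarR0 Ω).prod (haarR0 Ω)

end Oscillatory

/-! ### Stability of oscillatory integrals under multiplication by coordinates. -/

section Decay

variable {V : Type*} [NormedAddCommGroup V] [NormedSpace ℝ V] {Ω : V →ₗ[ℝ] V →ₗ[ℝ] ℝ}
  [FiniteDimensional ℝ V] [MeasurableSpace V] [BorelSpace V]

/-- The span of the oscillatory integrals. -/
def oscSpan (Ω : V →ₗ[ℝ] V →ₗ[ℝ] ℝ) (κ : ℝ) : Submodule ℂ (R0 Ω → ℂ) :=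
  Submodule.span ℂ {f | ∃ B u v, Amp B ∧ IsTest u ∧ IsTest v ∧ f = osc κ B u v}

theorem osc_mem {κ : ℝ} {B : ℝ → ℝ → ℝ → ℝ} {u v : R0 Ω → ℂ} (hB : Amp B) (hu : IsTest u)
    (hv : IsTest v) : osc κ B u v ∈ oscSpan Ω κ :=
  Submodule.subset_span ⟨B, u, v, hB, hu, hv, rfl⟩

theorem mul_mem_oscSpan {κ : ℝ} {m : R0 Ω → ℂ} (h : ∀ B u v, Amp B → IsTest u → IsTest v →
    m * osc κ B u v ∈ oscSpan Ω κ) {f : R0 Ω → ℂ} (hf : f ∈ oscSpan Ω κ) :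
    m * f ∈ oscSpan Ω κ := by
  induction hf using Submodule.span_induction with
  | mem f hf =>
    obtain ⟨B, u, v, hB, hu, hv, rfl⟩ := hf
    exact h B u v hB hu hv
  | zero => rw [mul_zero]; exact zero_mem _
  | add f g _ _ hf hg => rw [mul_add]; exact add_mem hf hg
  | smul c f _ hf => rw [mul_smul_comm]; exact Submodule.smul_mem _ _ hf

theorem IsTest.coord_mul {u : R0 Ω → ℂ} (hu : IsTest u) (l : V →ₗ[ℝ] ℝ) :
    IsTest fun g => (l g.x : ℂ) * u g :=
  hu.smooth_mul (l.toContinuousLinearMap.contDiff.comp R0.contDiff_x)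

theorem IsTest.z_mul {u : R0 Ω → ℂ} (hu : IsTest u) : IsTest fun g => (g.z : ℂ) * u g :=
  hu.smooth_mul R0.contDiff_z

variable [(haarR0 Ω).IsAddHaarMeasure] {κ : ℝ} {B : ℝ → ℝ → ℝ → ℝ} {u v : R0 Ω → ℂ}

theorem integral_phase_mem (hκ : κ ≠ 0) (d : R0 Ω) (hB : Amp B) {S' : R0 Ω → R0 Ω → R0 Ω → ℝ}
    (hSc : ∀ g₀, Continuous fun p : R0 Ω × R0 Ω => S' g₀ p.1 p.2)
    (hS : ∀ g₀ g₁ g₂, HasDerivAt (fun t : ℝ => phase g₀ (g₁ + t • d) g₂) (S' g₀ g₁ g₂) 0)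
    (hu : IsTest u) (hv : IsTest v) :
    (fun g₀ => ∫ p, (S' g₀ p.1 p.2 : ℂ) * oscIntegrand κ B u v g₀ p ∂(haarR0 Ω).prod (haarR0 Ω))
      ∈ oscSpan Ω κ := by
  obtain ⟨B', hB', hd⟩ := hB.exists_hasDerivAt
  have h : (fun g₀ => ∫ p, (S' g₀ p.1 p.2 : ℂ) * oscIntegrand κ B u v g₀ p
        ∂(haarR0 Ω).prod (haarR0 Ω))
      = (Complex.I / κ) • ((d.a : ℂ) • osc κ B' u v + osc κ B (dirDeriv u d) v) := by
    funext g₀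
    exact osc_integration_by_parts hκ d hB hB' hd hSc hS hu hv g₀
  rw [h]
  exact Submodule.smul_mem _ _ (add_mem (Submodule.smul_mem _ _ (osc_mem hB' hu hv))
    (osc_mem hB (hu.dirDeriv d) hv))

theorem continuous_phaseX (w : V) (g₀ : R0 Ω) :
    Continuous fun p : R0 Ω × R0 Ω => phaseX w g₀ p.1 p.2 := by
  unfold phaseX
  fun_prop

theorem continuous_phaseA (g₀ : R0 Ω) : Continuous fun p : R0 Ω × R0 Ω => phaseA g₀ p.1 p.2 := by
  unfold phaseA
  fun_prop

/-- The phase derivative `phaseX w` is affine in `Ω(x₀, w)` with a coefficient that is a product of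
`cosh`'s. Solving for `Ω(x₀, w)` leaves a phase derivative, removed by integration by parts, and a
term in `Ω(w, x₂)`, absorbed into `v`. -/
theorem form_mul_osc_mem (hκ : κ ≠ 0) (w : V) (hB : Amp B) (hu : IsTest u) (hv : IsTest v) :
    (fun g₀ : R0 Ω => (Ω g₀.x w : ℂ)) * osc κ B u v ∈ oscSpan Ω κ := by
  have hB₁ := (hB.mul (Amp.inv_cosh isLin_sub₁₂)).mul (Amp.inv_cosh isLin_sub₂₀)
  have hB₂ := (hB.mul (Amp.inv_cosh isLin_sub₁₂)).mul (Amp.cosh isLin_sub₀₁)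
  have hv' := hv.coord_mul (Ω w)
  have h : (fun g₀ : R0 Ω => (Ω g₀.x w : ℂ)) * osc κ B u v
      = (fun g₀ => ∫ p, (phaseX w g₀ p.1 p.2 : ℂ) * oscIntegrand κ
          (fun a b c => B a b c * (Real.cosh (b - c))⁻¹ * (Real.cosh (c - a))⁻¹) u v g₀ p
          ∂(haarR0 Ω).prod (haarR0 Ω))
        - osc κ (fun a b c => B a b c * (Real.cosh (b - c))⁻¹ * Real.cosh (a - b)) u
          (fun g => (Ω w g.x : ℂ) * v g) := by
    funext g₀
    rw [Pi.mul_apply, Pi.sub_apply, osc, osc, ← integral_const_mul, ← integral_sub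
      (integrable_mul_oscIntegrand κ hB₁ hu hv g₀ (continuous_phaseX w g₀))
      (integrable_oscIntegrand κ hB₂ hu hv' g₀)]
    refine integral_congr_ae (Filter.Eventually.of_forall fun p => ?_)
    have h1 : (Real.cosh (p.1.a - p.2.a) : ℂ) ≠ 0 := by exact_mod_cast (Real.cosh_pos _).ne'
    have h2 : (Real.cosh (p.2.a - g₀.a) : ℂ) ≠ 0 := by exact_mod_cast (Real.cosh_pos _).ne'
    simp only [oscIntegrand, phaseX, Complex.ofReal_mul, Complex.ofReal_add, Complex.ofReal_inv]
    field_simp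
    ring
  rw [h]
  exact sub_mem (integral_phase_mem hκ _ hB₁ (continuous_phaseX w) (hasDerivAt_phase_x w) hu hv)
    (osc_mem hB₂ hu hv')

theorem form_mul_mem (hκ : κ ≠ 0) (w : V) {f : R0 Ω → ℂ} (hf : f ∈ oscSpan Ω κ) :
    (fun g₀ : R0 Ω => (Ω g₀.x w : ℂ)) * f ∈ oscSpan Ω κ :=
  mul_mem_oscSpan (fun _ _ _ hB hu hv => form_mul_osc_mem hκ w hB hu hv) hf

theorem apply_eq_sum_coord (l : V →ₗ[ℝ] ℝ) (x : V) :
    l x = ∑ j, (Module.finBasis ℝ V).coord j x * l (Module.finBasis ℝ V j) := by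
  conv_lhs => rw [← (Module.finBasis ℝ V).sum_repr x, map_sum]
  simp

/-- Expanding `x₁` in a basis moves its coordinates into `u` and leaves the factors `Ω(x₀, bⱼ)`,
covered by `form_mul_osc_mem`. -/
theorem integral_form₀₁_mem (hκ : κ ≠ 0) (hB : Amp B) (hu : IsTest u) (hv : IsTest v) :
    (fun g₀ => ∫ p, (Ω g₀.x p.1.x : ℂ) * oscIntegrand κ B u v g₀ p ∂(haarR0 Ω).prod (haarR0 Ω))
      ∈ oscSpan Ω κ := by
  let b := Module.finBasis ℝ V
  have h : (fun g₀ => ∫ p, (Ω g₀.x p.1.x : ℂ) * oscIntegrand κ B u v g₀ p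
        ∂(haarR0 Ω).prod (haarR0 Ω))
      = ∑ j, (fun g₀ : R0 Ω => (Ω g₀.x (b j) : ℂ)) *
        osc κ B (fun g => (b.coord j g.x : ℂ) * u g) v := by
    funext g₀
    simp only [Finset.sum_apply, Pi.mul_apply, osc, ← integral_const_mul]
    rw [← integral_finsetSum _ fun j _ =>
      (integrable_oscIntegrand κ hB (hu.coord_mul (b.coord j)) hv g₀).const_mul _]
    refine integral_congr_ae (Filter.Eventually.of_forall fun p => ?_)
    simp only [oscIntegrand]
    rw [apply_eq_sum_coord (Ω g₀.x) p.1.x, Complex.ofReal_sum, Finset.sum_mul]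
    refine Finset.sum_congr rfl fun j _ => ?_
    push_cast
    ring
  rw [h]
  exact Submodule.sum_mem _ fun j _ => form_mul_osc_mem hκ _ hB (hu.coord_mul _) hv

theorem integral_form₂₀_mem (hΩ : Ω.IsAlt) (hκ : κ ≠ 0) (hB : Amp B) (hu : IsTest u)
    (hv : IsTest v) :
    (fun g₀ => ∫ p, (Ω p.2.x g₀.x : ℂ) * oscIntegrand κ B u v g₀ p ∂(haarR0 Ω).prod (haarR0 Ω))
      ∈ oscSpan Ω κ := by
  let b := Module.finBasis ℝ V
  have h : (fun g₀ => ∫ p, (Ω p.2.x g₀.x : ℂ) * oscIntegrand κ B u v g₀ p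
        ∂(haarR0 Ω).prod (haarR0 Ω))
      = -∑ j, (fun g₀ : R0 Ω => (Ω g₀.x (b j) : ℂ)) *
        osc κ B u (fun g => (b.coord j g.x : ℂ) * v g) := by
    funext g₀
    simp only [Pi.neg_apply, Finset.sum_apply, Pi.mul_apply, osc, ← integral_const_mul]
    rw [← integral_finsetSum _ fun j _ =>
      (integrable_oscIntegrand κ hB hu (hv.coord_mul (b.coord j)) g₀).const_mul _, ← integral_neg]
    refine integral_congr_ae (Filter.Eventually.of_forall fun p => ?_)
    simp only [oscIntegrand]
    rw [← hΩ.neg, apply_eq_sum_coord (Ω g₀.x) p.2.x, Complex.ofReal_neg, Complex.ofReal_sum,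
      neg_mul, Finset.sum_mul]
    congr 1
    refine Finset.sum_congr rfl fun j _ => ?_
    push_cast
    ring
  rw [h]
  exact neg_mem (Submodule.sum_mem _ fun j _ => form_mul_osc_mem hκ _ hB hu (hv.coord_mul _))

theorem integral_form₁₂_mem (hB : Amp B) (hu : IsTest u) (hv : IsTest v) :
    (fun g₀ => ∫ p, (Ω p.1.x p.2.x : ℂ) * oscIntegrand κ B u v g₀ p ∂(haarR0 Ω).prod (haarR0 Ω))
      ∈ oscSpan Ω κ := by
  let b := Module.finBasis ℝ V
  have h : (fun g₀ => ∫ p, (Ω p.1.x p.2.x : ℂ) * oscIntegrand κ B u v g₀ p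
        ∂(haarR0 Ω).prod (haarR0 Ω))
      = ∑ j, osc κ B (fun g => (b.coord j g.x : ℂ) * u g) (fun g => (Ω (b j) g.x : ℂ) * v g) := by
    funext g₀
    simp only [Finset.sum_apply, osc]
    rw [← integral_finsetSum _ fun j _ =>
      integrable_oscIntegrand κ hB (hu.coord_mul (b.coord j)) (hv.coord_mul (Ω (b j))) g₀]
    refine integral_congr_ae (Filter.Eventually.of_forall fun p => ?_)
    simp only [oscIntegrand]
    have h1 := apply_eq_sum_coord (Ω.flip p.2.x) p.1.x
    simp only [LinearMap.flip_apply] at h1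
    rw [h1, Complex.ofReal_sum, Finset.sum_mul]
    refine Finset.sum_congr rfl fun j _ => ?_
    push_cast
    ring
  rw [h]
  exact Submodule.sum_mem _ fun j _ => osc_mem hB (hu.coord_mul _) (hv.coord_mul _)

/-- The derivative `phaseA` contains `z₀` with coefficient `-2 cosh (2 (a₁ - a₂))`, which never
vanishes. Solving for `z₀` leaves that derivative, terms in the values of `Ω` on pairs of the `x`'s,
and a term in `z₂` that is absorbed into `v`. -/
theorem z_mul_osc_mem (hΩ : Ω.IsAlt) (hκ : κ ≠ 0) (hB : Amp B) (hu : IsTest u) (hv : IsTest v) :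
    (fun g₀ : R0 Ω => (g₀.z : ℂ)) * osc κ B u v ∈ oscSpan Ω κ := by
  have hB₁ := hB.mul ((Amp.const (1 / 2)).mul (Amp.inv_cosh (isLin_sub₁₂.const_mul 2)))
  have k₁ := hB₁.mul ((Amp.sinh isLin_sub₁₂).mul (Amp.cosh isLin_sub₂₀))
  have k₂ := hB₁.mul ((Amp.cosh isLin_sub₂₀).mul (Amp.sinh isLin_sub₀₁))
  have k₃ := hB₁.mul (((Amp.cosh isLin_sub₀₁).mul (Amp.sinh isLin_sub₁₂)).add
    ((Amp.const (-1)).mul ((Amp.sinh isLin_sub₀₁).mul (Amp.cosh isLin_sub₁₂))))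
  have k₄ := hB₁.mul ((Amp.const 2).mul (Amp.cosh (isLin_sub₀₁.const_mul 2)))
  have h : (fun g₀ : R0 Ω => (g₀.z : ℂ)) * osc κ B u v
      = (fun g₀ => ∫ p, (Ω g₀.x p.1.x : ℂ) * oscIntegrand κ
          (fun a b c => B a b c * (1 / 2 * (Real.cosh (2 * (b - c)))⁻¹)
            * (Real.sinh (b - c) * Real.cosh (c - a))) u v g₀ p
          ∂(haarR0 Ω).prod (haarR0 Ω))
      - (fun g₀ => ∫ p, (Ω p.1.x p.2.x : ℂ) * oscIntegrand κ
          (fun a b c => B a b c * (1 / 2 * (Real.cosh (2 * (b - c)))⁻¹)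
            * (Real.cosh (c - a) * Real.sinh (a - b))) u v g₀ p
          ∂(haarR0 Ω).prod (haarR0 Ω))
      + (fun g₀ => ∫ p, (Ω p.2.x g₀.x : ℂ) * oscIntegrand κ
          (fun a b c => B a b c * (1 / 2 * (Real.cosh (2 * (b - c)))⁻¹)
            * (Real.cosh (a - b) * Real.sinh (b - c)
              + -1 * (Real.sinh (a - b) * Real.cosh (b - c)))) u v g₀ p
          ∂(haarR0 Ω).prod (haarR0 Ω))
      + osc κ (fun a b c => B a b c * (1 / 2 * (Real.cosh (2 * (b - c)))⁻¹)
            * (2 * Real.cosh (2 * (a - b)))) u (fun g => (g.z : ℂ) * v g)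
      - (fun g₀ => ∫ p, (phaseA g₀ p.1 p.2 : ℂ) * oscIntegrand κ
          (fun a b c => B a b c * (1 / 2 * (Real.cosh (2 * (b - c)))⁻¹)) u v g₀ p
          ∂(haarR0 Ω).prod (haarR0 Ω)) := by
    funext g₀
    simp only [Pi.mul_apply, Pi.sub_apply, Pi.add_apply, osc]
    have i₁ := integrable_mul_oscIntegrand κ k₁ hu hv g₀ (f := fun p => Ω g₀.x p.1.x) (by fun_prop)
    have i₂ := integrable_mul_oscIntegrand κ k₂ hu hv g₀ (f := fun p => Ω p.1.x p.2.x) (by fun_prop)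
    have i₃ := integrable_mul_oscIntegrand κ k₃ hu hv g₀ (f := fun p => Ω p.2.x g₀.x) (by fun_prop)
    have i₄ := integrable_oscIntegrand κ k₄ hu hv.z_mul g₀
    have i₅ := integrable_mul_oscIntegrand κ hB₁ hu hv g₀ (continuous_phaseA g₀)
    rw [← integral_const_mul, ← integral_sub' i₁ i₂, ← integral_add' (i₁.sub i₂) i₃,
      ← integral_add' ((i₁.sub i₂).add i₃) i₄, ← integral_sub' (((i₁.sub i₂).add i₃).add i₄) i₅]
    refine integral_congr_ae (Filter.Eventually.of_forall fun p => ?_)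
    have h1 : (Real.cosh (2 * (p.1.a - p.2.a)) : ℂ) ≠ 0 := by exact_mod_cast (Real.cosh_pos _).ne'
    simp only [oscIntegrand, phaseA, Complex.ofReal_mul, Complex.ofReal_add, Complex.ofReal_inv,
      Complex.ofReal_sub, Complex.ofReal_div, Complex.ofReal_one, Complex.ofReal_ofNat,
      Complex.ofReal_neg, Pi.add_apply, Pi.sub_apply]
    field_simp
    ring
  rw [h]
  exact sub_mem (add_mem (add_mem (sub_mem (integral_form₀₁_mem hκ k₁ hu hv)
    (integral_form₁₂_mem k₂ hu hv)) (integral_form₂₀_mem hΩ hκ k₃ hu hv))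
    (osc_mem k₄ hu hv.z_mul))
    (integral_phase_mem hκ _ hB₁ continuous_phaseA hasDerivAt_phase_a hu hv)

theorem z_mul_mem (hΩ : Ω.IsAlt) (hκ : κ ≠ 0) {f : R0 Ω → ℂ} (hf : f ∈ oscSpan Ω κ) :
    (fun g₀ : R0 Ω => (g₀.z : ℂ)) * f ∈ oscSpan Ω κ :=
  mul_mem_oscSpan (fun _ _ _ hB hu hv => z_mul_osc_mem hΩ hκ hB hu hv) hf

theorem osc_sinh_mul (hκ : κ ≠ 0) (hB : Amp B) (hu : IsTest u) (hv : IsTest v) :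
    osc κ (fun a b c => B a b c * Real.sinh (2 * (c - a))) u v
      = (-(Complex.I / κ)) • osc κ B (dirDeriv u (R0.mk 0 0 1)) v := by
  funext g₀
  -- Any derivative of the amplitude may be supplied here, because it is multiplied by the zero
  -- `a`-component of the direction.
  have h := osc_integration_by_parts hκ (R0.mk 0 0 1 : R0 Ω) hB
    hB.exists_hasDerivAt.choose_spec.1 hB.exists_hasDerivAt.choose_spec.2
    (S' := fun g₀ _ g₂ => -Real.sinh (2 * (g₂.a - g₀.a))) (fun g₀ => by fun_prop)
    hasDerivAt_phase_z hu hv g₀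
  rw [R0.mk_a, Complex.ofReal_zero, zero_mul, zero_add] at h
  rw [Pi.smul_apply, smul_eq_mul, neg_mul, ← h, ← integral_neg, osc]
  refine integral_congr_ae (Filter.Eventually.of_forall fun p => ?_)
  simp only [oscIntegrand]
  push_cast
  ring

/-- Insert `1 = cosh⁻² (1 + sinh²)` with argument `2 (a₂ - a₀)`, and trade each `sinh` for a
`z`-derivative of `u` by `osc_sinh_mul`. Every round gains a factor `cosh⁻²`, and this is what
yields decay in `a₀`. -/
theorem exists_osc_eq (hκ : κ ≠ 0) (hB : Amp B) (hu : IsTest u) (hv : IsTest v) (n : ℕ) :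
    ∃ u', IsTest u' ∧ osc κ B u v
      = osc κ (fun a b c => B a b c * ((Real.cosh (2 * (c - a)))⁻¹ ^ 2) ^ n) u' v := by
  induction n with
  | zero => exact ⟨u, hu, by simp⟩
  | succ n ih =>
    obtain ⟨u', hu', h⟩ := ih
    have hi := (Amp.inv_cosh (isLin_sub₂₀.const_mul 2)).pow 2
    have hBn := hB.mul (hi.pow n)
    have hB' := hB.mul (hi.pow (n + 1))
    have hs := Amp.sinh (isLin_sub₂₀.const_mul 2)
    have hz := hu'.dirDeriv (R0.mk 0 0 1)
    let u'' : R0 Ω → ℂ := u' + (-(Complex.I / κ)) • ((-(Complex.I / κ)) •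
      dirDeriv (dirDeriv u' (R0.mk 0 0 1)) (R0.mk 0 0 1))
    have hu'' : IsTest u'' := hu'.add (((hz.dirDeriv _).smul _).smul _)
    refine ⟨u'', hu'', ?_⟩
    have h1 := osc_sinh_mul hκ (hB'.mul hs) hu' hv
    rw [osc_sinh_mul hκ hB' hz hv] at h1
    rw [h]
    funext g₀
    have h2 := congrFun h1 g₀
    have j₁ := integrable_oscIntegrand κ hB' hu' hv g₀
    have j₂ := integrable_oscIntegrand κ ((hB'.mul hs).mul hs) hu' hv g₀
    have j₃ := integrable_oscIntegrand κ hB' (hz.dirDeriv (R0.mk 0 0 1)) hv g₀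
    have h3 : osc κ (fun a b c => B a b c * ((Real.cosh (2 * (c - a)))⁻¹ ^ 2) ^ n) u' v g₀
        = osc κ (fun a b c => B a b c * ((Real.cosh (2 * (c - a)))⁻¹ ^ 2) ^ (n + 1)) u' v g₀
        + osc κ (fun a b c => B a b c * ((Real.cosh (2 * (c - a)))⁻¹ ^ 2) ^ (n + 1)
            * Real.sinh (2 * (c - a)) * Real.sinh (2 * (c - a))) u' v g₀ := by
      rw [osc, osc, osc, ← integral_add j₁ j₂]
      refine integral_congr_ae (Filter.Eventually.of_forall fun p => ?_)
      have hc : (Real.cosh (2 * (p.2.a - g₀.a)) : ℂ) ≠ 0 := by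
        exact_mod_cast (Real.cosh_pos _).ne'
      have hcs : (Real.cosh (2 * (p.2.a - g₀.a)) : ℂ) ^ 2
          = 1 + (Real.sinh (2 * (p.2.a - g₀.a)) : ℂ) ^ 2 := by
        exact_mod_cast (by rw [Real.cosh_sq]; ring : Real.cosh (2 * (p.2.a - g₀.a)) ^ 2 = 1 + _)
      have hcs' : ((Real.cosh (2 * (p.2.a - g₀.a)) : ℂ)⁻¹ ^ 2) *
          (1 + (Real.sinh (2 * (p.2.a - g₀.a)) : ℂ) ^ 2) = 1 := by
        rw [← hcs, ← mul_pow, inv_mul_cancel₀ hc, one_pow]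
      simp only [oscIntegrand]
      generalize Complex.exp (((κ * phase g₀ p.1 p.2 : ℝ) : ℂ) * Complex.I) = w
      simp only [Complex.ofReal_mul, Complex.ofReal_inv, Complex.ofReal_pow, pow_succ _ n]
      generalize (Real.cosh (2 * (p.2.a - g₀.a)) : ℂ)⁻¹ ^ 2 = y at *
      linear_combination (-((B g₀.a p.1.a p.2.a : ℂ) * y ^ n * w * (u' p.1 * v p.2))) * hcs'
    have h4 : osc κ (fun a b c => B a b c * ((Real.cosh (2 * (c - a)))⁻¹ ^ 2) ^ (n + 1)) u'' v g₀
        = osc κ (fun a b c => B a b c * ((Real.cosh (2 * (c - a)))⁻¹ ^ 2) ^ (n + 1)) u' v g₀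
        + (-(Complex.I / κ)) * ((-(Complex.I / κ)) *
          osc κ (fun a b c => B a b c * ((Real.cosh (2 * (c - a)))⁻¹ ^ 2) ^ (n + 1))
            (dirDeriv (dirDeriv u' (R0.mk 0 0 1)) (R0.mk 0 0 1)) v g₀) := by
      rw [osc, osc, osc, ← integral_const_mul, ← integral_const_mul,
        ← integral_add j₁ ((j₃.const_mul _).const_mul _)]
      refine integral_congr_ae (Filter.Eventually.of_forall fun p => ?_)
      simp only [oscIntegrand, u'', Pi.add_apply, Pi.smul_apply, smul_eq_mul]
      ring
    rw [h3, h4, h2]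
    rfl

end Decay

theorem inv_cosh_le (x : ℝ) : (Real.cosh x)⁻¹ ≤ 2 * Real.exp (-|x|) := by
  have h : Real.exp |x| / 2 ≤ Real.cosh x := by
    rw [← Real.cosh_abs, Real.cosh_eq]
    linarith [Real.exp_pos (-|x|)]
  refine (inv_anti₀ (by positivity) h).trans (le_of_eq ?_)
  rw [Real.exp_neg]
  field_simp

/-! ### Rapid decay and integrability of the product. -/

section Decay

variable {V : Type*} [NormedAddCommGroup V] [NormedSpace ℝ V] {Ω : V →ₗ[ℝ] V →ₗ[ℝ] ℝ}
  [FiniteDimensional ℝ V] [MeasurableSpace V] [BorelSpace V]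

theorem norm_osc_le {κ : ℝ} {B : ℝ → ℝ → ℝ → ℝ} {u v : R0 Ω → ℂ} (hu : IsTest u) (hv : IsTest v)
    {φ : ℝ → ℝ} {K : ℝ} (hφ : ∀ a b c, |B a b c| ≤ φ a * Real.exp (K * (|b| + |c|))) :
    ∃ C, ∀ g₀, ‖osc κ B u v g₀‖ ≤ C * φ g₀.a := by
  let H : R0 Ω × R0 Ω → ℝ := fun p => Real.exp (K * (|p.1.a| + |p.2.a|)) * (‖u p.1‖ * ‖v p.2‖)
  have hHc : Continuous H := by
    have h1 := hu.1.continuous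
    have h2 := hv.1.continuous
    fun_prop
  have hHs : HasCompactSupport H := by
    refine HasCompactSupport.intro (hu.2.isCompact.prod hv.2.isCompact) fun p hp => ?_
    rw [Set.mem_prod, not_and_or] at hp
    rcases hp with hp | hp <;> simp [H, image_eq_zero_of_notMem_tsupport hp]
  have hHi : Integrable H ((haarR0 Ω).prod (haarR0 Ω)) := hHc.integrable_of_hasCompactSupport hHs
  refine ⟨∫ p, H p ∂(haarR0 Ω).prod (haarR0 Ω), fun g₀ => ?_⟩
  rw [mul_comm, ← integral_const_mul]
  refine norm_integral_le_of_norm_le (hHi.const_mul _) (Filter.Eventually.of_forall fun p => ?_)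
  rw [oscIntegrand, norm_mul, norm_mul, norm_mul, Complex.norm_exp_ofReal_mul_I, mul_one,
    Complex.norm_real, Real.norm_eq_abs]
  simp only [H, ← mul_assoc]
  gcongr
  exact hφ _ _ _

variable [(haarR0 Ω).IsAddHaarMeasure] {κ : ℝ}

/-- The amplitude grows at most exponentially in `|a₀|`, and `exists_osc_eq` supplies factors
`cosh⁻¹ (2 (a₂ - a₀))` in any number. Since `a₁` and `a₂` range over compact sets, these beat the
growth. -/
theorem exists_norm_osc_le (hκ : κ ≠ 0) {B : ℝ → ℝ → ℝ → ℝ} {u v : R0 Ω → ℂ} (hB : Amp B)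
    (hu : IsTest u) (hv : IsTest v) (N : ℝ) :
    ∃ C, ∀ g₀, ‖osc κ B u v g₀‖ ≤ C * Real.exp (-(N * |g₀.a|)) := by
  obtain ⟨C, K, hC, hK, hb⟩ := hB.exists_bound
  -- The gain `exp (-4 n |a₂ - a₀|)` has to overcome the growth rate `K` and still leave the rate
  -- `N`.
  obtain ⟨n, hn⟩ := exists_nat_ge (K + N)
  obtain ⟨u', hu', h⟩ := exists_osc_eq hκ hB hu hv n
  rw [h]
  have hn0 : (0 : ℝ) ≤ n := Nat.cast_nonneg n
  obtain ⟨C', hC'⟩ := norm_osc_le (κ := κ)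
    (B := fun a b c => B a b c * ((Real.cosh (2 * (c - a)))⁻¹ ^ 2) ^ n) hu' hv
    (φ := fun a => C * 2 ^ (2 * n) * Real.exp (-(N * |a|))) (K := K + 4 * n) fun a b c => by
    have h1 : ((Real.cosh (2 * (c - a)))⁻¹ ^ 2) ^ n
        ≤ 2 ^ (2 * n) * Real.exp (-(4 * n * |c - a|)) := by
      rw [← pow_mul]
      refine (pow_le_pow_left₀ (by positivity) (inv_cosh_le _) _).trans (le_of_eq ?_)
      rw [mul_pow, ← Real.exp_nat_mul, abs_mul, abs_two]
      push_cast
      congr 2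
      ring
    rw [abs_mul, abs_of_nonneg (by positivity : 0 ≤ ((Real.cosh (2 * (c - a)))⁻¹ ^ 2) ^ n)]
    refine (mul_le_mul (hb a b c) h1 (by positivity) (by positivity)).trans ?_
    have h2 : C * Real.exp (K * (|a| + |b| + |c|)) * (2 ^ (2 * n) * Real.exp (-(4 * n * |c - a|)))
        = C * 2 ^ (2 * n) * Real.exp (K * (|a| + |b| + |c|) + -(4 * n * |c - a|)) := by
      rw [Real.exp_add]; ring
    rw [h2, mul_assoc (C * 2 ^ (2 * n)), ← Real.exp_add]
    refine mul_le_mul_of_nonneg_left (Real.exp_le_exp.2 ?_) (by positivity)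
    have h3 : |a| - |c| ≤ |c - a| := by
      rw [abs_sub_comm]; exact abs_sub_abs_le_abs_sub a c
    have h4 := mul_le_mul_of_nonneg_left h3 hn0
    have h5 := mul_le_mul_of_nonneg_right hn (abs_nonneg a)
    have h6 := mul_nonneg hn0 (abs_nonneg a)
    have h7 := mul_nonneg hn0 (abs_nonneg b)
    nlinarith
  exact ⟨C' * (C * 2 ^ (2 * n)), fun g₀ => (hC' g₀).trans (le_of_eq (by ring))⟩

theorem exists_norm_le_of_mem_oscSpan (hκ : κ ≠ 0) {f : R0 Ω → ℂ} (hf : f ∈ oscSpan Ω κ) (N : ℝ) :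
    ∃ C, ∀ g₀, ‖f g₀‖ ≤ C * Real.exp (-(N * |g₀.a|)) := by
  induction hf using Submodule.span_induction with
  | mem f hf =>
    obtain ⟨B, u, v, hB, hu, hv, rfl⟩ := hf
    exact exists_norm_osc_le hκ hB hu hv N
  | zero => exact ⟨0, fun g₀ => by simp⟩
  | add f g _ _ hf hg =>
    obtain ⟨C, hC⟩ := hf
    obtain ⟨C', hC'⟩ := hg
    exact ⟨C + C', fun g₀ => (norm_add_le _ _).trans (by linarith [hC g₀, hC' g₀])⟩
  | smul c f _ hf =>
    obtain ⟨C, hC⟩ := hf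
    refine ⟨‖c‖ * C, fun g₀ => ?_⟩
    rw [Pi.smul_apply, norm_smul, mul_assoc]
    gcongr
    exact hC g₀

/-- A quadratic weight. -/
def weight (g : R0 Ω) : ℝ :=
  (1 + ∑ j, Ω g.x (Module.finBasis ℝ V j) ^ 2) * (1 + g.z ^ 2)

theorem weight_mul_mem (hΩ : Ω.IsAlt) (hκ : κ ≠ 0) {f : R0 Ω → ℂ} (hf : f ∈ oscSpan Ω κ) :
    (fun g => (weight g : ℂ)) * f ∈ oscSpan Ω κ := by
  have h1 : ∀ {f : R0 Ω → ℂ}, f ∈ oscSpan Ω κ →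
      (fun g : R0 Ω => ((1 + g.z ^ 2 : ℝ) : ℂ)) * f ∈ oscSpan Ω κ := by
    intro f hf
    have : (fun g : R0 Ω => ((1 + g.z ^ 2 : ℝ) : ℂ)) * f
        = f + (fun g : R0 Ω => (g.z : ℂ)) * ((fun g : R0 Ω => (g.z : ℂ)) * f) := by
      funext g
      simp only [Pi.mul_apply, Pi.add_apply]
      push_cast
      ring
    rw [this]
    exact add_mem hf (z_mul_mem hΩ hκ (z_mul_mem hΩ hκ hf))
  have h2 : (fun g : R0 Ω => ((1 + ∑ j, Ω g.x (Module.finBasis ℝ V j) ^ 2 : ℝ) : ℂ)) * f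
      ∈ oscSpan Ω κ := by
    have : (fun g : R0 Ω => ((1 + ∑ j, Ω g.x (Module.finBasis ℝ V j) ^ 2 : ℝ) : ℂ)) * f
        = f + ∑ j, (fun g : R0 Ω => (Ω g.x (Module.finBasis ℝ V j) : ℂ)) *
          ((fun g : R0 Ω => (Ω g.x (Module.finBasis ℝ V j) : ℂ)) * f) := by
      funext g
      simp only [Pi.mul_apply, Pi.add_apply, Finset.sum_apply]
      push_cast
      rw [add_mul, one_mul, Finset.sum_mul]
      congr 1
      exact Finset.sum_congr rfl fun j _ => by ring
    rw [this]
    exact add_mem hf (Submodule.sum_mem _ fun j _ => form_mul_mem hκ _ (form_mul_mem hκ _ hf))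
  have h3 := h1 h2
  refine (congrArg (· ∈ oscSpan Ω κ) ?_).mp h3
  funext g
  simp only [Pi.mul_apply, weight]
  push_cast
  ring

/-- By nondegeneracy the numbers `Ω(x, bⱼ)` determine `x` linearly, so in finite dimension they
bound its norm. The exponential handles the coordinate `a`, which the weight does not see. -/
theorem one_add_norm_sq_le_weight (hΩ' : Ω.Nondegenerate) :
    ∃ C : ℝ, 0 ≤ C ∧ ∀ g : R0 Ω, (1 + ‖g‖) ^ 2 ≤ C * (Real.exp (2 * |g.a|) * weight g) := by
  let L : V →ₗ[ℝ] (Fin (Module.finrank ℝ V) → ℝ) :=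
    LinearMap.pi fun j => Ω.flip (Module.finBasis ℝ V j)
  have hL : LinearMap.ker L = ⊥ := by
    rw [LinearMap.ker_eq_bot']
    intro x hx
    refine hΩ'.1 x fun y => ?_
    have h0 : Ω x = 0 := (Module.finBasis ℝ V).ext fun j => by
      simpa [L] using congrFun hx j
    rw [h0, LinearMap.zero_apply]
  obtain ⟨K, -, hK⟩ := L.exists_antilipschitzWith hL
  refine ⟨4 * (1 + K ^ 2), by positivity, fun g => ?_⟩
  let q : ℝ := ∑ j, Ω g.x (Module.finBasis ℝ V j) ^ 2
  have hq : 0 ≤ q := Finset.sum_nonneg fun j _ => sq_nonneg _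
  have hx : ‖g.x‖ ^ 2 ≤ K ^ 2 * q := by
    have h1 : ‖g.x‖ ≤ K * ‖L g.x‖ := by
      simpa using hK.le_mul_norm_sub g.x 0
    have h2 : ‖L g.x‖ ≤ Real.sqrt q := by
      refine (pi_norm_le_iff_of_nonneg (Real.sqrt_nonneg _)).2 fun j => ?_
      refine Real.le_sqrt_of_sq_le ?_
      rw [Real.norm_eq_abs, sq_abs]
      exact Finset.single_le_sum (f := fun j => Ω g.x (Module.finBasis ℝ V j) ^ 2)
        (fun j _ => sq_nonneg _) (Finset.mem_univ j)
    calc ‖g.x‖ ^ 2 ≤ (K * Real.sqrt q) ^ 2 := by gcongr; exact h1.trans (by gcongr)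
      _ = K ^ 2 * q := by rw [mul_pow, Real.sq_sqrt hq]
  have hn : ‖g‖ = max |g.a| (max ‖g.x‖ |g.z|) := rfl
  have h1 : 1 + ‖g‖ ≤ (1 + |g.a|) * ((1 + ‖g.x‖) * (1 + |g.z|)) := by
    have ha := abs_nonneg g.a
    have hz := abs_nonneg g.z
    have hx0 := norm_nonneg g.x
    have p1 := mul_nonneg ha hz
    have p2 := mul_nonneg ha hx0
    have p3 := mul_nonneg hx0 hz
    have p4 := mul_nonneg ha p3
    rw [hn]
    rcases max_choice |g.a| (max ‖g.x‖ |g.z|) with h | h <;> rw [h]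
    · nlinarith
    · rcases max_choice ‖g.x‖ |g.z| with h | h <;> rw [h] <;> nlinarith
  have ha2 : (1 + |g.a|) ^ 2 ≤ Real.exp (2 * |g.a|) := by
    have : Real.exp (2 * |g.a|) = Real.exp |g.a| ^ 2 := by
      rw [← Real.exp_nat_mul]; norm_num
    rw [this]
    gcongr
    linarith [Real.add_one_le_exp |g.a|]
  have hx2 : (1 + ‖g.x‖) ^ 2 ≤ 2 * (1 + K ^ 2) * (1 + q) := by
    have := sq_nonneg (1 - ‖g.x‖)
    have hk : (0 : ℝ) ≤ K ^ 2 := by positivity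
    nlinarith
  have hz2 : (1 + |g.z|) ^ 2 ≤ 2 * (1 + g.z ^ 2) := by
    have := sq_nonneg (1 - |g.z|)
    have h := sq_abs g.z
    nlinarith
  calc (1 + ‖g‖) ^ 2 ≤ ((1 + |g.a|) * ((1 + ‖g.x‖) * (1 + |g.z|))) ^ 2 := by gcongr
    _ = (1 + |g.a|) ^ 2 * ((1 + ‖g.x‖) ^ 2 * (1 + |g.z|) ^ 2) := by ring
    _ ≤ Real.exp (2 * |g.a|) * ((2 * (1 + K ^ 2) * (1 + q)) * (2 * (1 + g.z ^ 2))) := by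
        gcongr
    _ = 4 * (1 + K ^ 2) * (Real.exp (2 * |g.a|) * weight g) := by
        simp only [weight, q]; ring

theorem exists_polynomial_decay (hΩ : Ω.IsAlt) (hΩ' : Ω.Nondegenerate) (hκ : κ ≠ 0)
    {f : R0 Ω → ℂ} (hf : f ∈ oscSpan Ω κ) (k : ℕ) :
    ∃ C, ∀ g, (1 + ‖g‖) ^ (2 * k) * ‖f g‖ ≤ C := by
  obtain ⟨D, hD, hw⟩ := one_add_norm_sq_le_weight hΩ'
  have hmem : ∀ k : ℕ, (fun g => (weight g : ℂ) ^ k) * f ∈ oscSpan Ω κ := by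
    intro k
    induction k with
    | zero =>
      refine (congrArg (· ∈ oscSpan Ω κ) ?_).mp hf
      funext g
      simp
    | succ k ih =>
      refine (congrArg (· ∈ oscSpan Ω κ) ?_).mp (weight_mul_mem hΩ hκ ih)
      funext g
      simp only [Pi.mul_apply]
      ring
  -- The decay rate `2 k` in `|a|` exactly compensates the `k`-th power of `exp (2 |a|)` from the
  -- weight estimate.
  obtain ⟨C, hC⟩ := exists_norm_le_of_mem_oscSpan hκ (hmem k) (2 * k)
  refine ⟨D ^ k * C, fun g => ?_⟩
  have hw0 : 0 ≤ weight g := by unfold weight; positivity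
  have h1 := hC g
  rw [Pi.mul_apply, norm_mul, norm_pow, Complex.norm_real, Real.norm_of_nonneg hw0] at h1
  calc (1 + ‖g‖) ^ (2 * k) * ‖f g‖ = ((1 + ‖g‖) ^ 2) ^ k * ‖f g‖ := by rw [pow_mul]
    _ ≤ (D * (Real.exp (2 * |g.a|) * weight g)) ^ k * ‖f g‖ := by
        gcongr
        exact hw g
    _ = D ^ k * Real.exp (2 * |g.a|) ^ k * (weight g ^ k * ‖f g‖) := by ring
    _ ≤ D ^ k * Real.exp (2 * |g.a|) ^ k * (C * Real.exp (-(2 * k * |g.a|))) := by gcongr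
    _ = D ^ k * C * (Real.exp (2 * |g.a|) ^ k * Real.exp (-(2 * k * |g.a|))) := by ring
    _ = D ^ k * C := by
        rw [← Real.exp_nat_mul, ← Real.exp_add]
        have : (k : ℝ) * (2 * |g.a|) + -(2 * k * |g.a|) = 0 := by ring
        rw [this, Real.exp_zero, mul_one]

theorem integrable_of_mem_oscSpan (hΩ : Ω.IsAlt) (hΩ' : Ω.Nondegenerate) (hκ : κ ≠ 0)
    {f : R0 Ω → ℂ} (hf : f ∈ oscSpan Ω κ) (hfm : AEStronglyMeasurable f (haarR0 Ω)) :
    Integrable f (haarR0 Ω) := by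
  -- The resulting exponent, twice the dimension plus two, exceeds the dimension, so the bound is
  -- integrable.
  obtain ⟨C, hC⟩ := exists_polynomial_decay hΩ hΩ' hκ hf (Module.finrank ℝ (R0 Ω) + 1)
  have hi := integrable_one_add_norm (μ := haarR0 Ω)
    (r := ((2 * (Module.finrank ℝ (R0 Ω) + 1) : ℕ) : ℝ)) (by push_cast; linarith)
  refine (hi.const_mul C).mono' hfm (Filter.Eventually.of_forall fun g => ?_)
  rw [Real.rpow_neg (by positivity), Real.rpow_natCast, ← div_eq_mul_inv, le_div_iff₀ (by positivity),
    mul_comm]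
  exact hC g

theorem amp_amplitude (k : ℕ) : Amp fun a b c =>
    Real.sqrt (Real.cosh (2 * (b - c)) * Real.cosh (2 * (c - a)) * Real.cosh (2 * (a - b))
      * (Real.cosh (b - c) * Real.cosh (c - a) * Real.cosh (a - b)) ^ k) := by
  refine (((Amp.sqrt_cosh (isLin_sub₁₂.const_mul 2)).mul
    (Amp.sqrt_cosh (isLin_sub₂₀.const_mul 2))).mul
    (Amp.sqrt_cosh (isLin_sub₀₁.const_mul 2))).mul
    ((((Amp.sqrt_cosh isLin_sub₁₂).mul (Amp.sqrt_cosh isLin_sub₂₀)).mul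
      (Amp.sqrt_cosh isLin_sub₀₁)).pow k) |>.congr fun a b c => ?_
  have hs : ∀ {x : ℝ}, 0 ≤ x → Real.sqrt (x ^ k) = Real.sqrt x ^ k := fun {x} hx => by
    conv_lhs => rw [← Real.sq_sqrt hx, ← pow_mul, mul_comm, pow_mul]
    rw [Real.sqrt_sq (by positivity)]
  rw [Real.sqrt_mul (by positivity), Real.sqrt_mul (by positivity), Real.sqrt_mul (by positivity),
    hs (by positivity), Real.sqrt_mul (by positivity), Real.sqrt_mul (by positivity)]

theorem starProd_eq_osc (θ : ℝ) (u v : R0 Ω → ℂ) :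
    starProd θ u v = (1 / (θ : ℂ) ^ dimR0 V) • osc (2 / θ) (fun a b c =>
      Real.sqrt (Real.cosh (2 * (b - c)) * Real.cosh (2 * (c - a)) * Real.cosh (2 * (a - b))
      * (Real.cosh (b - c) * Real.cosh (c - a) * Real.cosh (a - b)) ^ (dimR0 V - 2))) u v := by
  funext g₀
  rw [starProd, Pi.smul_apply, smul_eq_mul, osc]
  congr 1
  refine integral_congr_ae (Filter.Eventually.of_forall fun p => ?_)
  have h : 2 * Complex.I / (θ : ℂ) * (phase g₀ p.1 p.2 : ℂ)
      = ((2 / θ * phase g₀ p.1 p.2 : ℝ) : ℂ) * Complex.I := by push_cast; ring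
  simp only [integrand, oscIntegrand, h]
  rfl

theorem integrable_starProd (hΩ : Ω.IsAlt) (hΩ' : Ω.Nondegenerate) {θ : ℝ} (hθ : θ ≠ 0)
    {u v : R0 Ω → ℂ} (hu : IsTest u) (hv : IsTest v) (hc : Continuous (starProd θ u v)) :
    Integrable (starProd θ u v) (haarR0 Ω) := by
  refine integrable_of_mem_oscSpan hΩ hΩ' (div_ne_zero two_ne_zero hθ) ?_ hc.aestronglyMeasurable
  rw [starProd_eq_osc]
  exact Submodule.smul_mem _ _ (osc_mem (amp_amplitude _) hu hv)

end Decay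

/-! ### The integral of the product. -/

section Trace

variable {E : Type*} [NormedAddCommGroup E] [InnerProductSpace ℝ E]
  [FiniteDimensional ℝ E] [MeasurableSpace E] [BorelSpace E]

/-- The inverse of `freq w₀ w₁`. -/
def unfreq (w₀ w₁ ξ : ℝ × E) : ℝ × E :=
  (w₁.1 + Real.arsinh ξ.1 / 2,
    (Real.cosh (Real.arsinh ξ.1 / 2) * Real.cosh (w₀.1 - w₁.1))⁻¹ • ξ.2
      + ((Real.cosh (w₀.1 - w₁.1))⁻¹ * Real.cosh (w₁.1 + Real.arsinh ξ.1 / 2 - w₀.1)) • w₁.2)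

/-- The Jacobian of `unfreq w₀ w₁`. -/
def unfreqDensity (w₀ w₁ ξ : ℝ × E) : ℝ :=
  (Real.sqrt (1 + ξ.1 ^ 2))⁻¹ / 2 *
    (Real.cosh (Real.arsinh ξ.1 / 2) * Real.cosh (w₀.1 - w₁.1))⁻¹ ^ Module.finrank ℝ E

theorem freq_unfreq (w₀ w₁ ξ : ℝ × E) : freq w₀ w₁ (unfreq w₀ w₁ ξ) = ξ := by
  have h1 : w₁.1 + Real.arsinh ξ.1 / 2 - w₁.1 = Real.arsinh ξ.1 / 2 := by ring
  have h2 : w₁.1 - (w₁.1 + Real.arsinh ξ.1 / 2) = -(Real.arsinh ξ.1 / 2) := by ring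
  have h3 : 2 * (Real.arsinh ξ.1 / 2) = Real.arsinh ξ.1 := by ring
  have c1 := (Real.cosh_pos (Real.arsinh ξ.1 / 2)).ne'
  have c2 := (Real.cosh_pos (w₀.1 - w₁.1)).ne'
  refine Prod.ext ?_ ?_
  · simp only [freq, unfreq, h1, h3, Real.sinh_arsinh]
  · simp only [freq, unfreq, h2, Real.cosh_neg, smul_add, smul_sub, smul_smul]
    rw [show Real.cosh (Real.arsinh ξ.1 / 2) * (Real.cosh (w₀.1 - w₁.1) *
      (Real.cosh (Real.arsinh ξ.1 / 2) * Real.cosh (w₀.1 - w₁.1))⁻¹) = 1 by field_simp,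
      show Real.cosh (Real.arsinh ξ.1 / 2) * (Real.cosh (w₀.1 - w₁.1) *
      ((Real.cosh (w₀.1 - w₁.1))⁻¹ * Real.cosh (w₁.1 + Real.arsinh ξ.1 / 2 - w₀.1)))
      = Real.cosh (Real.arsinh ξ.1 / 2) * Real.cosh (w₁.1 + Real.arsinh ξ.1 / 2 - w₀.1) by
        field_simp]
    module

theorem continuous_unfreq {T : Type*} [TopologicalSpace T] {f g h : T → ℝ × E} (hf : Continuous f)
    (hg : Continuous g) (hh : Continuous h) : Continuous fun t => unfreq (f t) (g t) (h t) := by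
  have h1 : ∀ t, Real.cosh (Real.arsinh (h t).1 / 2) * Real.cosh ((f t).1 - (g t).1) ≠ 0 :=
    fun t => mul_ne_zero (Real.cosh_pos _).ne' (Real.cosh_pos _).ne'
  have h2 : ∀ t, Real.cosh ((f t).1 - (g t).1) ≠ 0 := fun t => (Real.cosh_pos _).ne'
  have h3 := Real.continuous_arsinh
  unfold unfreq
  fun_prop (disch := assumption)

theorem continuous_unfreqDensity {T : Type*} [TopologicalSpace T] {f g h : T → ℝ × E}
    (hf : Continuous f) (hg : Continuous g) (hh : Continuous h) :
    Continuous fun t => unfreqDensity (f t) (g t) (h t) := by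
  have h1 : ∀ t, Real.cosh (Real.arsinh (h t).1 / 2) * Real.cosh ((f t).1 - (g t).1) ≠ 0 :=
    fun t => mul_ne_zero (Real.cosh_pos _).ne' (Real.cosh_pos _).ne'
  have h2 : ∀ t, Real.sqrt (1 + (h t).1 ^ 2) ≠ 0 := fun t => (Real.sqrt_pos.2 (by positivity)).ne'
  have h3 := Real.continuous_arsinh
  unfold unfreqDensity
  fun_prop (disch := assumption)

theorem changeVar_unfreq (w₀ w₁ : ℝ × E) :
    ChangeVar (unfreq w₀ w₁) (unfreqDensity w₀ w₁) 1 volume volume := by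
  have h3 := Real.continuous_arsinh
  refine changeVar_affine (E := E) (σ := fun a => w₁.1 + Real.arsinh a / 2)
    (σ' := fun a => (Real.sqrt (1 + a ^ 2))⁻¹ / 2)
    (k := fun a => (Real.cosh (Real.arsinh a / 2) * Real.cosh (w₀.1 - w₁.1))⁻¹)
    (l := fun a => ((Real.cosh (w₀.1 - w₁.1))⁻¹ *
      Real.cosh (w₁.1 + Real.arsinh a / 2 - w₀.1)) • w₁.2)
    (fun a => ((Real.hasDerivAt_arsinh a).div_const 2).const_add _) ?_
    (fun a => by positivity) (by fun_prop) (fun a => by positivity) (by fun_prop) (by fun_prop)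
  refine ⟨fun a b h => ?_, fun y => ⟨Real.sinh (2 * (y - w₁.1)), ?_⟩⟩
  · have : Real.arsinh a = Real.arsinh b := by linarith
    exact Real.arsinh_injective this
  · simp only [Real.arsinh_sinh]
    ring

/-- At frequency zero the second and third base points coincide, and the output base point `w₀` is
left to parametrise the frequencies. The exact constant 1 is recorded because the trace formula
holds with no undetermined factor. -/
theorem changeVar_freq (w : ℝ × E) :
    ChangeVar (fun w₀ => freq w w w₀)
      (fun w₀ => 2 * Real.cosh (2 * (w₀.1 - w.1)) * Real.cosh (w.1 - w₀.1) ^ Module.finrank ℝ E)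
      1 volume volume := by
  refine (changeVar_affine (E := E) (σ := fun a => Real.sinh (2 * (a - w.1)))
    (σ' := fun a => 2 * Real.cosh (2 * (a - w.1))) (k := fun a => Real.cosh (w.1 - a))
    (l := fun a => -((Real.cosh (w.1 - a) * Real.cosh (a - w.1)) • w.2))
    (hasDerivAt_sinh_two_mul w.1) (bijective_sinh_two_mul w.1)
    (fun a => mul_nonneg zero_le_two (Real.cosh_pos _).le) (by fun_prop)
    (fun a => Real.cosh_pos _) (by fun_prop) (by fun_prop)).congr (fun w₀ => ?_) (fun _ => rfl)
  simp only [freq, sub_self, Real.cosh_zero, one_smul, smul_sub, smul_smul]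
  exact Prod.ext rfl (sub_eq_add_neg _ _).symm

theorem freq_swap (w w₀ : ℝ × E) : freq w w₀ w = -freq w w w₀ := by
  have h1 : 2 * (w.1 - w₀.1) = -(2 * (w₀.1 - w.1)) := by ring
  have h2 : Real.cosh (w.1 - w₀.1) = Real.cosh (w₀.1 - w.1) := by
    rw [← Real.cosh_neg]; congr 1; ring
  simp only [freq, h1, Real.sinh_neg, sub_self, Real.cosh_zero, h2, Prod.neg_mk, one_smul,
    ← smul_neg, neg_sub]

variable {κ : ℝ} {U₁ U₂ : (ℝ × E) × (ℝ × E) → ℂ}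

/-- The integrand of the product in the frequency variable. -/
def freqIntegrand (κ : ℝ) (U₁ U₂ : (ℝ × E) × (ℝ × E) → ℂ) (w₀ w₁ ξ : ℝ × E) : ℂ :=
  (unfreqDensity w₀ w₁ ξ : ℂ) * ((wAmp w₀ w₁ (unfreq w₀ w₁ ξ) : ℂ) *
    (pft κ U₁ w₁ (freq w₁ (unfreq w₀ w₁ ξ) w₀) *
      pft κ U₂ (unfreq w₀ w₁ ξ) (freq (unfreq w₀ w₁ ξ) w₀ w₁)))

theorem continuous_freqIntegrand (h₁ : IsTestW U₁) (h₂ : IsTestW U₂) (κ : ℝ) (w₀ : ℝ × E) :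
    Continuous fun p : (ℝ × E) × (ℝ × E) => freqIntegrand κ U₁ U₂ w₀ p.1 p.2 := by
  have k₁ : Continuous fun p : (ℝ × E) × (ℝ × E) => unfreqDensity w₀ p.1 p.2 :=
    continuous_unfreqDensity continuous_const continuous_fst continuous_snd
  have k₂ : Continuous fun p : (ℝ × E) × (ℝ × E) => unfreq w₀ p.1 p.2 :=
    continuous_unfreq continuous_const continuous_fst continuous_snd
  have k₃ : Continuous fun p : (ℝ × E) × (ℝ × E) =>
      pft κ U₁ p.1 (freq p.1 (unfreq w₀ p.1 p.2) w₀) :=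
    h₁.continuous_pft_comp κ continuous_fst (by fun_prop)
  have k₄ : Continuous fun p : (ℝ × E) × (ℝ × E) =>
      pft κ U₂ (unfreq w₀ p.1 p.2) (freq (unfreq w₀ p.1 p.2) w₀ p.1) :=
    h₂.continuous_pft_comp κ k₂ (by fun_prop)
  unfold freqIntegrand
  fun_prop

theorem freqIntegrand_eq_zero (h₁ : IsTestW U₁) (h₂ : IsTestW U₂) (κ : ℝ) (w₀ : ℝ × E) :
    ∃ s t : Set (ℝ × E), IsCompact s ∧ IsCompact t ∧
      ∀ w₁ ξ, (w₁ ∉ s ∨ ξ ∉ t) → freqIntegrand κ U₁ U₂ w₀ w₁ ξ = 0 := by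
  obtain ⟨s₁, hs₁, k₁⟩ := h₁.pft_eq_zero κ
  obtain ⟨s₂, hs₂, k₂⟩ := h₂.pft_eq_zero κ
  refine ⟨s₁, (fun p : (ℝ × E) × (ℝ × E) => freq w₀ p.1 p.2) '' (s₁ ×ˢ s₂), hs₁,
    (hs₁.prod hs₂).image (by fun_prop), fun w₁ ξ h => ?_⟩
  by_cases h1 : w₁ ∈ s₁
  · have h2 : unfreq w₀ w₁ ξ ∉ s₂ := fun hc =>
      (h.resolve_left (not_not.2 h1)) ⟨(w₁, unfreq w₀ w₁ ξ), ⟨h1, hc⟩, freq_unfreq w₀ w₁ ξ⟩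
    simp [freqIntegrand, k₂ _ h2]
  · simp [freqIntegrand, k₁ _ h1]

attribute [local irreducible] freqIntegrand starWIntegrand pft freq unfreq

/-- The partial Fourier transform of the product. -/
def starFreq (κ : ℝ) (U₁ U₂ : (ℝ × E) × (ℝ × E) → ℂ) (w₀ ξ : ℝ × E) : ℂ :=
  ∫ w₁, freqIntegrand κ U₁ U₂ w₀ w₁ ξ

theorem continuous_starFreq (h₁ : IsTestW U₁) (h₂ : IsTestW U₂) (κ : ℝ) (w₀ : ℝ × E) :
    Continuous (starFreq κ U₁ U₂ w₀) := by
  obtain ⟨s, t, hs, -, h0⟩ := freqIntegrand_eq_zero h₁ h₂ κ w₀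
  exact continuous_integral_of_support (f := fun ξ w₁ => freqIntegrand κ U₁ U₂ w₀ w₁ ξ)
    ((continuous_freqIntegrand h₁ h₂ κ w₀).comp continuous_swap) hs
    fun ξ w₁ hw => h0 w₁ ξ (Or.inl hw)

theorem hasCompactSupport_starFreq (h₁ : IsTestW U₁) (h₂ : IsTestW U₂) (κ : ℝ) (w₀ : ℝ × E) :
    HasCompactSupport (starFreq κ U₁ U₂ w₀) := by
  obtain ⟨s, t, -, ht, h0⟩ := freqIntegrand_eq_zero h₁ h₂ κ w₀
  refine HasCompactSupport.intro ht fun ξ hξ => ?_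
  simp [starFreq, h0 _ ξ (Or.inr hξ)]

/-- The variable `ζ₀` occurs only in the exponential with frequency `freq w₀ w₁ w₂`. Taking this
frequency as integration variable in place of `w₂` and interchanging the integrals exhibits a
Fourier transform. -/
theorem starW_eq_ft (h₁ : IsTestW U₁) (h₂ : IsTestW U₂) (κ : ℝ) (w₀ ζ₀ : ℝ × E) :
    starW κ U₁ U₂ (w₀, ζ₀) = ft κ (starFreq κ U₁ U₂ w₀) ζ₀ := by
  obtain ⟨s', hs', h0'⟩ := starWIntegrand_eq_zero h₁ h₂ κ
  obtain ⟨s, t, hs, ht, h0⟩ := freqIntegrand_eq_zero h₁ h₂ κ w₀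
  have hc := continuous_starWIntegrand h₁ h₂ κ
  have hc' : Continuous (starWIntegrand κ U₁ U₂ (w₀, ζ₀)) :=
    hc.comp (Continuous.prodMk_right (w₀, ζ₀))
  have hi : Integrable (starWIntegrand κ U₁ U₂ (w₀, ζ₀)) :=
    hc'.integrable_of_hasCompactSupport (HasCompactSupport.intro hs' (h0' _))
  let F : ℝ × E → ℝ × E → ℂ := fun w₁ ξ =>
    Complex.exp ((κ * pair ξ ζ₀ : ℝ) * Complex.I) * freqIntegrand κ U₁ U₂ w₀ w₁ ξ
  have hFc : Continuous (Function.uncurry F) :=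
    (by fun_prop : Continuous fun p : (ℝ × E) × (ℝ × E) =>
      Complex.exp ((κ * pair p.2 ζ₀ : ℝ) * Complex.I)).mul
      (continuous_freqIntegrand h₁ h₂ κ w₀)
  have hFs : HasCompactSupport (Function.uncurry F) := by
    refine HasCompactSupport.intro (hs.prod ht) fun p hp => ?_
    rw [Set.mem_prod, not_and_or] at hp
    simp [F, Function.uncurry, h0 _ _ hp]
  have hFi : Integrable (Function.uncurry F)
      ((volume : Measure (ℝ × E)).prod (volume : Measure (ℝ × E))) :=
    hFc.integrable_of_hasCompactSupport hFs
  calc starW κ U₁ U₂ (w₀, ζ₀)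
      = ∫ w₁ : ℝ × E, ∫ w₂ : ℝ × E, starWIntegrand κ U₁ U₂ (w₀, ζ₀) (w₁, w₂) :=
        integral_volume_prod hi
    _ = ∫ w₁ : ℝ × E, ∫ ξ : ℝ × E, F w₁ ξ := by
        refine integral_congr_ae (Filter.Eventually.of_forall fun w₁ => ?_)
        have h1 := (changeVar_unfreq w₀ w₁).integral
          (f := fun w₂ => starWIntegrand κ U₁ U₂ (w₀, ζ₀) (w₁, w₂))
          (hc'.comp (Continuous.prodMk_right w₁)).measurable
        rw [Complex.ofReal_one, one_mul] at h1
        simp only [← h1]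
        refine integral_congr_ae (Filter.Eventually.of_forall fun ξ => ?_)
        simp only [F, starWIntegrand, freqIntegrand, freq_unfreq, pair_comm ζ₀ ξ]
        ring
    _ = ∫ ξ : ℝ × E, ∫ w₁ : ℝ × E, F w₁ ξ := integral_integral_swap hFi
    _ = ft κ (starFreq κ U₁ U₂ w₀) ζ₀ := by
        simp only [F, integral_const_mul, ft, starFreq]

/-- Frequency zero means `w₂ = w₁`. There the density of `unfreq` times the amplitude equals one
quarter of the Jacobian in `changeVar_freq`, and the two remaining frequencies are opposite, as the
bilinear Parseval formula requires. -/
theorem starFreq_zero (κ : ℝ) (U₁ U₂ : (ℝ × E) × (ℝ × E) → ℂ) (w₀ : ℝ × E) :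
    starFreq κ U₁ U₂ w₀ 0 = ∫ w₁ : ℝ × E, (4 : ℂ)⁻¹ *
      (((2 * Real.cosh (2 * (w₀.1 - w₁.1)) * Real.cosh (w₁.1 - w₀.1) ^ Module.finrank ℝ E : ℝ) : ℂ)
        * (pft κ U₁ w₁ (freq w₁ w₁ w₀) * pft κ U₂ w₁ (-freq w₁ w₁ w₀))) := by
  refine integral_congr_ae (Filter.Eventually.of_forall fun w₁ => ?_)
  have hc : Real.cosh (w₁.1 - w₀.1) = Real.cosh (w₀.1 - w₁.1) := by
    rw [← Real.cosh_neg]; congr 1; ring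
  have hc2 : Real.cosh (2 * (w₁.1 - w₀.1)) = Real.cosh (2 * (w₀.1 - w₁.1)) := by
    rw [← Real.cosh_neg]; congr 1; ring
  have hpos := Real.cosh_pos (w₀.1 - w₁.1)
  have h1 : unfreq w₀ w₁ 0 = w₁ := by
    refine Prod.ext ?_ ?_
    · simp [unfreq]
    · simp only [unfreq, Prod.fst_zero, Prod.snd_zero, Real.arsinh_zero, zero_div, add_zero,
        smul_zero, zero_add, hc, inv_mul_cancel₀ hpos.ne', one_smul]
  have h2 : unfreqDensity w₀ w₁ 0 * wAmp w₀ w₁ w₁ = 4⁻¹ *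
      (2 * Real.cosh (2 * (w₀.1 - w₁.1)) * Real.cosh (w₁.1 - w₀.1) ^ Module.finrank ℝ E) := by
    simp only [unfreqDensity, wAmp, hc, hc2, mul_zero, Prod.fst_zero, Real.arsinh_zero, zero_div,
      Real.cosh_zero, one_mul, sub_self, Real.sqrt_mul_self (Real.cosh_pos _).le]
    rw [mul_pow, inv_pow]
    norm_num
    field_simp
    norm_num
  have h3 := congrArg (fun r : ℝ => (r : ℂ)) h2
  simp only [Complex.ofReal_mul] at h3
  simp only [freqIntegrand, h1, freq_swap]
  rw [← mul_assoc, h3]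
  push_cast
  ring

theorem integral_starW (hκ : κ ≠ 0) (h₁ : IsTestW U₁) (h₂ : IsTestW U₂)
    (hi : Integrable (starW κ U₁ U₂)) :
    ∫ p, starW κ U₁ U₂ p = ftConst E κ ^ 2 / 4 * ∫ p, U₁ p * U₂ p := by
  let μ : Measure (ℝ × E) := volume
  let Q : (ℝ × E) × (ℝ × E) → ℂ := fun p => pft κ U₁ p.1 p.2 * pft κ U₂ p.1 (-p.2)
  have hQc : Continuous Q := (h₁.continuous_pft κ).mul
    (h₂.continuous_pft_comp κ continuous_fst continuous_snd.neg)
  have hL : ∀ {U : (ℝ × E) × (ℝ × E) → ℂ}, IsTestW U →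
      MemLp (fun p : (ℝ × E) × (ℝ × E) => pft κ U p.1 p.2) 2 (μ.prod μ) := fun {U} hU => by
    have h1 := lintegral_lt_top_of_memLp_two
      (hU.1.continuous.memLp_of_hasCompactSupport (μ := volume) (p := 2) hU.2)
    exact memLp_two_of_lintegral (hU.continuous_pft κ).aestronglyMeasurable
      ((hU.lintegral_pft_sq hκ).trans_lt (ENNReal.mul_lt_top (by simp) h1))
  have hneg : MeasurePreserving (Prod.map id Neg.neg : (ℝ × E) × (ℝ × E) → _) (μ.prod μ)
      (μ.prod μ) := (MeasurePreserving.id μ).prod (Measure.measurePreserving_neg μ)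
  have hQi : Integrable Q (μ.prod μ) :=
    (hL h₁).integrable_mul ((hL h₂).comp_measurePreserving hneg)
  have hcv : ChangeVar (fun p : (ℝ × E) × (ℝ × E) => (p.1, freq p.1 p.1 p.2))
      (fun p => 2 * Real.cosh (2 * (p.2.1 - p.1.1)) *
        Real.cosh (p.1.1 - p.2.1) ^ Module.finrank ℝ E) 1 (μ.prod μ) (μ.prod μ) :=
    ChangeVar.of_fiber (Θ := fun w w₀ => freq w w w₀)
      (ρ := fun w w₀ => 2 * Real.cosh (2 * (w₀.1 - w.1)) *
        Real.cosh (w.1 - w₀.1) ^ Module.finrank ℝ E) changeVar_freq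
      (by unfold Function.uncurry; exact Continuous.measurable (by fun_prop))
      (by unfold Function.uncurry; exact Continuous.measurable (by fun_prop))
  have hRi := (hcv.integrable hQc.measurable hQi).swap
  have hRe := hcv.integral hQc.measurable
  have hUi : Integrable (fun p => U₁ p * U₂ p) (μ.prod μ) :=
    (h₁.1.continuous.mul h₂.1.continuous).integrable_of_hasCompactSupport h₁.2.mul_right
  have hi' : Integrable (starW κ U₁ U₂) (μ.prod μ) := hi
  calc ∫ p, starW κ U₁ U₂ p
      = ∫ w₀ : ℝ × E, ∫ ζ₀ : ℝ × E, starW κ U₁ U₂ (w₀, ζ₀) := integral_volume_prod hi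
    _ = ∫ w₀ : ℝ × E, (ftConst E κ : ℂ) * starFreq κ U₁ U₂ w₀ 0 := by
        refine integral_congr_ae ?_
        -- Inversion needs the Fourier transform to be integrable in `ζ₀`; integrability of the
        -- product gives this for almost every `w₀`.
        filter_upwards [hi'.prod_right_ae] with w₀ hw
        have hft : (fun ζ₀ => starW κ U₁ U₂ (w₀, ζ₀)) = ft κ (starFreq κ U₁ U₂ w₀) :=
          funext fun ζ₀ => starW_eq_ft h₁ h₂ κ w₀ ζ₀
        rw [hft] at hw ⊢
        exact integral_ft hκ (continuous_starFreq h₁ h₂ κ w₀)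
          ((continuous_starFreq h₁ h₂ κ w₀).integrable_of_hasCompactSupport
            (hasCompactSupport_starFreq h₁ h₂ κ w₀)) hw
    _ = (ftConst E κ : ℂ) * ((4 : ℂ)⁻¹ * ∫ p, Q p ∂μ.prod μ) := by
        rw [integral_const_mul]
        simp only [starFreq_zero, integral_const_mul]
        rw [Complex.ofReal_one, one_mul] at hRe
        rw [← hRe, ← integral_prod_swap]
        exact congrArg (fun r => (ftConst E κ : ℂ) * ((4 : ℂ)⁻¹ * r)) (integral_prod _ hRi).symm
    _ = (ftConst E κ : ℂ) * ((4 : ℂ)⁻¹ * ∫ w : ℝ × E,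
          (ftConst E κ : ℂ) * ∫ ζ : ℝ × E, U₁ (w, ζ) * U₂ (w, ζ)) := by
        rw [integral_prod _ hQi]
        congr 2
        refine integral_congr_ae (Filter.Eventually.of_forall fun w => ?_)
        simp only [Q, pft]
        exact integral_ft_mul_ft_neg hκ (h₁.contDiff_slice w) (h₁.hasCompactSupport_slice w)
          (h₂.contDiff_slice w) (h₂.hasCompactSupport_slice w)
    _ = ftConst E κ ^ 2 / 4 * ∫ p, U₁ p * U₂ p := by
        rw [integral_const_mul, integral_volume_prod hUi]
        ring

end Trace

/-! ### The normalising constant and strong closedness. -/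

section Group

variable {V : Type*} [NormedAddCommGroup V] [NormedSpace ℝ V] {Ω : V →ₗ[ℝ] V →ₗ[ℝ] ℝ}
  [FiniteDimensional ℝ V] [MeasurableSpace V] [BorelSpace V]
  {E : Type*} [NormedAddCommGroup E] [InnerProductSpace ℝ E]
  [FiniteDimensional ℝ E] [MeasurableSpace E] [BorelSpace E] {e : V ≃L[ℝ] E × E}

/-- The normalisation `2 π^{-dim R₀ / 2}` of the Haar measure enters here: its square cancels the
quarter and the powers of `π` from the two Fourier constants. Since `dim R₀` is even, `|θ|` and `θ`
have the same power and the sign of `θ` is immaterial. -/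
theorem starConst_mul_ftConst (e : V ≃L[ℝ] E × E) {θ : ℝ} (hθ : θ ≠ 0) :
    starConst V θ * (ftConst E (2 / θ) ^ 2 / 4) = 1 := by
  have hd : dimR0 V = 2 * (Module.finrank ℝ E + 1) := by
    rw [dimR0, finrank_of_chart e]; ring
  have h1 : 2 * Real.pi / |2 / θ| = Real.pi * |θ| := by
    rw [abs_div, abs_two]
    have := abs_pos.2 hθ
    field_simp
  have hπ := Real.pi_pos
  rw [starConst, haarConst, ftConst, hd, h1, div_pow, Real.sq_sqrt (by positivity), ← pow_mul,
    mul_comm (Module.finrank ℝ E + 1) 2, mul_pow, pow_mul |θ|, sq_abs, ← pow_mul]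
  have := pow_ne_zero (2 * (Module.finrank ℝ E + 1)) hθ
  field_simp
  norm_num

theorem integral_starProd (he : IsDarboux Ω e) (hm : liouville Ω = Measure.map e.symm volume)
    {θ : ℝ} (hθ : θ ≠ 0) {u v : R0 Ω → ℂ} (hu : IsTest u) (hv : IsTest v)
    (hi : Integrable (starProd θ u v) (haarR0 Ω)) :
    ∫ g, starProd θ u v g ∂haarR0 Ω = ∫ g, u g * v g ∂haarR0 Ω := by
  have hc : (starConst V θ : ℂ) ≠ 0 := by exact_mod_cast starConst_ne_zero hθ
  have hi' : Integrable (starW (2 / θ) (fun q => u (chart Ω e q)) fun q => v (chart Ω e q)) := by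
    have h1 := ((measurePreserving_chart hm).integrable_comp_emb chart_measurableEmbedding).2 hi
    have h2 : Integrable (starProd θ u v ∘ chart Ω e) := by
      refine (integrable_smul_measure (c := (Real.toNNReal (haarConst V) : ℝ≥0∞)) ?_ ?_).1 h1
      · simp [haarConst_pos]
      · simp
    have h3 : starW (2 / θ) (fun q => u (chart Ω e q)) (fun q => v (chart Ω e q))
        = fun p => (starConst V θ : ℂ)⁻¹ * (starProd θ u v ∘ chart Ω e) p := by
      funext p
      rw [Function.comp_apply, starProd_chart he hm θ hu hv, inv_mul_cancel_left₀ hc]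
    rw [h3]
    exact h2.const_mul _
  have hk := congrArg (fun r : ℝ => (r : ℂ)) (starConst_mul_ftConst (V := V) e hθ)
  push_cast at hk
  rw [integral_haarR0 hm, integral_haarR0 hm]
  simp only [starProd_chart he hm θ hu hv, integral_const_mul]
  rw [integral_starW (div_ne_zero two_ne_zero hθ) (isTestW_comp_chart hu) (isTestW_comp_chart hv)
    hi', ← mul_assoc (starConst V θ : ℂ), hk, one_mul]

end Group

end OscKernel

end

theorem mainTheorem2 {V : Type*} [NormedAddCommGroup V] [NormedSpace ℝ V]
    [FiniteDimensional ℝ V] [MeasurableSpace V] [BorelSpace V]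
    (Ω : V →ₗ[ℝ] V →ₗ[ℝ] ℝ) (hΩ_alt : Ω.IsAlt) (hΩ_nondeg : Ω.Nondegenerate)
    (θ : ℝ) (hθ : θ ≠ 0) :
    -- the oscillatory integral converges absolutely at every point
    (∀ u v : OscKernel.R0 Ω → ℂ, OscKernel.IsTest u → OscKernel.IsTest v →
      ∀ g₀ : OscKernel.R0 Ω, MeasureTheory.Integrable (OscKernel.integrand θ u v g₀)
        ((OscKernel.haarR0 Ω).prod (OscKernel.haarR0 Ω))) ∧
    -- a unique bounded extension to `L²`, a left-invariant Hilbert algebra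
    (∃ M : OscKernel.L2 Ω →L[ℂ] OscKernel.L2 Ω →L[ℂ] OscKernel.L2 Ω,
      OscKernel.Extends θ M ∧
      (∀ M' : OscKernel.L2 Ω →L[ℂ] OscKernel.L2 Ω →L[ℂ] OscKernel.L2 Ω,
        OscKernel.Extends θ M' → M' = M) ∧
      (∀ (g : OscKernel.R0 Ω) (f h : OscKernel.L2 Ω),
        M (OscKernel.leftReg g f) (OscKernel.leftReg g h) = OscKernel.leftReg g (M f h)) ∧
      OscKernel.IsHilbertAlgebra (fun f h : OscKernel.L2 Ω => M f h) star) ∧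
    -- strong closedness
    (∀ u v : OscKernel.R0 Ω → ℂ, OscKernel.IsTest u → OscKernel.IsTest v →
      MeasureTheory.Integrable (OscKernel.starProd θ u v) (OscKernel.haarR0 Ω) ∧
      ∫ g, OscKernel.starProd θ u v g ∂(OscKernel.haarR0 Ω)
        = ∫ g, u g * v g ∂(OscKernel.haarR0 Ω)) := by
  obtain ⟨n, e, he⟩ := OscKernel.exists_darboux hΩ_alt hΩ_nondeg
  have hm := OscKernel.liouville_eq_map he
  have := OscKernel.isAddHaarMeasure_haarR0 hm
  obtain ⟨M, hM, hA⟩ := OscKernel.exists_extension he hm hθ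
  refine ⟨fun u v hu hv g₀ => OscKernel.integrable_integrand θ hu hv g₀,
    ⟨M, hM, fun M' h' => hM.unique h', fun g f h => hM.leftReg hΩ_alt g f h, hA⟩,
    fun u v hu hv => ?_⟩
  have hi := OscKernel.integrable_starProd hΩ_alt hΩ_nondeg hθ hu hv
    (OscKernel.continuous_starProd he hm θ hu hv)
  exact ⟨hi, OscKernel.integral_starProd he hm hθ hu hv hi⟩
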